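/- **Theorem (Global dynamic patterns of entropy solutions).** Let $f\in C^2(\mathbb R)$ with $f''\ge 0$ and $\{f''=0\}$ of Lebesgue measure zero, and let $\varphi\in L^\infty(\mathbb R)$. Let $u$ be the entropy solution of $u_t+f(u)_x=0$ on $\mathbb R\times(0,\infty)$, $u|_{t=0}=\varphi$: $u$ is bounded and measurable; $\iint (u\psi_t+f(u)\psi_x)\,dx\,dt=0$ for all $\psi\in C_c^\infty(\mathbb R\times(0,\infty))$; $\int_{x_1}^{x_2}u(x,t)\,dx\to\int_{x_1}^{x_2}\varphi\,dx$ as $t\to0+$ for all $x_1,x_2$; $f'(u(x_2,t))-f'(u(x_1,t))\le (x_2-x_1)/t$ for all $t>0$, $x_1<x_2$; and $t\mapsto\int_{x_1}^{x_2}u(x,t)\,dx$ is continuous on $(0,\infty)$ for all $x_1,x_2$ (this selects the version in time). *Notation.* $u(x\pm,t)$ are the one-sided limits in $x$. The shock set is $\Gamma=\{(x,t): t>0,\ u(x+,t)<u(x-,t)\}$. A shock is a continuous curve $x=x(t)$, $t\ge t_0\ge 0$, with $(x(t),t)\in\Gamma$ for $t>t_0$; it lies in $H$ if $(x(t),t)\in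 H$ for all $t>t_0$. $\mathcal U(x,t)$ is the set of maximum points of $E(v;x,t)=t\int_0^v f''(s)\,(\varphi(x-tf'(s))-s)\,ds$, $v\in\mathbb R$. The line $L_c(x_0)$: $x=x_0+tf'(c)$, $t>0$, is a divide if $\mathcal U(x,t)=\{c\}$ at all its points; $\mathcal K$ is the union of all divides. Put $\Phi(x)=\int_0^x\varphi$, $\overline u_l=\limsup_{x\to-\infty}\Phi(x)/x$, $\underline u_r=\liminf_{x\to\infty}\Phi(x)/x$. $\bar\Phi=\lim_{N\to\infty}\bar\Phi_N\in[-\infty,\infty)$, where $\bar\Phi_N$ is the convex envelope of $\Phi$ over $[-N,N]$ on that interval and $\Phi$ outside it; $D_\pm\bar\Phi$ are the one-sided derivatives of $\bar\Phi$; $\mathcal K_0=\{\Phi=\bar\Phi\}$. For a bounded component $(e,h)$ of $\mathbb R\setminus\mathcal K_0$ let $c=\frac{\Phi(h)-\Phi(e)}{h-e}$ and $\mathcal H_{(e,h)}=\{(x,t):t>0,\ e+tf'(c)<x<h+tf'(c)\}$. If $\mathcal K_0$ is bounded above, $\mathcal H_\infty=\{t>0,\ x>\sup\mathcal K_0+tf'(\underline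 u_r)\}$; if it is bounded below, $\mathcal H_{-\infty}=\{t>0,\ x<\inf\mathcal K_0+tf'(\overline u_l)\}$. For $F\subset\mathbb R$, $\Delta_F(x_0,t_0)$ is the union over $v\in F$ of the segments $x=x_0+(t-t_0)f'(v)$, $0<t<t_0$; $\Delta(x_0,t_0)=\Delta_{[u(x_0+,t_0),u(x_0-,t_0)]}(x_0,t_0)$. The forward generalized characteristic of $(x_0,t_0)$ is the curve $x=X(t)$, $t\ge t_0$, $X(t_0)=x_0$, along which the triangles $\Delta(X(t),t)$ increase with $t$. A gap of a closed set $S\subset\mathbb R$ is a bounded component of its complement with both end points in $S$. *Pattern.* We say that $u$ has the single-shock pattern in $H$ if: 1. any two shocks in $H$ coincide after a finite time; 2. $\Gamma\cap H$ is non-empty and path-connected; 3. $u$ turns into a single shock asymptotically in $H$: there is a shock $x=\gamma(t)$ in $H$ such that for every compact $K\subset H$ there is a time $T$ after which the forward generalized characteristics of all points of $K$ (these exist) coincide with $\gamma$; 4. at each $(x_0,t_0)\in\Gamma\cap H$, writing $u^\pm=u(x_0\pm,t_0)$ and $\mathcal U=\mathcal U(x_0,t_0)$: (a) $u^-=\max\mathcal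 U$, $u^+=\min\mathcal U$. The forward generalized characteristic $X$ exists, is unique and is a shock, with right derivative $\frac{f(u^-)-f(u^+)}{u^--u^+}$ at $t_0$. $u(X(t)\pm,t)\to u^\pm$ as $t\to t_0+$, and both traces of $u$ tend to $u^-$ (resp. $u^+$) as $(x,t)\to(x_0,t_0)$ to the left (resp. right) of $\Delta(x_0,t_0)$ for $t<t_0$ and of $X$ for $t\ge t_0$. (b) For $v\in\mathcal U$ both traces of $u$ equal $v$ on the segment $\Delta_{\{v\}}(x_0,t_0)$. If $a<b$ and $[a,b]\subset\mathcal U$, there is a centered compression wave: $f'(u(x,t))=\frac{x-x_0}{t-t_0}$ and $u(x,t)\in(a,b)$ on $\Delta_{(a,b)}(x_0,t_0)$, and $f'(\varphi(y))=\frac{x_0-y}{t_0}$ for a.e. $y\in[x_0-t_0f'(b),x_0-t_0f'(a)]$. (c) The shocks reaching $(x_0,t_0)$ from earlier times correspond one-to-one to the gaps $(c,d)$ of $\mathcal U$: each such shock runs in $\Delta_{(c,d)}(x_0,t_0)$ for exactly one gap; every gap has such a shock; two of them with the same gap coincide on some $[s,t_0]$, $s<t_0$. (So there is no gap exactly if the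 point is a discontinuous shock generation point, and there are several exactly if several shocks collide.) The shock $x=\gamma(t)$ of the gap $(c,d)$ has left derivative $\frac{f(d)-f(c)}{d-c}$ at $t_0$, $u(\gamma(t)-,t)\to d$ and $u(\gamma(t)+,t)\to c$ as $t\to t_0-$, and both traces of $u$ tend to $d$ (resp. $c$) as $(x,t)\to(x_0,t_0)$ in $\Delta_{(c,d)}(x_0,t_0)$ to the left (resp. right) of $\gamma$; 5. at each $(x_0,t_0)\in H\setminus\Gamma$, $u(x_0-,t_0)=u(x_0+,t_0)=:c$, and either $\mathcal U=\{c\}$ along the line of slope $f'(c)$ through the point for $0<t<t_1$ with some $t_1>t_0$, or the forward generalized characteristic of the point is a shock. **(i)** Suppose $\overline u_l<\underline u_r$, or $\overline u_l=\underline u_r$ and $\mathcal K_0\ne\varnothing$. Then divides exist, $\bar\Phi>-\infty$, and $L_c(x_0)$ is a divide if and only if $x_0\in\mathcal K_0$ and $D_-\bar\Phi(x_0)\le c\le D_+\bar\Phi(x_0)$; this interval is non-empty for each $x_0\in\mathcal K_0$, and $f'(u(x,t))=(x-x_0)/t$ for $x_0+tf'(D_-\bar\Phi(x_0))<x<x_0+tf'(D_+\bar\Phi(x_0))$.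 If $\overline u_l=\underline u_r$, then $L_c(x_0)$ is a divide if and only if $x_0\in\mathcal K_0$ and $c=\underline u_r$. For each bounded component $(e,h)$, $c=D_+\bar\Phi(e)=D_-\bar\Phi(h)$, and the boundary lines of $\mathcal H_{(e,h)}$ and of $\mathcal H_{\pm\infty}$ are divides. $\mathbb R\times(0,\infty)$ is the disjoint union of $\mathcal K$ and the (at most countably many) regions $\mathcal H_{(e,h)}$ and, where defined, $\mathcal H_{\pm\infty}$. There are no shocks in $\mathcal K$: $u(x-,t)=u(x+,t)$ for $(x,t)\in\mathcal K$. In each of the regions $\mathcal H_{(e,h)}$, $\mathcal H_\infty$, $\mathcal H_{-\infty}$, $u$ has the single-shock pattern. **(ii)** Suppose $\overline u_l>\underline u_r$, or $\overline u_l=\underline u_r$ and $\mathcal K_0=\varnothing$. Then there are no divides, and $u$ has the single-shock pattern in $H=\mathbb R\times(0,\infty)$. -/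

import Mathlib

open Set Filter Topology MeasureTheory
open scoped ContDiff

namespace ScalarLaw

noncomputable section

/-- The flux: `f` is `C²` and convex, and `f''` vanishes only on a Lebesgue null set. -/
def IsFlux (f : ℝ → ℝ) : Prop :=
  ContDiff ℝ 2 f ∧ (∀ v, 0 ≤ deriv (deriv f) v) ∧ volume {v | deriv (deriv f) v = 0} = 0

/-- The open upper half-plane; a point is a pair `(x, t)`. -/
def halfPlane : Set (ℝ × ℝ) := {p | 0 < p.2}

/-- Bounded measurable distributional solutions of `u_t + f(u)_x = 0` on the open upper half-plane
which attain the initial data `φ` in the sense of integrals over intervals. -/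
structure IsWeakSolution (f φ : ℝ → ℝ) (u : ℝ → ℝ → ℝ) : Prop where
  measurable : AEMeasurable (fun p : ℝ × ℝ => u p.1 p.2) (volume.restrict halfPlane)
  bounded : ∃ M, ∀ x t, 0 < t → |u x t| ≤ M
  equation : ∀ ψ : ℝ × ℝ → ℝ, ContDiff ℝ ∞ ψ → HasCompactSupport ψ → tsupport ψ ⊆ halfPlane →
    ∫ p in halfPlane,
      (u p.1 p.2 * fderiv ℝ ψ p (0, 1) + f (u p.1 p.2) * fderiv ℝ ψ p (1, 0)) = 0
  initial : ∀ x₁ x₂ : ℝ,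
    Tendsto (fun t => ∫ x in x₁..x₂, u x t) (𝓝[>] 0) (𝓝 (∫ x in x₁..x₂, φ x))

/-- Entropy solutions: weak solutions with the one-sided Oleinik inequality.  The last field fixes
the version of `u` in time (a change on a null set of times is otherwise invisible to the other
conditions); it extends the continuity in `initial` from time `0` to all times. -/
structure IsEntropySolution (f φ : ℝ → ℝ) (u : ℝ → ℝ → ℝ) : Prop extends
    IsWeakSolution f φ u where
  oleinik : ∀ t, 0 < t → ∀ x₁ x₂, x₁ < x₂ →
    deriv f (u x₂ t) - deriv f (u x₁ t) ≤ (x₂ - x₁) / t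
  time_continuous : ∀ x₁ x₂ : ℝ, ContinuousOn (fun t => ∫ x in x₁..x₂, u x t) (Ioi 0)

/-- The trace `u(x-, t)`. -/
def leftTrace (u : ℝ → ℝ → ℝ) (x t : ℝ) : ℝ := Function.leftLim (fun y => u y t) x

/-- The trace `u(x+, t)`. -/
def rightTrace (u : ℝ → ℝ → ℝ) (x t : ℝ) : ℝ := Function.rightLim (fun y => u y t) x

/-- The shock set: the points `(x, t)`, `t > 0`, with `u(x+, t) < u(x-, t)`. -/
def shockSet (u : ℝ → ℝ → ℝ) : Set (ℝ × ℝ) :=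
  {p | 0 < p.2 ∧ rightTrace u p.1 p.2 < leftTrace u p.1 p.2}

/-- `x = γ(t)`, `t ≥ t₀`, is a shock curve. -/
def IsShockCurve (u : ℝ → ℝ → ℝ) (t₀ : ℝ) (γ : ℝ → ℝ) : Prop :=
  0 ≤ t₀ ∧ ContinuousOn γ (Ici t₀) ∧ ∀ t, t₀ < t → (γ t, t) ∈ shockSet u

/-! ### The function `E` and divides -/

/-- `E(v; x, t) = t ∫₀^v f''(s) (φ(x - t f'(s)) - s) ds`. -/
def E (f φ : ℝ → ℝ) (x t v : ℝ) : ℝ :=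
  t * ∫ s in (0 : ℝ)..v, deriv (deriv f) s * (φ (x - t * deriv f s) - s)

/-- The set `𝒰(x, t)` of maximum points of `E(·; x, t)`. -/
def maximizers (f φ : ℝ → ℝ) (x t : ℝ) : Set ℝ := {w | ∀ v, E f φ x t v ≤ E f φ x t w}

/-- The line `x = x₀ + t f'(c)`, `t > 0`, is a divide. -/
def IsDivide (f φ : ℝ → ℝ) (x₀ c : ℝ) : Prop :=
  ∀ t, 0 < t → maximizers f φ (x₀ + t * deriv f c) t = {c}

/-! ### Mean values of the data, and the convex hull of the primitive -/

/-- `Φ(x) = ∫₀ˣ φ`. -/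
def primitive (φ : ℝ → ℝ) (x : ℝ) : ℝ := ∫ ξ in (0 : ℝ)..x, φ ξ

/-- `limsup_{x → -∞} Φ(x) / x`. -/
def upperMeanLeft (φ : ℝ → ℝ) : ℝ := limsup (fun x => x⁻¹ * primitive φ x) atBot

/-- `liminf_{x → +∞} Φ(x) / x`. -/
def lowerMeanRight (φ : ℝ → ℝ) : ℝ := liminf (fun x => x⁻¹ * primitive φ x) atTop

/-- The convex envelope of `g` over `s`: the largest convex function on `s` lying below `g`. -/
def convexEnvelope (s : Set ℝ) (g : ℝ → ℝ) (x : ℝ) : ℝ :=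
  sSup {y | ∃ k : ℝ → ℝ, ConvexOn ℝ s k ∧ (∀ z ∈ s, k z ≤ g z) ∧ y = k x}

open Classical in
/-- The convex-truncated function `Φ̄_N`. -/
def truncatedHull (φ : ℝ → ℝ) (N x : ℝ) : ℝ :=
  if |x| ≤ N then convexEnvelope (Icc (-N) N) (primitive φ) x else primitive φ x

/-- The convex hull `Φ̄ = lim_{N → ∞} Φ̄_N`, with values in `[-∞, ∞)`; the sequence is eventually
nonincreasing in `N`, so that the limit exists. -/
def hull (φ : ℝ → ℝ) (x : ℝ) : EReal :=
  limUnder atTop (fun N : ℝ => ((truncatedHull φ N x : ℝ) : EReal))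

/-- The left derivative of `Φ̄` (used where `Φ̄` is finite, hence convex). -/
def hullLeftDeriv (φ : ℝ → ℝ) (x : ℝ) : ℝ := derivWithin (fun y => (hull φ y).toReal) (Iio x) x

/-- The right derivative of `Φ̄` (used where `Φ̄` is finite, hence convex). -/
def hullRightDeriv (φ : ℝ → ℝ) (x : ℝ) : ℝ := derivWithin (fun y => (hull φ y).toReal) (Ioi x) x

/-- The contact set `𝒦₀ = {Φ = Φ̄}`. -/
def contactSet (φ : ℝ → ℝ) : Set ℝ := {x | ((primitive φ x : ℝ) : EReal) = hull φ x}

/-! ### The partition of the upper half-plane -/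

/-- `(a, b)` is a bounded component of the complement of the closed set `S`. -/
def IsGap (S : Set ℝ) (a b : ℝ) : Prop := a < b ∧ a ∈ S ∧ b ∈ S ∧ Disjoint (Ioo a b) S

/-- The slope of `Φ` over `[e, h]`. -/
def gapSlope (φ : ℝ → ℝ) (e h : ℝ) : ℝ := (primitive φ h - primitive φ e) / (h - e)

/-- The strip over a bounded component `(e, h)` of the complement of the contact set. -/
def strip (f φ : ℝ → ℝ) (e h : ℝ) : Set (ℝ × ℝ) :=
  {p | 0 < p.2 ∧ e + p.2 * deriv f (gapSlope φ e h) < p.1 ∧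
    p.1 < h + p.2 * deriv f (gapSlope φ e h)}

/-- The region over the component `(sup 𝒦₀, ∞)`. -/
def rightRegion (f φ : ℝ → ℝ) : Set (ℝ × ℝ) :=
  {p | 0 < p.2 ∧ sSup (contactSet φ) + p.2 * deriv f (lowerMeanRight φ) < p.1}

/-- The region over the component `(-∞, inf 𝒦₀)`. -/
def leftRegion (f φ : ℝ → ℝ) : Set (ℝ × ℝ) :=
  {p | 0 < p.2 ∧ p.1 < sInf (contactSet φ) + p.2 * deriv f (upperMeanLeft φ)}

/-- The family of all the regions over the components of the complement of the contact set. -/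
def regions (f φ : ℝ → ℝ) : Set (Set (ℝ × ℝ)) :=
  {H | (∃ e h, IsGap (contactSet φ) e h ∧ H = strip f φ e h) ∨
    (BddAbove (contactSet φ) ∧ H = rightRegion f φ) ∨
    (BddBelow (contactSet φ) ∧ H = leftRegion f φ)}

/-- The union `𝒦` of all the divides. -/
def divideSet (f φ : ℝ → ℝ) : Set (ℝ × ℝ) :=
  {p | 0 < p.2 ∧ ∃ x₀ c, IsDivide f φ x₀ c ∧ p.1 = x₀ + p.2 * deriv f c}

/-! ### Backward triangles and forward generalized characteristics -/

/-- `Δ_F(x₀, t₀)`: the union over `v ∈ F` of the segments `x = x₀ + (t - t₀) f'(v)`,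
`0 < t < t₀`. -/
def fan (f : ℝ → ℝ) (F : Set ℝ) (x₀ t₀ : ℝ) : Set (ℝ × ℝ) :=
  {p | 0 < p.2 ∧ p.2 < t₀ ∧ ∃ v ∈ F, p.1 = x₀ + (p.2 - t₀) * deriv f v}

/-- The backward characteristic triangle of `(x₀, t₀)`. -/
def triangle (f : ℝ → ℝ) (u : ℝ → ℝ → ℝ) (x₀ t₀ : ℝ) : Set (ℝ × ℝ) :=
  fan f (Icc (rightTrace u x₀ t₀) (leftTrace u x₀ t₀)) x₀ t₀

/-- `x = X(t)`, `t ≥ t₀`, is the forward generalized characteristic of `(x₀, t₀)`. -/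
def IsForwardChar (f : ℝ → ℝ) (u : ℝ → ℝ → ℝ) (x₀ t₀ : ℝ) (X : ℝ → ℝ) : Prop :=
  X t₀ = x₀ ∧ ∀ t₁ t₂, t₀ ≤ t₁ → t₁ < t₂ → triangle f u (X t₁) t₁ ⊆ triangle f u (X t₂) t₂

/-- `x = γ(t)`, `s ≤ t ≤ t₀`, is a shock reaching the point `(x₀, t₀)` from earlier times. -/
def IsArrivingShock (u : ℝ → ℝ → ℝ) (x₀ t₀ s : ℝ) (γ : ℝ → ℝ) : Prop :=
  0 ≤ s ∧ s < t₀ ∧ ContinuousOn γ (Icc s t₀) ∧ γ t₀ = x₀ ∧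
    ∀ t ∈ Ioo s t₀, (γ t, t) ∈ shockSet u

/-- The curve `x = γ(t)` runs in the fan `Δ_(c,d)(x₀, t₀)` for `s < t < t₀`. -/
def RunsInFan (f : ℝ → ℝ) (c d x₀ t₀ s : ℝ) (γ : ℝ → ℝ) : Prop :=
  ∀ t ∈ Ioo s t₀, (γ t, t) ∈ fan f (Ioo c d) x₀ t₀

/-- The region to the left of the backward triangle of `(x₀, t₀)` and of the curve `X` issuing
from this point. -/
def leftSide (f : ℝ → ℝ) (u : ℝ → ℝ → ℝ) (x₀ t₀ : ℝ) (X : ℝ → ℝ) : Set (ℝ × ℝ) :=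
  {p | 0 < p.2 ∧ (t₀ ≤ p.2 → p.1 < X p.2) ∧
    (p.2 < t₀ → p.1 < x₀ + (p.2 - t₀) * deriv f (leftTrace u x₀ t₀))}

/-- The region to the right of the backward triangle of `(x₀, t₀)` and of the curve `X` issuing
from this point. -/
def rightSide (f : ℝ → ℝ) (u : ℝ → ℝ → ℝ) (x₀ t₀ : ℝ) (X : ℝ → ℝ) : Set (ℝ × ℝ) :=
  {p | 0 < p.2 ∧ (t₀ ≤ p.2 → X p.2 < p.1) ∧
    (p.2 < t₀ → x₀ + (p.2 - t₀) * deriv f (rightTrace u x₀ t₀) < p.1)}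

/-- Both traces of `u` tend to `a` as `(x, t) → (x₀, t₀)` in `S`. -/
def TracesTendsto (u : ℝ → ℝ → ℝ) (S : Set (ℝ × ℝ)) (x₀ t₀ a : ℝ) : Prop :=
  Tendsto (fun p : ℝ × ℝ => leftTrace u p.1 p.2) (𝓝[S] (x₀, t₀)) (𝓝 a) ∧
  Tendsto (fun p : ℝ × ℝ => rightTrace u p.1 p.2) (𝓝[S] (x₀, t₀)) (𝓝 a)

/-- The structure of `u` at a point of the shock set.  The gaps `(c, d)` of `𝒰(x₀, t₀)` are the
components of `[u(x₀+,t₀), u(x₀-,t₀)] \ 𝒰(x₀, t₀)`.  They correspond one-to-one to the shocks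
reaching the point, and nondegenerate intervals in `𝒰(x₀, t₀)` to centered compression waves: no
gap means that the shock is generated at the point, the single gap `(u(x₀+,t₀), u(x₀-,t₀))` that
the point is regular, a smaller single gap that one shock meets compression waves, and several
gaps that several shocks collide. -/
structure FineStructure (f φ : ℝ → ℝ) (u : ℝ → ℝ → ℝ) (x₀ t₀ : ℝ) : Prop where
  greatest : IsGreatest (maximizers f φ x₀ t₀) (leftTrace u x₀ t₀)
  least : IsLeast (maximizers f φ x₀ t₀) (rightTrace u x₀ t₀)
  /-- exactly one shock leaves the point -/
  forward_exists : ∃ X, IsForwardChar f u x₀ t₀ X ∧ IsShockCurve u t₀ X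
  forward_unique : ∀ X Y, IsForwardChar f u x₀ t₀ X → IsForwardChar f u x₀ t₀ Y →
    ∀ t, t₀ ≤ t → X t = Y t
  right_deriv : ∀ X, IsForwardChar f u x₀ t₀ X →
    HasDerivWithinAt X ((f (leftTrace u x₀ t₀) - f (rightTrace u x₀ t₀)) /
      (leftTrace u x₀ t₀ - rightTrace u x₀ t₀)) (Ici t₀) t₀
  forward_limits : ∀ X, IsForwardChar f u x₀ t₀ X →
    Tendsto (fun t => leftTrace u (X t) t) (𝓝[>] t₀) (𝓝 (leftTrace u x₀ t₀)) ∧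
    Tendsto (fun t => rightTrace u (X t) t) (𝓝[>] t₀) (𝓝 (rightTrace u x₀ t₀)) ∧
    TracesTendsto u (leftSide f u x₀ t₀ X) x₀ t₀ (leftTrace u x₀ t₀) ∧
    TracesTendsto u (rightSide f u x₀ t₀ X) x₀ t₀ (rightTrace u x₀ t₀)
  /-- backward characteristics from the point -/
  backward_char : ∀ v ∈ maximizers f φ x₀ t₀, ∀ t ∈ Ioo 0 t₀,
    leftTrace u (x₀ + (t - t₀) * deriv f v) t = v ∧
    rightTrace u (x₀ + (t - t₀) * deriv f v) t = v
  /-- centered compression waves ending at the point -/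
  compression : ∀ a b, a < b → Icc a b ⊆ maximizers f φ x₀ t₀ →
    (∀ p ∈ fan f (Ioo a b) x₀ t₀,
      deriv f (u p.1 p.2) = (p.1 - x₀) / (p.2 - t₀) ∧ u p.1 p.2 ∈ Ioo a b) ∧
    ∀ᵐ y, y ∈ Icc (x₀ - t₀ * deriv f b) (x₀ - t₀ * deriv f a) → deriv f (φ y) = (x₀ - y) / t₀
  /-- shocks reaching the point correspond to gaps -/
  gap_of_shock : ∀ s γ, IsArrivingShock u x₀ t₀ s γ →
    ∃! J : ℝ × ℝ, IsGap (maximizers f φ x₀ t₀) J.1 J.2 ∧ RunsInFan f J.1 J.2 x₀ t₀ s γ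
  shock_of_gap : ∀ c d, IsGap (maximizers f φ x₀ t₀) c d →
    ∃ s γ, IsArrivingShock u x₀ t₀ s γ ∧ RunsInFan f c d x₀ t₀ s γ
  shock_of_gap_unique : ∀ c d, IsGap (maximizers f φ x₀ t₀) c d →
    ∀ s₁ s₂ γ₁ γ₂, IsArrivingShock u x₀ t₀ s₁ γ₁ → RunsInFan f c d x₀ t₀ s₁ γ₁ →
      IsArrivingShock u x₀ t₀ s₂ γ₂ → RunsInFan f c d x₀ t₀ s₂ γ₂ →
      ∃ s, s < t₀ ∧ ∀ t ∈ Icc s t₀, γ₁ t = γ₂ t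
  /-- left derivatives and directional limits at the point along these shocks -/
  left_deriv : ∀ c d, IsGap (maximizers f φ x₀ t₀) c d →
    ∀ s γ, IsArrivingShock u x₀ t₀ s γ → RunsInFan f c d x₀ t₀ s γ →
      HasDerivWithinAt γ ((f d - f c) / (d - c)) (Iic t₀) t₀
  backward_limits : ∀ c d, IsGap (maximizers f φ x₀ t₀) c d →
    ∀ s γ, IsArrivingShock u x₀ t₀ s γ → RunsInFan f c d x₀ t₀ s γ →
      Tendsto (fun t => leftTrace u (γ t) t) (𝓝[<] t₀) (𝓝 d) ∧
      Tendsto (fun t => rightTrace u (γ t) t) (𝓝[<] t₀) (𝓝 c) ∧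
      TracesTendsto u {p | p ∈ fan f (Ioo c d) x₀ t₀ ∧ s < p.2 ∧ p.1 < γ p.2} x₀ t₀ d ∧
      TracesTendsto u {p | p ∈ fan f (Ioo c d) x₀ t₀ ∧ s < p.2 ∧ γ p.2 < p.1} x₀ t₀ c

/-- The structure of `u` at a point outside the shock set: the two traces agree, and either the
point is an inner point of a characteristic segment or a shock is generated at it. -/
def ContinuityPointStructure (f φ : ℝ → ℝ) (u : ℝ → ℝ → ℝ) (x₀ t₀ : ℝ) : Prop :=
  leftTrace u x₀ t₀ = rightTrace u x₀ t₀ ∧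
  ((∃ t₁, t₀ < t₁ ∧ ∀ t ∈ Ioo 0 t₁,
      maximizers f φ (x₀ + (t - t₀) * deriv f (rightTrace u x₀ t₀)) t = {rightTrace u x₀ t₀}) ∨
    ∃ X, IsForwardChar f u x₀ t₀ X ∧ IsShockCurve u t₀ X)

/-! ### The pattern in one region -/

/-- In the region `H` the solution turns into a single shock: some shock `x = γ(t)` in `H` absorbs
every forward generalized characteristic issuing from a point of `H` in a finite time, uniformly
on compact subsets of `H`. -/
def TurnsIntoSingleShock (f : ℝ → ℝ) (u : ℝ → ℝ → ℝ) (H : Set (ℝ × ℝ)) : Prop :=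
  ∃ t₀ γ, IsShockCurve u t₀ γ ∧ (∀ t, t₀ < t → (γ t, t) ∈ H) ∧
    ∀ K ⊆ H, IsCompact K → ∃ T, t₀ < T ∧ ∀ p ∈ K, p.2 ≤ T ∧
      (∃ X, IsForwardChar f u p.1 p.2 X) ∧
      ∀ X, IsForwardChar f u p.1 p.2 X → ∀ t, T ≤ t → X t = γ t

/-- The dynamic pattern in a region `H`. -/
structure SingleShockPattern (f φ : ℝ → ℝ) (u : ℝ → ℝ → ℝ) (H : Set (ℝ × ℝ)) : Prop where
  /-- any two shocks in `H` coincide after a finite time -/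
  merge : ∀ t₁ t₂ γ₁ γ₂, IsShockCurve u t₁ γ₁ → IsShockCurve u t₂ γ₂ →
    (∀ t, t₁ < t → (γ₁ t, t) ∈ H) → (∀ t, t₂ < t → (γ₂ t, t) ∈ H) →
    ∃ T, t₁ ≤ T ∧ t₂ ≤ T ∧ ∀ t, T ≤ t → γ₁ t = γ₂ t
  pathConnected : IsPathConnected (shockSet u ∩ H)
  single : TurnsIntoSingleShock f u H
  fine : ∀ p ∈ shockSet u ∩ H, FineStructure f φ u p.1 p.2
  continuity : ∀ p ∈ H \ shockSet u, ContinuityPointStructure f φ u p.1 p.2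

end

end ScalarLaw

/-!
# Global dynamic patterns of entropy solutions of a convex scalar conservation law

Integration by parts turns the functional `E` into a constant minus the cost
`Φ(x - t f'(v)) + t ℓ(v)`, where `ℓ(v) = v f'(v) - f(v)` is the Legendre transform of `f` in terms
of the velocity parameter (`FluxData.mem_maximizers`).  Thus `𝒰(x, t)` is the set of minimizers in
the Lax–Oleinik formula for the value `V(x, t) = min_v (Φ(x - t f'(v)) + t ℓ(v))`.  Since `ℓ` is
strictly convex along `f'`, a minimizing segment is the only minimizer at each of its inner points
(`FluxData.maximizers_linePos`).  Hence such segments do not cross (`FluxData.linePos_lt`), the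
closed backward triangles of the points at a fixed time are disjoint above the initial line, and
every point lies in exactly one triangle with vertex at a given later time
(`FluxData.exists_reaches`).  The vertices form the forward characteristic, which defines a monotone
continuous flow; as triangles grow along the flow, a shock remains a shock
(`FluxData.vmin_lt_vmax_of_reaches`).

The entropy solution `u` is identified with the Lax–Oleinik solution by means of its potential `W`,
`W_x = u`, `W_t = -f(u)`, `W(·, 0) = Φ`.  The tangent inequality for `f` gives `W ≤ V`
(`potential_le_cost`).  For the converse, `D = V - W ≥ 0` does not increase along the velocity
field `f'(u)` to first order, and the one-sided inequality for `f'(u)` bounds the contraction by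
this field; so the square of the weighted `L²` norm of `D(·, t)`, divided by `t` and damped
exponentially, is nonincreasing, and it tends to `0` as `t → 0`, since `D = O(t)`
(`potential_eq_value`).  It follows that `u(x-, t) = max 𝒰(x, t)` and `u(x+, t) = min 𝒰(x, t)`
(`leftTrace_eq`, `rightTrace_eq`), and everything else is a statement on the sets `𝒰`.

A line is a divide exactly if `c` is the slope of a supporting line of `Φ` at `x₀`
(`FluxData.isDivide_iff`).  The points with supporting lines are those of the contact set, and the
slopes at such a point fill the interval between the one-sided derivatives of the hull
(`FluxData.supports_iff`); over a gap of the contact set the chord supports `Φ`, and at the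
ends of the contact set the slopes are the mean values of the data at infinity (`FluxData.supports_gapSlope`,
`FluxData.supports_sSup`, `FluxData.supports_sInf`).  This gives the partition of the half-plane
(`FluxData.halfPlane_eq`).

The structure at a single point comes from the upper semicontinuity of `𝒰` together with the
noncrossing of characteristics: a limit of maximizers is a maximizer at the limit point, and the
noncrossing tells which one (`FluxData.maximizersTendsto`).  The slopes of shocks follow by
comparing the increments of `V` on both sides (`tendsto_shock_speed`).  For the large time
behaviour, two forward characteristics which never meet would have a divide between them, a limit
of longer and longer characteristic segments (`FluxData.exists_divide_between`).  In a region
without divides all of them therefore merge, and shocks in it form a single tree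
(`IsFlowRegion.singleShockPattern`).
-/

namespace ScalarLaw

noncomputable section

variable {f φ : ℝ → ℝ} {u : ℝ → ℝ → ℝ}

/-! ### Convex fluxes and the Legendre transform -/

/-- The Legendre transform of `f`, parametrized by the velocity `v` instead of the slope `f'(v)`:
`legendre f v = f*(f'(v))`. -/
def legendre (f : ℝ → ℝ) (v : ℝ) : ℝ := v * deriv f v - f v

theorem IsFlux.hasDerivAt (hf : IsFlux f) (v : ℝ) : HasDerivAt f (deriv f v) v :=
  ((hf.1.differentiable (by norm_num)) v).hasDerivAt

theorem IsFlux.contDiff_deriv (hf : IsFlux f) : ContDiff ℝ 1 (deriv f) := by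
  have h : ContDiff ℝ (1 + 1) f := by simpa [one_add_one_eq_two] using hf.1
  exact (contDiff_succ_iff_deriv.1 h).2.2

theorem IsFlux.hasDerivAt_deriv (hf : IsFlux f) (v : ℝ) :
    HasDerivAt (deriv f) (deriv (deriv f) v) v :=
  ((hf.contDiff_deriv.differentiable (by norm_num)) v).hasDerivAt

theorem IsFlux.continuous (hf : IsFlux f) : Continuous f := hf.1.continuous

theorem IsFlux.continuous_deriv (hf : IsFlux f) : Continuous (deriv f) :=
  hf.contDiff_deriv.continuous

theorem IsFlux.continuous_deriv_deriv (hf : IsFlux f) : Continuous (deriv (deriv f)) :=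
  hf.contDiff_deriv.continuous_deriv le_rfl

theorem IsFlux.monotone_deriv (hf : IsFlux f) : Monotone (deriv f) :=
  monotone_of_deriv_nonneg (fun v => (hf.hasDerivAt_deriv v).differentiableAt) hf.2.1

/-- The zero set of `f''` is a null set, so it contains no interval on which `f'` could be constant. -/
theorem IsFlux.strictMono (hf : IsFlux f) : StrictMono (deriv f) := by
  refine hf.monotone_deriv.strictMono_of_injective ?_
  by_contra hinj
  obtain ⟨a, b, hab, hlt⟩ : ∃ a b, deriv f a = deriv f b ∧ a < b := by
    simp only [Function.Injective, not_forall] at hinj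
    obtain ⟨a, b, h, hne⟩ := hinj
    rcases lt_or_gt_of_ne hne with h' | h'
    · exact ⟨a, b, h, h'⟩
    · exact ⟨b, a, h.symm, h'⟩
  have hconst : ∀ v ∈ Icc a b, deriv f v = deriv f a := fun v hv =>
    le_antisymm ((hf.monotone_deriv hv.2).trans hab.ge) (hf.monotone_deriv hv.1)
  have hsub : Ioo a b ⊆ {v | deriv (deriv f) v = 0} := by
    intro v hv
    have : deriv f =ᶠ[𝓝 v] fun _ => deriv f a := by
      filter_upwards [Ioo_mem_nhds hv.1 hv.2] with w hw using hconst w ⟨hw.1.le, hw.2.le⟩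
    simpa using this.deriv_eq
  have h0 := measure_mono_null hsub hf.2.2
  rw [Real.volume_Ioo, ENNReal.ofReal_eq_zero] at h0
  linarith

theorem IsFlux.tangent_lt (hf : IsFlux f) {m v : ℝ} (h : m ≠ v) :
    f v + deriv f v * (m - v) < f m := by
  rcases lt_or_gt_of_ne h with h | h
  · obtain ⟨ξ, hξ, he⟩ := exists_hasDerivAt_eq_slope f (deriv f) h hf.continuous.continuousOn
      (fun x _ => hf.hasDerivAt x)
    have := hf.strictMono hξ.2
    rw [he, div_lt_iff₀ (by linarith)] at this
    nlinarith
  · obtain ⟨ξ, hξ, he⟩ := exists_hasDerivAt_eq_slope f (deriv f) h hf.continuous.continuousOn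
      (fun x _ => hf.hasDerivAt x)
    have := hf.strictMono hξ.1
    rw [he, lt_div_iff₀ (by linarith)] at this
    nlinarith

theorem IsFlux.tangent_le (hf : IsFlux f) (m v : ℝ) :
    f v + deriv f v * (m - v) ≤ f m := by
  rcases eq_or_ne m v with rfl | h
  · simp
  · exact (hf.tangent_lt h).le

/-- Strict convexity of the Legendre transform, with `m` as subgradient at `f'(m)`. -/
theorem IsFlux.legendre_lt (hf : IsFlux f) {m v : ℝ} (h : m ≠ v) :
    legendre f m + m * (deriv f v - deriv f m) < legendre f v := by
  have := hf.tangent_lt h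
  unfold legendre
  nlinarith

theorem IsFlux.legendre_le (hf : IsFlux f) (m v : ℝ) :
    legendre f m + m * (deriv f v - deriv f m) ≤ legendre f v := by
  rcases eq_or_ne m v with rfl | h
  · simp
  · exact (hf.legendre_lt h).le

theorem IsFlux.continuous_legendre (hf : IsFlux f) : Continuous (legendre f) :=
  (continuous_id.mul hf.continuous_deriv).sub hf.continuous

theorem IsFlux.exists_deriv_eq (hf : IsFlux f) {a b p : ℝ} (hab : a ≤ b)
    (ha : deriv f a ≤ p) (hb : p ≤ deriv f b) : ∃ v ∈ Icc a b, deriv f v = p :=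
  intermediate_value_Icc hab hf.continuous_deriv.continuousOn ⟨ha, hb⟩

/-- The cost of the straight path with velocity `q` is at most that of a broken path with the same
end points, and less if the path is really broken. -/
theorem IsFlux.exists_mean (hf : IsFlux f) {s t : ℝ} (hs : 0 < s) (ht : 0 < t) (v w : ℝ) :
    ∃ q, (s + t) * deriv f q = s * deriv f v + t * deriv f w ∧
      (s + t) * legendre f q ≤ s * legendre f v + t * legendre f w ∧
      (v ≠ w → (s + t) * legendre f q < s * legendre f v + t * legendre f w) := by
  have hst : 0 < s + t := by linarith
  obtain ⟨q, hq⟩ : ∃ q, deriv f q = (s * deriv f v + t * deriv f w) / (s + t) := by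
    rcases le_total v w with h | h
    · obtain ⟨q, -, hq⟩ := hf.exists_deriv_eq h
        (p := (s * deriv f v + t * deriv f w) / (s + t))
        (by rw [le_div_iff₀ hst]; nlinarith [hf.monotone_deriv h])
        (by rw [div_le_iff₀ hst]; nlinarith [hf.monotone_deriv h])
      exact ⟨q, hq⟩
    · obtain ⟨q, -, hq⟩ := hf.exists_deriv_eq h
        (p := (s * deriv f v + t * deriv f w) / (s + t))
        (by rw [le_div_iff₀ hst]; nlinarith [hf.monotone_deriv h])
        (by rw [div_le_iff₀ hst]; nlinarith [hf.monotone_deriv h])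
      exact ⟨q, hq⟩
  have hq' : (s + t) * deriv f q = s * deriv f v + t * deriv f w := by
    rw [hq]; field_simp
  refine ⟨q, hq', ?_, fun hne => ?_⟩
  · have h1 := hf.legendre_le q v
    have h2 := hf.legendre_le q w
    have h3 : s * (q * (deriv f v - deriv f q)) + t * (q * (deriv f w - deriv f q)) = 0 := by
      linear_combination (-q) * hq'
    nlinarith [mul_le_mul_of_nonneg_left h1 hs.le, mul_le_mul_of_nonneg_left h2 ht.le]
  · have hv : q ≠ v := by
      rintro rfl
      exact hne (hf.strictMono.injective (mul_left_cancel₀ ht.ne' (by linarith)))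
    have h1 := hf.legendre_lt hv
    have h2 := hf.legendre_le q w
    have h3 : s * (q * (deriv f v - deriv f q)) + t * (q * (deriv f w - deriv f q)) = 0 := by
      linear_combination (-q) * hq'
    nlinarith [mul_lt_mul_of_pos_left h1 hs, mul_le_mul_of_nonneg_left h2 ht.le]

/-! ### The Lax–Oleinik functional -/

/-- A convex flux together with bounded initial data. -/
structure FluxData (f φ : ℝ → ℝ) : Prop where
  flux : IsFlux f
  data : MemLp φ ⊤ volume

/-- The essential bound of the initial data. -/
def dataBound (φ : ℝ → ℝ) : ℝ := (eLpNorm φ ⊤ volume).toReal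

/-- The cost of reaching `(x, t)` from time `0` with velocity `f'(v)`; up to a constant, this is
`-E(v; x, t)`. -/
def cost (f φ : ℝ → ℝ) (x t v : ℝ) : ℝ :=
  primitive φ (x - t * deriv f v) + t * legendre f v

theorem dataBound_nonneg (φ : ℝ → ℝ) : 0 ≤ dataBound φ := ENNReal.toReal_nonneg

theorem FluxData.ae_le (S : FluxData f φ) : ∀ᵐ x, |φ x| ≤ dataBound φ := by
  filter_upwards [ae_le_eLpNormEssSup (f := φ) (μ := volume)] with x hx
  have hfin : eLpNorm φ ⊤ volume ≠ ⊤ := S.data.2.ne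
  rw [← eLpNorm_exponent_top] at hx
  have := ENNReal.toReal_mono hfin hx
  simpa [dataBound] using this

theorem FluxData.locallyIntegrable (S : FluxData f φ) : LocallyIntegrable φ volume :=
  S.data.locallyIntegrable le_top

theorem FluxData.intervalIntegrable (S : FluxData f φ) (a b : ℝ) :
    IntervalIntegrable φ volume a b :=
  intervalIntegrable_iff.mpr <|
    (S.locallyIntegrable.integrableOn_isCompact isCompact_uIcc).mono_set uIoc_subset_uIcc

theorem FluxData.primitive_sub (S : FluxData f φ) (a b : ℝ) :
    primitive φ b - primitive φ a = ∫ y in a..b, φ y :=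
  intervalIntegral.integral_interval_sub_left (S.intervalIntegrable _ _) (S.intervalIntegrable _ _)

theorem FluxData.abs_primitive_sub_le (S : FluxData f φ) (a b : ℝ) :
    |primitive φ b - primitive φ a| ≤ dataBound φ * |b - a| := by
  rw [S.primitive_sub]
  rw [← Real.norm_eq_abs]
  refine intervalIntegral.norm_integral_le_of_norm_le_const_ae ?_
  filter_upwards [S.ae_le] with x hx _ using hx

theorem FluxData.continuous_primitive (S : FluxData f φ) : Continuous (primitive φ) :=
  (LipschitzWith.of_dist_le' (K := dataBound φ) fun a b => by
    rw [Real.dist_eq, Real.dist_eq]; exact S.abs_primitive_sub_le b a).continuous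

theorem FluxData.continuous_cost (S : FluxData f φ) :
    Continuous fun q : (ℝ × ℝ) × ℝ => cost f φ q.1.1 q.1.2 q.2 := by
  have h1 := S.continuous_primitive
  have h2 := S.flux.continuous_deriv
  have h3 := S.flux.continuous_legendre
  unfold cost
  fun_prop

/-- The substitution `y = x - t f'(s)` in the definition of `E`. -/
theorem FluxData.E_eq (S : FluxData f φ) {x t : ℝ} (ht : 0 < t) (v : ℝ) :
    E f φ x t v = cost f φ x t 0 - cost f φ x t v := by
  have key : ∀ a b, a ≤ b →
      IntervalIntegrable (fun s => deriv (deriv f) s * φ (x - t * deriv f s)) volume a b ∧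
      t * ∫ s in a..b, deriv (deriv f) s * φ (x - t * deriv f s) =
        primitive φ (x - t * deriv f a) - primitive φ (x - t * deriv f b) := by
    intro a b hab
    have hg : ∀ s, HasDerivAt (fun s => x - t * deriv f s) (-(t * deriv (deriv f) s)) s :=
      fun s => by simpa using ((S.flux.hasDerivAt_deriv s).const_mul t).const_sub x
    have hc : ContinuousOn (fun s => x - t * deriv f s) (Icc a b) :=
      fun s _ => (hg s).continuousAt.continuousWithinAt
    have hn : ∀ s ∈ Ioo a b, -(t * deriv (deriv f) s) ≤ 0 := fun s _ =>
      neg_nonpos.2 (mul_nonneg ht.le (S.flux.2.1 s))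
    have hle : x - t * deriv f b ≤ x - t * deriv f a := by
      have := mul_le_mul_of_nonneg_left (S.flux.monotone_deriv hab) ht.le
      linarith
    have h1 := integral_Icc_deriv_smul_of_deriv_nonpos (g := φ) hc (fun s _ => hg s) hn hab
    have h2 := (integrableOn_Icc_deriv_smul_iff_of_deriv_nonpos (g := φ) hc
      (fun s _ => hg s) hn hab).2
      (S.locallyIntegrable.integrableOn_isCompact isCompact_Icc)
    constructor
    · rw [intervalIntegrable_iff_integrableOn_Icc_of_le hab]
      have := h2.const_mul (-t⁻¹)
      refine this.congr (ae_of_all _ fun s => ?_)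
      simp only [smul_eq_mul]
      field_simp
    · rw [S.primitive_sub, intervalIntegral.integral_of_le hle, ← integral_Icc_eq_integral_Ioc,
        ← neg_neg (∫ y in Icc _ _, φ y), ← h1, intervalIntegral.integral_of_le hab,
        ← integral_Icc_eq_integral_Ioc, ← integral_const_mul, ← integral_neg]
      refine integral_congr_ae (ae_of_all _ fun s => ?_)
      simp only [smul_eq_mul]
      ring
  have key' : ∀ b,
      IntervalIntegrable (fun s => deriv (deriv f) s * φ (x - t * deriv f s)) volume 0 b ∧
      t * ∫ s in (0 : ℝ)..b, deriv (deriv f) s * φ (x - t * deriv f s) =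
        primitive φ (x - t * deriv f 0) - primitive φ (x - t * deriv f b) := by
    intro b
    rcases le_total 0 b with h | h
    · exact key 0 b h
    · obtain ⟨h1, h2⟩ := key b 0 h
      refine ⟨h1.symm, ?_⟩
      rw [intervalIntegral.integral_symm]
      linarith
  have hleg : ∫ s in (0 : ℝ)..v, deriv (deriv f) s * s = legendre f v - legendre f 0 := by
    refine intervalIntegral.integral_eq_sub_of_hasDerivAt (fun s _ => ?_)
      ((S.flux.continuous_deriv_deriv.mul continuous_id).intervalIntegrable _ _)
    have := ((hasDerivAt_id s).mul (S.flux.hasDerivAt_deriv s)).sub (S.flux.hasDerivAt s)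
    refine this.congr_deriv ?_
    simp only [id]
    ring
  have hint : IntervalIntegrable (fun s => deriv (deriv f) s * s) volume 0 v :=
    (S.flux.continuous_deriv_deriv.mul continuous_id).intervalIntegrable _ _
  unfold E cost
  simp_rw [mul_sub]
  rw [intervalIntegral.integral_sub (key' v).1 hint, mul_sub,
    (key' v).2, hleg]
  ring

theorem FluxData.mem_maximizers (S : FluxData f φ) {x t : ℝ} (ht : 0 < t) {w : ℝ} :
    w ∈ maximizers f φ x t ↔ ∀ v, cost f φ x t w ≤ cost f φ x t v := by
  simp only [maximizers, mem_ofPred_eq, S.E_eq ht, sub_le_sub_iff_left]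

/-- Velocities beyond the bound of the data are not better than the bound itself, since `Φ` is
Lipschitz with this constant. -/
theorem FluxData.cost_le_of_abs_gt (S : FluxData f φ) {x t : ℝ} (ht : 0 < t) {v : ℝ}
    (hv : dataBound φ < |v|) : ∃ m, |m| ≤ dataBound φ ∧ cost f φ x t m < cost f φ x t v := by
  have h0 := dataBound_nonneg φ
  rcases lt_abs.1 hv with h | h
  · refine ⟨dataBound φ, (abs_of_nonneg h0).le, ?_⟩
    have h1 := (abs_le.1 (S.abs_primitive_sub_le (x - t * deriv f v)
      (x - t * deriv f (dataBound φ)))).2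
    have h2 := S.flux.legendre_lt h.ne
    have h3 := S.flux.strictMono h
    rw [abs_of_nonneg (by nlinarith)] at h1
    unfold cost
    nlinarith [mul_lt_mul_of_pos_left h2 ht]
  · refine ⟨-dataBound φ, by rw [abs_neg, abs_of_nonneg h0], ?_⟩
    have h1 := (abs_le.1 (S.abs_primitive_sub_le (x - t * deriv f v)
      (x - t * deriv f (-dataBound φ)))).2
    have hlt : v < -dataBound φ := by linarith
    have h2 := S.flux.legendre_lt hlt.ne'
    have h3 := S.flux.strictMono hlt
    rw [abs_of_nonpos (by nlinarith)] at h1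
    unfold cost
    nlinarith [mul_lt_mul_of_pos_left h2 ht]

theorem FluxData.abs_le_dataBound (S : FluxData f φ) {x t : ℝ} (ht : 0 < t) {v : ℝ}
    (hv : v ∈ maximizers f φ x t) : |v| ≤ dataBound φ := by
  by_contra! h
  obtain ⟨m, -, hm⟩ := S.cost_le_of_abs_gt (x := x) ht h
  exact absurd ((S.mem_maximizers ht).1 hv m) (not_le.2 hm)

theorem FluxData.nonempty (S : FluxData f φ) (x : ℝ) {t : ℝ} (ht : 0 < t) :
    (maximizers f φ x t).Nonempty := by
  have h0 := dataBound_nonneg φ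
  have hc : Continuous (cost f φ x t) :=
    S.continuous_cost.comp (continuous_const (y := (x, t)).prodMk continuous_id)
  obtain ⟨w, hw, hmin⟩ := (isCompact_Icc (a := -dataBound φ) (b := dataBound φ)).exists_isMinOn
    ⟨0, by constructor <;> linarith⟩ hc.continuousOn
  refine ⟨w, (S.mem_maximizers ht).2 fun v => ?_⟩
  rcases le_or_gt |v| (dataBound φ) with h | h
  · exact hmin (abs_le.1 h)
  · obtain ⟨m, hm, hlt⟩ := S.cost_le_of_abs_gt (x := x) ht h
    exact (hmin (abs_le.1 hm)).trans hlt.le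

theorem FluxData.isClosed_maximizers (S : FluxData f φ) (x : ℝ) {t : ℝ} (ht : 0 < t) :
    IsClosed (maximizers f φ x t) := by
  have hc : Continuous (cost f φ x t) :=
    S.continuous_cost.comp (continuous_const (y := (x, t)).prodMk continuous_id)
  have : maximizers f φ x t = ⋂ v, {w | cost f φ x t w ≤ cost f φ x t v} := by
    ext w; simp [S.mem_maximizers ht]
  rw [this]
  exact isClosed_iInter fun v => isClosed_le hc continuous_const

theorem FluxData.isCompact_maximizers (S : FluxData f φ) (x : ℝ) {t : ℝ} (ht : 0 < t) :
    IsCompact (maximizers f φ x t) :=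
  (isCompact_Icc (a := -dataBound φ) (b := dataBound φ)).of_isClosed_subset
    (S.isClosed_maximizers x ht) fun _ hv => abs_le.1 (S.abs_le_dataBound ht hv)

/-- The sets of maximizers depend upper semicontinuously on the point. -/
theorem FluxData.eventually_maximizers_subset (S : FluxData f φ) {x t : ℝ} (ht : 0 < t)
    {O : Set ℝ} (hO : IsOpen O) (hsub : maximizers f φ x t ⊆ O) :
    ∀ᶠ p : ℝ × ℝ in 𝓝 (x, t), maximizers f φ p.1 p.2 ⊆ O := by
  obtain ⟨w, hw⟩ := S.nonempty x ht
  have hK : IsCompact (Icc (-dataBound φ) (dataBound φ) \ O) := isCompact_Icc.diff hO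
  have key : ∀ᶠ p : ℝ × ℝ in 𝓝 (x, t), ∀ v ∈ Icc (-dataBound φ) (dataBound φ) \ O,
      cost f φ p.1 p.2 w < cost f φ p.1 p.2 v := by
    refine hK.eventually_forall_of_forall_eventually fun v hv => ?_
    have hlt : cost f φ x t w < cost f φ x t v := by
      by_contra! hle
      exact hv.2 (hsub ((S.mem_maximizers ht).2 fun z =>
        hle.trans ((S.mem_maximizers ht).1 hw z)))
    have c1 : Continuous fun z : (ℝ × ℝ) × ℝ => cost f φ z.1.1 z.1.2 w :=
      S.continuous_cost.comp (continuous_fst.prodMk continuous_const)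
    exact (c1.continuousAt.eventually_lt S.continuous_cost.continuousAt hlt)
  have hpos : ∀ᶠ p : ℝ × ℝ in 𝓝 (x, t), 0 < p.2 :=
    continuous_snd.continuousAt.eventually (lt_mem_nhds ht)
  filter_upwards [key, hpos] with p hp hp2 v hv
  by_contra hvO
  exact absurd ((S.mem_maximizers hp2).1 hv w)
    (not_le.2 (hp v ⟨abs_le.1 (S.abs_le_dataBound hp2 hv), hvO⟩))

theorem FluxData.mem_of_tendsto (S : FluxData f φ) {ι : Type*} {l : Filter ι} [l.NeBot]
    {p : ι → ℝ × ℝ} {v : ι → ℝ} {x t c : ℝ} (ht : 0 < t) (hp : Tendsto p l (𝓝 (x, t)))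
    (hv : Tendsto v l (𝓝 c)) (hmem : ∀ᶠ i in l, v i ∈ maximizers f φ (p i).1 (p i).2) :
    c ∈ maximizers f φ x t := by
  refine (S.mem_maximizers ht).2 fun w => ?_
  have h1 : Tendsto (fun i => cost f φ (p i).1 (p i).2 (v i)) l (𝓝 (cost f φ x t c)) :=
    (S.continuous_cost.tendsto ((x, t), c)).comp (f := fun i => (p i, v i)) (hp.prodMk_nhds hv)
  have h2 : Tendsto (fun i => cost f φ (p i).1 (p i).2 w) l (𝓝 (cost f φ x t w)) :=
    (S.continuous_cost.tendsto ((x, t), w)).comp (f := fun i => (p i, w))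
      (hp.prodMk_nhds tendsto_const_nhds)
  have hpos : ∀ᶠ i in l, 0 < (p i).2 :=
    ((continuous_snd.tendsto (x, t)).comp hp).eventually (lt_mem_nhds ht)
  refine le_of_tendsto_of_tendsto h1 h2 ?_
  filter_upwards [hmem, hpos] with i hi hi2 using (S.mem_maximizers hi2).1 hi w

/-! ### Greatest and least maximizers -/

/-- The greatest maximizer; it will turn out to be the trace `u(x-, t)`. -/
def vmax (f φ : ℝ → ℝ) (x t : ℝ) : ℝ := sSup (maximizers f φ x t)

/-- The least maximizer; it will turn out to be the trace `u(x+, t)`. -/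
def vmin (f φ : ℝ → ℝ) (x t : ℝ) : ℝ := sInf (maximizers f φ x t)

theorem FluxData.isGreatest_vmax (S : FluxData f φ) (x : ℝ) {t : ℝ} (ht : 0 < t) :
    IsGreatest (maximizers f φ x t) (vmax f φ x t) :=
  (S.isCompact_maximizers x ht).isGreatest_sSup (S.nonempty x ht)

theorem FluxData.isLeast_vmin (S : FluxData f φ) (x : ℝ) {t : ℝ} (ht : 0 < t) :
    IsLeast (maximizers f φ x t) (vmin f φ x t) :=
  (S.isCompact_maximizers x ht).isLeast_sInf (S.nonempty x ht)

theorem FluxData.vmin_le_vmax (S : FluxData f φ) (x : ℝ) {t : ℝ} (ht : 0 < t) :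
    vmin f φ x t ≤ vmax f φ x t :=
  (S.isLeast_vmin x ht).2 (S.isGreatest_vmax x ht).1

theorem vmax_eq_of_singleton {x t c : ℝ} (h : maximizers f φ x t = {c}) : vmax f φ x t = c := by
  simp [vmax, h]

theorem vmin_eq_of_singleton {x t c : ℝ} (h : maximizers f φ x t = {c}) : vmin f φ x t = c := by
  simp [vmin, h]

theorem FluxData.eq_singleton (S : FluxData f φ) {x t : ℝ} (ht : 0 < t)
    (h : vmax f φ x t ≤ vmin f φ x t) : maximizers f φ x t = {vmin f φ x t} := by
  refine Set.eq_singleton_iff_unique_mem.2 ⟨(S.isLeast_vmin x ht).1, fun v hv => ?_⟩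
  exact le_antisymm (((S.isGreatest_vmax x ht).2 hv).trans h) ((S.isLeast_vmin x ht).2 hv)

theorem FluxData.eventually_between (S : FluxData f φ) (x : ℝ) {t ε : ℝ} (ht : 0 < t)
    (hε : 0 < ε) : ∀ᶠ p : ℝ × ℝ in 𝓝 (x, t), ∀ v ∈ maximizers f φ p.1 p.2,
      vmin f φ x t - ε < v ∧ v < vmax f φ x t + ε :=
  (S.eventually_maximizers_subset ht isOpen_Ioo (O := Ioo (vmin f φ x t - ε) (vmax f φ x t + ε))
    fun v hv => ⟨by linarith [(S.isLeast_vmin x ht).2 hv],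
      by linarith [(S.isGreatest_vmax x ht).2 hv]⟩).mono fun _ h _ hv => h hv

/-! ### Characteristic segments do not cross -/

/-- The position at time `r` on the line of velocity `f'(v)` through `(x, t)`. -/
def linePos (f : ℝ → ℝ) (x t v r : ℝ) : ℝ := x + (r - t) * deriv f v

@[simp] theorem linePos_self (x t v : ℝ) : linePos f x t v t = x := by simp [linePos]

theorem linePos_linePos (x t v r s : ℝ) :
    linePos f (linePos f x t v r) r v s = linePos f x t v s := by
  simp only [linePos]; ring

theorem continuous_linePos (x t v : ℝ) : Continuous (linePos f x t v) := by
  unfold linePos; fun_prop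

/-- A characteristic segment is the unique minimizing path at its inner points. -/
theorem FluxData.maximizers_linePos (S : FluxData f φ) {x t v r : ℝ}
    (hv : v ∈ maximizers f φ x t) (hr : 0 < r) (hrt : r < t) :
    maximizers f φ (linePos f x t v r) r = {v} := by
  have ht : 0 < t := hr.trans hrt
  have hfoot : linePos f x t v r - r * deriv f v = x - t * deriv f v := by
    simp only [linePos]; ring
  have hne : ∀ w, w ≠ v → cost f φ (linePos f x t v r) r v < cost f φ (linePos f x t v r) r w := by
    intro w hw
    obtain ⟨q, hq, -, hlt⟩ := S.flux.exists_mean hr (sub_pos.2 hrt) w v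
    have hlt := hlt hw
    have hmin := (S.mem_maximizers ht).1 hv q
    have h1 : linePos f x t v r - r * deriv f w = x - t * deriv f q := by
      simp only [linePos]; linarith
    unfold cost at hmin ⊢
    rw [h1, hfoot]
    linarith
  refine Set.eq_singleton_iff_unique_mem.2 ⟨(S.mem_maximizers hr).2 fun w => ?_, fun w hw => ?_⟩
  · rcases eq_or_ne w v with rfl | h
    · exact le_rfl
    · exact (hne w h).le
  · by_contra h
    exact absurd ((S.mem_maximizers hr).1 hw v) (not_le.2 (hne w h))

theorem FluxData.mem_linePos (S : FluxData f φ) {x t v r : ℝ}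
    (hv : v ∈ maximizers f φ x t) (hr : 0 < r) (hrt : r ≤ t) :
    v ∈ maximizers f φ (linePos f x t v r) r := by
  rcases hrt.lt_or_eq with h | rfl
  · simp [S.maximizers_linePos hv hr h]
  · simpa using hv

/-- Two characteristic segments which meet below the top of one of them have the same velocity. -/
theorem FluxData.eq_of_linePos_eq (S : FluxData f φ) {x₁ t₁ v₁ x₂ t₂ v₂ r : ℝ}
    (h₁ : v₁ ∈ maximizers f φ x₁ t₁) (h₂ : v₂ ∈ maximizers f φ x₂ t₂) (hr : 0 < r)
    (hr₁ : r ≤ t₁) (hr₂ : r ≤ t₂) (hlt : r < t₁ ∨ r < t₂)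
    (heq : linePos f x₁ t₁ v₁ r = linePos f x₂ t₂ v₂ r) : v₁ = v₂ := by
  rcases hlt with h | h
  · have := S.mem_linePos h₂ hr hr₂
    rw [← heq, S.maximizers_linePos h₁ hr h] at this
    exact this.symm
  · have := S.mem_linePos h₁ hr hr₁
    rw [heq, S.maximizers_linePos h₂ hr h] at this
    exact this

/-- Characteristic segments are ordered at all the times before a time at which they are ordered. -/
theorem FluxData.linePos_lt (S : FluxData f φ) {x₁ t₁ v₁ x₂ t₂ v₂ r r₀ : ℝ}
    (h₁ : v₁ ∈ maximizers f φ x₁ t₁) (h₂ : v₂ ∈ maximizers f φ x₂ t₂) (hr : 0 < r)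
    (hrr : r ≤ r₀) (hr₁ : r₀ ≤ t₁) (hr₂ : r₀ ≤ t₂)
    (hlt : linePos f x₁ t₁ v₁ r₀ < linePos f x₂ t₂ v₂ r₀) :
    linePos f x₁ t₁ v₁ r < linePos f x₂ t₂ v₂ r := by
  by_contra! hle
  obtain ⟨s, hs, heq⟩ : ∃ s ∈ Icc r r₀, linePos f x₂ t₂ v₂ s - linePos f x₁ t₁ v₁ s = 0 :=
    intermediate_value_Icc hrr
      ((continuous_linePos x₂ t₂ v₂).sub (continuous_linePos x₁ t₁ v₁)).continuousOn
      ⟨sub_nonpos.2 hle, (sub_pos.2 hlt).le⟩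
  have hs0 : s ≠ r₀ := by rintro rfl; linarith
  have hsr : s < r₀ := lt_of_le_of_ne hs.2 hs0
  have hv := S.eq_of_linePos_eq h₁ h₂ (hr.trans_le hs.1) (hsr.le.trans hr₁) (hsr.le.trans hr₂)
    (Or.inl (hsr.trans_le hr₁)) (by linarith)
  subst hv
  simp only [linePos] at heq hlt
  linarith

/-- The weak form of `FluxData.linePos_lt`, which includes the initial time. -/
theorem FluxData.linePos_le (S : FluxData f φ) {x₁ t₁ v₁ x₂ t₂ v₂ r r₀ : ℝ}
    (h₁ : v₁ ∈ maximizers f φ x₁ t₁) (h₂ : v₂ ∈ maximizers f φ x₂ t₂) (hr : 0 ≤ r)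
    (hr₀ : 0 < r₀) (hrr : r ≤ r₀) (hr₁ : r₀ ≤ t₁) (hr₂ : r₀ ≤ t₂)
    (hlt : linePos f x₁ t₁ v₁ r₀ < linePos f x₂ t₂ v₂ r₀) :
    linePos f x₁ t₁ v₁ r ≤ linePos f x₂ t₂ v₂ r := by
  rcases hr.lt_or_eq with h | rfl
  · exact (S.linePos_lt h₁ h₂ h hrr hr₁ hr₂ hlt).le
  · refine le_of_tendsto_of_tendsto
      ((continuous_linePos x₁ t₁ v₁).continuousWithinAt (s := Ioi 0) (x := 0)).tendsto
      ((continuous_linePos x₂ t₂ v₂).continuousWithinAt (s := Ioi 0) (x := 0)).tendsto ?_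
    filter_upwards [Ioo_mem_nhdsGT hr₀] with s hs
    exact (S.linePos_lt h₁ h₂ hs.1 hs.2.le hr₁ hr₂ hlt).le

/-! ### Backward triangles -/

/-- The left edge of the backward triangle spanned by the maximizers at `(x, t)`. -/
def leftEdge (f φ : ℝ → ℝ) (x t r : ℝ) : ℝ := linePos f x t (vmax f φ x t) r

/-- The right edge of the backward triangle spanned by the maximizers at `(x, t)`. -/
def rightEdge (f φ : ℝ → ℝ) (x t r : ℝ) : ℝ := linePos f x t (vmin f φ x t) r

/-- The point `(x₀, t₀)` lies in the closed backward triangle of `(x, t)`. -/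
def Reaches (f φ : ℝ → ℝ) (x₀ t₀ x t : ℝ) : Prop :=
  leftEdge f φ x t t₀ ≤ x₀ ∧ x₀ ≤ rightEdge f φ x t t₀

@[simp] theorem leftEdge_self (x t : ℝ) : leftEdge f φ x t t = x := linePos_self _ _ _

@[simp] theorem rightEdge_self (x t : ℝ) : rightEdge f φ x t t = x := linePos_self _ _ _

theorem continuous_leftEdge (x t : ℝ) : Continuous (leftEdge f φ x t) := continuous_linePos _ _ _

theorem continuous_rightEdge (x t : ℝ) : Continuous (rightEdge f φ x t) := continuous_linePos _ _ _

theorem linePos_anti (hf : IsFlux f) {x t v w r : ℝ} (hrt : r ≤ t) (hvw : v ≤ w) :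
    linePos f x t w r ≤ linePos f x t v r := by
  have := hf.monotone_deriv hvw
  unfold linePos
  nlinarith

theorem linePos_lt_linePos_iff (hf : IsFlux f) {x t v w r : ℝ} (hrt : r < t) :
    linePos f x t w r < linePos f x t v r ↔ v < w := by
  rw [← hf.strictMono.lt_iff_lt (a := v) (b := w)]
  unfold linePos
  constructor <;> intro h <;> nlinarith

theorem FluxData.leftEdge_le_rightEdge (S : FluxData f φ) (x : ℝ) {t r : ℝ} (ht : 0 < t)
    (hrt : r ≤ t) : leftEdge f φ x t r ≤ rightEdge f φ x t r :=
  linePos_anti S.flux hrt (S.vmin_le_vmax x ht)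

theorem FluxData.rightEdge_lt_leftEdge (S : FluxData f φ) {x₁ x₂ t r : ℝ} (hx : x₁ < x₂)
    (hr : 0 < r) (hrt : r ≤ t) : rightEdge f φ x₁ t r < leftEdge f φ x₂ t r :=
  S.linePos_lt (S.isLeast_vmin x₁ (hr.trans_le hrt)).1 (S.isGreatest_vmax x₂ (hr.trans_le hrt)).1
    hr hrt le_rfl le_rfl (by simpa using hx)

theorem FluxData.leftEdge_mono (S : FluxData f φ) {x₁ x₂ t r : ℝ} (hx : x₁ ≤ x₂)
    (hr : 0 < r) (hrt : r ≤ t) : leftEdge f φ x₁ t r ≤ leftEdge f φ x₂ t r := by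
  rcases hx.lt_or_eq with h | rfl
  · exact (S.leftEdge_le_rightEdge x₁ (hr.trans_le hrt) hrt).trans
      (S.rightEdge_lt_leftEdge h hr hrt).le
  · exact le_rfl

theorem FluxData.rightEdge_mono (S : FluxData f φ) {x₁ x₂ t r : ℝ} (hx : x₁ ≤ x₂)
    (hr : 0 < r) (hrt : r ≤ t) : rightEdge f φ x₁ t r ≤ rightEdge f φ x₂ t r := by
  rcases hx.lt_or_eq with h | rfl
  · exact (S.rightEdge_lt_leftEdge h hr hrt).le.trans
      (S.leftEdge_le_rightEdge x₂ (hr.trans_le hrt) hrt)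
  · exact le_rfl

/-- Above the initial line, the closed backward triangles of the points at a fixed time are disjoint. -/
theorem FluxData.reaches_unique (S : FluxData f φ) {x₀ t₀ x y t : ℝ} (h₀ : 0 < t₀) (ht : t₀ ≤ t)
    (hx : Reaches f φ x₀ t₀ x t) (hy : Reaches f φ x₀ t₀ y t) : x = y := by
  rcases lt_trichotomy x y with h | h | h
  · exact absurd (hx.2.trans_lt (S.rightEdge_lt_leftEdge h h₀ ht)) (not_lt.2 hy.1)
  · exact h
  · exact absurd (hy.2.trans_lt (S.rightEdge_lt_leftEdge h h₀ ht)) (not_lt.2 hx.1)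

theorem reaches_self (x t : ℝ) : Reaches f φ x t x t := by simp [Reaches]

/-- A bound for the characteristic speeds. -/
def speedBound (f φ : ℝ → ℝ) : ℝ := max |deriv f (-dataBound φ)| |deriv f (dataBound φ)|

theorem speedBound_nonneg (f φ : ℝ → ℝ) : 0 ≤ speedBound f φ :=
  (abs_nonneg _).trans (le_max_left _ _)

theorem abs_deriv_le_max (hf : IsFlux f) {v K : ℝ} (hv : |v| ≤ K) :
    |deriv f v| ≤ max |deriv f (-K)| |deriv f K| := by
  obtain ⟨h1, h2⟩ := abs_le.1 hv
  have a := hf.monotone_deriv h1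
  have b := hf.monotone_deriv h2
  refine abs_le.2 ⟨?_, ?_⟩
  · have := neg_abs_le (deriv f (-K))
    have := le_max_left |deriv f (-K)| |deriv f K|
    linarith
  · have := le_abs_self (deriv f K)
    have := le_max_right |deriv f (-K)| |deriv f K|
    linarith

theorem FluxData.abs_speed_le (S : FluxData f φ) {x t v : ℝ} (ht : 0 < t)
    (hv : v ∈ maximizers f φ x t) : |deriv f v| ≤ speedBound f φ :=
  abs_deriv_le_max S.flux (S.abs_le_dataBound ht hv)

theorem FluxData.abs_linePos_sub_le (S : FluxData f φ) {x t v r : ℝ} (ht : 0 < t) (hr : r ≤ t)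
    (hv : v ∈ maximizers f φ x t) : |linePos f x t v r - x| ≤ speedBound f φ * (t - r) := by
  have h := S.abs_speed_le ht hv
  have : linePos f x t v r - x = (r - t) * deriv f v := by unfold linePos; ring
  rw [this, abs_mul, abs_of_nonpos (by linarith), mul_comm]
  nlinarith

/-- The closed backward triangles of the points at time `t` cover the earlier times: `(x₀, t₀)` lies
in the triangle of the supremum of the points whose left edge passes on the left of `x₀`, by the
upper semicontinuity of `𝒰`. -/
theorem FluxData.exists_reaches (S : FluxData f φ) (x₀ : ℝ) {t₀ t : ℝ} (h₀ : 0 < t₀)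
    (htt : t₀ ≤ t) : ∃ x, Reaches f φ x₀ t₀ x t := by
  have ht : 0 < t := h₀.trans_le htt
  set A : Set ℝ := {x | leftEdge f φ x t t₀ ≤ x₀} with hA
  have hspeed : ∀ x, |leftEdge f φ x t t₀ - x| ≤ speedBound f φ * (t - t₀) := fun x =>
    S.abs_linePos_sub_le ht htt (S.isGreatest_vmax x ht).1
  have hne : A.Nonempty := ⟨x₀ - speedBound f φ * (t - t₀), by
    have := (abs_le.1 (hspeed (x₀ - speedBound f φ * (t - t₀)))).2
    show leftEdge _ _ _ _ _ ≤ _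
    linarith⟩
  have hbdd : BddAbove A := ⟨x₀ + speedBound f φ * (t - t₀), fun x hx => by
    have := (abs_le.1 (hspeed x)).1
    have hx' : leftEdge f φ x t t₀ ≤ x₀ := hx
    linarith⟩
  have hnear : ∀ ε, 0 < ε → ∃ δ, 0 < δ ∧ ∀ x, |x - sSup A| < δ →
      vmin f φ (sSup A) t - ε < vmax f φ x t ∧ vmax f φ x t < vmax f φ (sSup A) t + ε := by
    intro ε hε
    have h := ((Continuous.prodMk_left t).tendsto (sSup A)).eventually
      (S.eventually_between (sSup A) ht hε)
    obtain ⟨δ, hδ, hb⟩ := Metric.eventually_nhds_iff.1 h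
    exact ⟨δ, hδ, fun x hx => hb hx _ (S.isGreatest_vmax x ht).1⟩
  refine ⟨sSup A, ?_, ?_⟩
  · have hlim : Tendsto (fun ε => linePos f (sSup A - ε) t (vmax f φ (sSup A) t + ε) t₀)
        (𝓝[>] 0) (𝓝 (leftEdge f φ (sSup A) t t₀)) := by
      have hc : Continuous fun ε => linePos f (sSup A - ε) t (vmax f φ (sSup A) t + ε) t₀ := by
        have := S.flux.continuous_deriv
        unfold linePos; fun_prop
      have := hc.tendsto 0
      simp only [sub_zero, add_zero] at this
      exact this.mono_left nhdsWithin_le_nhds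
    refine le_of_tendsto hlim ?_
    filter_upwards [self_mem_nhdsWithin] with ε hε
    obtain ⟨δ, hδ, hb⟩ := hnear ε hε
    obtain ⟨x, hx, hlt⟩ := exists_lt_of_lt_csSup hne (sub_lt_self (sSup A) (lt_min hδ hε))
    have hle := le_csSup hbdd hx
    have hm1 := min_le_left δ ε
    have hm2 := min_le_right δ ε
    have hv := (hb x (by rw [abs_lt]; constructor <;> linarith)).2
    have hx' : linePos f x t (vmax f φ x t) t₀ ≤ x₀ := hx
    have := S.flux.monotone_deriv hv.le
    unfold linePos at hx' ⊢
    nlinarith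
  · have hlim : Tendsto (fun ε => linePos f (sSup A + ε) t (vmin f φ (sSup A) t - ε) t₀)
        (𝓝[>] 0) (𝓝 (rightEdge f φ (sSup A) t t₀)) := by
      have hc : Continuous fun ε => linePos f (sSup A + ε) t (vmin f φ (sSup A) t - ε) t₀ := by
        have := S.flux.continuous_deriv
        unfold linePos; fun_prop
      have := hc.tendsto 0
      simp only [sub_zero, add_zero] at this
      exact this.mono_left nhdsWithin_le_nhds
    refine ge_of_tendsto hlim ?_
    filter_upwards [self_mem_nhdsWithin] with ε hε
    obtain ⟨δ, hδ, hb⟩ := hnear ε hε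
    have hpos : 0 < min δ ε := lt_min hδ hε
    have hm1 := min_le_left δ ε
    have hm2 := min_le_right δ ε
    have hx : sSup A + min δ ε / 2 ∉ A := fun h => by
      have := le_csSup hbdd h
      linarith
    have hv := (hb (sSup A + min δ ε / 2) (by
      rw [abs_lt]; constructor <;> linarith)).1
    have hx' : x₀ < linePos f (sSup A + min δ ε / 2) t (vmax f φ (sSup A + min δ ε / 2) t) t₀ :=
      not_le.1 hx
    have := S.flux.monotone_deriv hv.le
    unfold linePos at hx' ⊢
    nlinarith

/-- Backward triangles are nested along the relation `Reaches`. -/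
theorem FluxData.leftEdge_le_of_reaches (S : FluxData f φ) {x₁ t₁ x₂ t₂ r : ℝ} (h₁ : 0 < t₁)
    (h₁₂ : t₁ ≤ t₂) (h : Reaches f φ x₁ t₁ x₂ t₂) (hr : 0 ≤ r) (hrt : r ≤ t₁) :
    leftEdge f φ x₂ t₂ r ≤ leftEdge f φ x₁ t₁ r := by
  have h₂ := h₁.trans_le h₁₂
  rcases h₁₂.lt_or_eq with hlt | rfl
  · rcases h.1.lt_or_eq with hl | he
    · exact S.linePos_le (S.isGreatest_vmax x₂ h₂).1 (S.isGreatest_vmax x₁ h₁).1 hr h₁ hrt h₁₂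
        le_rfl (by rw [linePos_self]; exact hl)
    · have hs := S.maximizers_linePos (S.isGreatest_vmax x₂ h₂).1 h₁ hlt
      change maximizers f φ (leftEdge f φ x₂ t₂ t₁) t₁ = _ at hs
      rw [he] at hs
      rw [leftEdge, leftEdge, vmax_eq_of_singleton hs, ← he, leftEdge, linePos_linePos]
  · simp only [Reaches, leftEdge_self, rightEdge_self] at h
    rw [le_antisymm h.1 h.2]

theorem FluxData.rightEdge_le_of_reaches (S : FluxData f φ) {x₁ t₁ x₂ t₂ r : ℝ} (h₁ : 0 < t₁)
    (h₁₂ : t₁ ≤ t₂) (h : Reaches f φ x₁ t₁ x₂ t₂) (hr : 0 ≤ r) (hrt : r ≤ t₁) :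
    rightEdge f φ x₁ t₁ r ≤ rightEdge f φ x₂ t₂ r := by
  have h₂ := h₁.trans_le h₁₂
  rcases h₁₂.lt_or_eq with hlt | rfl
  · rcases h.2.lt_or_eq with hl | he
    · exact S.linePos_le (S.isLeast_vmin x₁ h₁).1 (S.isLeast_vmin x₂ h₂).1 hr h₁ hrt
        le_rfl h₁₂ (by rw [linePos_self]; exact hl)
    · have hs := S.maximizers_linePos (S.isLeast_vmin x₂ h₂).1 h₁ hlt
      change maximizers f φ (rightEdge f φ x₂ t₂ t₁) t₁ = _ at hs
      rw [← he] at hs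
      rw [rightEdge, rightEdge, vmin_eq_of_singleton hs, he, rightEdge, linePos_linePos]
  · simp only [Reaches, leftEdge_self, rightEdge_self] at h
    rw [le_antisymm h.1 h.2]

theorem FluxData.reaches_trans (S : FluxData f φ) {x₀ t₀ x₁ t₁ x₂ t₂ : ℝ} (h₀ : 0 < t₀)
    (h₀₁ : t₀ ≤ t₁) (h₁₂ : t₁ ≤ t₂) (h : Reaches f φ x₀ t₀ x₁ t₁)
    (h' : Reaches f φ x₁ t₁ x₂ t₂) : Reaches f φ x₀ t₀ x₂ t₂ :=
  ⟨(S.leftEdge_le_of_reaches (h₀.trans_le h₀₁) h₁₂ h' h₀.le h₀₁).trans h.1,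
    h.2.trans (S.rightEdge_le_of_reaches (h₀.trans_le h₀₁) h₁₂ h' h₀.le h₀₁)⟩

/-- Once a backward triangle is nondegenerate, it remains so. -/
theorem FluxData.vmin_lt_vmax_of_reaches (S : FluxData f φ) {x₁ t₁ x₂ t₂ : ℝ} (h₁ : 0 < t₁)
    (h₁₂ : t₁ ≤ t₂) (h : Reaches f φ x₁ t₁ x₂ t₂) (hs : vmin f φ x₁ t₁ < vmax f φ x₁ t₁) :
    vmin f φ x₂ t₂ < vmax f φ x₂ t₂ := by
  have a := S.leftEdge_le_of_reaches h₁ h₁₂ h le_rfl h₁.le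
  have b := S.rightEdge_le_of_reaches h₁ h₁₂ h le_rfl h₁.le
  have c : leftEdge f φ x₁ t₁ 0 < rightEdge f φ x₁ t₁ 0 :=
    (linePos_lt_linePos_iff S.flux h₁).2 hs
  exact (linePos_lt_linePos_iff S.flux (h₁.trans_le h₁₂)).1 (a.trans_lt (c.trans_le b))

theorem FluxData.reaches_of_mem (S : FluxData f φ) {x t v r : ℝ} (ht : 0 < t) (hrt : r ≤ t)
    (hv : v ∈ maximizers f φ x t) : Reaches f φ (linePos f x t v r) r x t :=
  ⟨linePos_anti S.flux hrt ((S.isGreatest_vmax x ht).2 hv),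
    linePos_anti S.flux hrt ((S.isLeast_vmin x ht).2 hv)⟩

theorem reaches_singleton_iff {x t c x₀ t₀ : ℝ} (h : maximizers f φ x t = {c}) :
    Reaches f φ x₀ t₀ x t ↔ x₀ = linePos f x t c t₀ := by
  rw [Reaches, leftEdge, rightEdge, vmax_eq_of_singleton h, vmin_eq_of_singleton h]
  exact ⟨fun h => le_antisymm h.2 h.1, fun h => ⟨h.ge, h.le⟩⟩

/-! ### The forward flow -/

/-- The position at time `t` of the forward generalized characteristic of `(x₀, t₀)`: the point
whose backward triangle contains `(x₀, t₀)`. -/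
def flow (f φ : ℝ → ℝ) (x₀ t₀ t : ℝ) : ℝ := Classical.epsilon fun x => Reaches f φ x₀ t₀ x t

theorem FluxData.reaches_flow (S : FluxData f φ) (x₀ : ℝ) {t₀ t : ℝ} (h₀ : 0 < t₀)
    (ht : t₀ ≤ t) : Reaches f φ x₀ t₀ (flow f φ x₀ t₀ t) t :=
  Classical.epsilon_spec (S.exists_reaches x₀ h₀ ht)

theorem FluxData.flow_eq (S : FluxData f φ) {x₀ t₀ x t : ℝ} (h₀ : 0 < t₀)
    (ht : t₀ ≤ t) (h : Reaches f φ x₀ t₀ x t) : flow f φ x₀ t₀ t = x :=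
  S.reaches_unique h₀ ht (S.reaches_flow x₀ h₀ ht) h

theorem FluxData.flow_self (S : FluxData f φ) (x₀ : ℝ) {t₀ : ℝ} (h₀ : 0 < t₀) :
    flow f φ x₀ t₀ t₀ = x₀ := S.flow_eq h₀ le_rfl (reaches_self _ _)

theorem FluxData.flow_flow (S : FluxData f φ) (x₀ : ℝ) {t₀ t₁ t₂ : ℝ} (h₀ : 0 < t₀)
    (h₀₁ : t₀ ≤ t₁) (h₁₂ : t₁ ≤ t₂) :
    flow f φ (flow f φ x₀ t₀ t₁) t₁ t₂ = flow f φ x₀ t₀ t₂ :=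
  (S.flow_eq h₀ (h₀₁.trans h₁₂) (S.reaches_trans h₀ h₀₁ h₁₂ (S.reaches_flow x₀ h₀ h₀₁)
    (S.reaches_flow _ (h₀.trans_le h₀₁) h₁₂))).symm

theorem FluxData.flow_mono (S : FluxData f φ) {x y t₀ t : ℝ} (hxy : x ≤ y) (h₀ : 0 < t₀)
    (ht : t₀ ≤ t) : flow f φ x t₀ t ≤ flow f φ y t₀ t := by
  by_contra! h
  have := S.rightEdge_lt_leftEdge h h₀ ht
  linarith [(S.reaches_flow x h₀ ht).1, (S.reaches_flow y h₀ ht).2]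

theorem FluxData.abs_flow_sub_le (S : FluxData f φ) (x₀ : ℝ) {t₀ t : ℝ} (h₀ : 0 < t₀)
    (ht : t₀ ≤ t) : |flow f φ x₀ t₀ t - x₀| ≤ speedBound f φ * (t - t₀) := by
  have hp := h₀.trans_le ht
  have h := S.reaches_flow x₀ h₀ ht
  have a := abs_le.1 (S.abs_linePos_sub_le hp ht (S.isGreatest_vmax (flow f φ x₀ t₀ t) hp).1)
  have b := abs_le.1 (S.abs_linePos_sub_le hp ht (S.isLeast_vmin (flow f φ x₀ t₀ t) hp).1)
  unfold Reaches leftEdge rightEdge at h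
  rw [abs_le]
  constructor <;> linarith [a.1, a.2, b.1, b.2, h.1, h.2]

theorem FluxData.continuousOn_flow_time (S : FluxData f φ) (x₀ : ℝ) {t₀ : ℝ} (h₀ : 0 < t₀) :
    ContinuousOn (flow f φ x₀ t₀) (Ici t₀) := by
  have key : ∀ s ∈ Ici t₀, ∀ t ∈ Ici t₀, s ≤ t →
      |flow f φ x₀ t₀ t - flow f φ x₀ t₀ s| ≤ speedBound f φ * |t - s| := by
    intro s hs t _ hst
    rw [← S.flow_flow x₀ h₀ hs hst, abs_of_nonneg (sub_nonneg.2 hst)]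
    exact S.abs_flow_sub_le _ (h₀.trans_le hs) hst
  refine (LipschitzOnWith.of_dist_le' (K := speedBound f φ) fun s hs t ht => ?_).continuousOn
  rw [Real.dist_eq, Real.dist_eq]
  rcases le_total s t with h | h
  · rw [abs_sub_comm, abs_sub_comm s t]; exact key s hs t ht h
  · exact key t ht s hs h

/-- The position at a fixed time `t` is a continuous function of the starting point and time: it
stays below `a` while the starting point stays on the left of the triangle of `(a, t)`, which is an
open condition, and likewise on the right. -/
theorem FluxData.continuousOn_flow (S : FluxData f φ) {t : ℝ} :
    ContinuousOn (fun p : ℝ × ℝ => flow f φ p.1 p.2 t) {p | 0 < p.2 ∧ p.2 ≤ t} := by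
  rintro ⟨x₀, t₀⟩ ⟨h₀, ht⟩
  simp only at h₀ ht
  have hR := S.reaches_flow x₀ h₀ ht
  refine tendsto_order.2 ⟨fun a ha => ?_, fun a ha => ?_⟩
  · have hlt : rightEdge f φ a t t₀ < x₀ := (S.rightEdge_lt_leftEdge ha h₀ ht).trans_le hR.1
    have hev : ∀ᶠ p : ℝ × ℝ in 𝓝 (x₀, t₀), rightEdge f φ a t p.2 < p.1 :=
      ((continuous_rightEdge a t).comp continuous_snd).continuousAt.eventually_lt
        continuous_fst.continuousAt hlt
    filter_upwards [mem_nhdsWithin_of_mem_nhds hev, self_mem_nhdsWithin] with p hp hp2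
    by_contra! hle
    have := S.rightEdge_mono hle hp2.1 hp2.2
    linarith [(S.reaches_flow p.1 hp2.1 hp2.2).2]
  · have hlt : x₀ < leftEdge f φ a t t₀ := hR.2.trans_lt (S.rightEdge_lt_leftEdge ha h₀ ht)
    have hev : ∀ᶠ p : ℝ × ℝ in 𝓝 (x₀, t₀), p.1 < leftEdge f φ a t p.2 :=
      continuous_fst.continuousAt.eventually_lt
        ((continuous_leftEdge a t).comp continuous_snd).continuousAt hlt
    filter_upwards [mem_nhdsWithin_of_mem_nhds hev, self_mem_nhdsWithin] with p hp hp2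
    by_contra! hle
    have := S.leftEdge_mono hle hp2.1 hp2.2
    linarith [(S.reaches_flow p.1 hp2.1 hp2.2).1]

/-- At each time there are only countably many nondegenerate backward triangles. -/
theorem FluxData.countable_shocks (S : FluxData f φ) {t : ℝ} (ht : 0 < t) :
    {x | vmin f φ x t < vmax f φ x t}.Countable := by
  refine Set.PairwiseDisjoint.countable_of_isOpen
    (s := fun x => Ioo (leftEdge f φ x t (t / 2)) (rightEdge f φ x t (t / 2))) ?_
    (fun _ _ => isOpen_Ioo) fun x hx => nonempty_Ioo.2 ?_
  · intro x _ y _ hxy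
    refine Set.disjoint_left.2 fun z hz hz' => ?_
    rcases lt_or_gt_of_ne hxy with h | h
    · linarith [S.rightEdge_lt_leftEdge h (half_pos ht) (half_le_self ht.le), hz.2, hz'.1]
    · linarith [S.rightEdge_lt_leftEdge h (half_pos ht) (half_le_self ht.le), hz.1, hz'.2]
  · exact (linePos_lt_linePos_iff S.flux (half_lt_self ht)).2 hx

/-- A continuous curve in the shock set follows the forward flow: the flow carries its points to
the time `b` continuously, into a countable set. -/
theorem FluxData.flow_eq_of_curve (S : FluxData f φ) {γ : ℝ → ℝ} {a b : ℝ} (ha : 0 < a)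
    (hab : a ≤ b) (hγ : ContinuousOn γ (Icc a b))
    (hs : ∀ t ∈ Ico a b, vmin f φ (γ t) t < vmax f φ (γ t) t) : flow f φ (γ a) a b = γ b := by
  have hb : 0 < b := ha.trans_le hab
  have hg : ContinuousOn (fun r => flow f φ (γ r) r b) (Icc a b) :=
    S.continuousOn_flow.comp (hγ.prodMk continuousOn_id) fun r hr => ⟨ha.trans_le hr.1, hr.2⟩
  have hend : flow f φ (γ b) b b = γ b := S.flow_self _ hb
  by_contra hne
  -- an interval of values of the carried curve would be uncountable
  have hsub : uIcc (flow f φ (γ a) a b) (γ b) ⊆ insert (γ b) {x | vmin f φ x b < vmax f φ x b} := by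
    intro z hz
    rw [← hend] at hz
    have hg' : ContinuousOn (fun r => flow f φ (γ r) r b) (uIcc a b) := by rwa [uIcc_of_le hab]
    obtain ⟨r, hr, rfl⟩ := intermediate_value_uIcc hg' hz
    rw [uIcc_of_le hab] at hr
    rcases hr.2.lt_or_eq with h | rfl
    · exact Or.inr (S.vmin_lt_vmax_of_reaches (ha.trans_le hr.1) hr.2
        (S.reaches_flow _ (ha.trans_le hr.1) hr.2) (hs r ⟨hr.1, h⟩))
    · exact Or.inl hend
  have h0 := (((S.countable_shocks hb).insert (γ b)).mono hsub).measure_zero volume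
  rw [Real.volume_interval, ENNReal.ofReal_eq_zero] at h0
  exact hne (eq_of_sub_eq_zero (abs_eq_zero.1 (le_antisymm h0 (abs_nonneg _)))).symm

/-! ### Divides as barriers between flow lines -/

theorem FluxData.isDivide_iff_mem (S : FluxData f φ) {x₀ c : ℝ} :
    IsDivide f φ x₀ c ↔ ∀ t, 0 < t → c ∈ maximizers f φ (x₀ + t * deriv f c) t := by
  refine ⟨fun h t ht => by rw [h t ht]; rfl, fun h t ht => ?_⟩
  have := S.maximizers_linePos (h (2 * t) (by linarith)) ht (by linarith)
  rw [← this]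
  congr 1
  simp only [linePos]; ring

/-- Two flow lines which never meet have a divide between them: a limit of characteristic segments
which run between them over longer and longer times. -/
theorem FluxData.exists_divide_between (S : FluxData f φ) {x₁ x₂ T : ℝ} (hT : 0 < T)
    (h : ∀ t, T ≤ t → flow f φ x₁ T t < flow f φ x₂ T t) :
    ∃ x₀ c, IsDivide f φ x₀ c ∧ x₁ ≤ x₀ + T * deriv f c ∧ x₀ + T * deriv f c ≤ x₂ := by
  set τ : ℕ → ℝ := fun n => T + n with hτ
  have hτT : ∀ n, T ≤ τ n := fun n => by simp [hτ]
  have hτ0 : ∀ n, 0 < τ n := fun n => hT.trans_le (hτT n)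
  -- the right edge of the triangle whose vertex is on the first flow line at time `τ n`;
  -- `z n` is its position at time `T`
  set c : ℕ → ℝ := fun n => vmin f φ (flow f φ x₁ T (τ n)) (τ n) with hc
  have hcm : ∀ n, c n ∈ maximizers f φ (flow f φ x₁ T (τ n)) (τ n) := fun n =>
    (S.isLeast_vmin _ (hτ0 n)).1
  set z : ℕ → ℝ := fun n => rightEdge f φ (flow f φ x₁ T (τ n)) (τ n) T with hz
  have hz1 : ∀ n, x₁ ≤ z n := fun n => (S.reaches_flow x₁ hT (hτT n)).2
  have hz2 : ∀ n, z n ≤ x₂ := fun n =>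
    (S.rightEdge_lt_leftEdge (h _ (hτT n)) hT (hτT n)).le.trans (S.reaches_flow x₂ hT (hτT n)).1
  have hK : IsCompact (Icc x₁ x₂ ×ˢ Icc (-dataBound φ) (dataBound φ)) :=
    isCompact_Icc.prod isCompact_Icc
  obtain ⟨⟨z₀, c₀⟩, ⟨hz₀, -⟩, θ, hθ, hlim⟩ := hK.tendsto_subseq (x := fun n => (z n, c n))
    fun n => ⟨⟨hz1 n, hz2 n⟩, abs_le.1 (S.abs_le_dataBound (hτ0 n) (hcm n))⟩
  have hlz : Tendsto (fun n => z (θ n)) atTop (𝓝 z₀) :=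
    (continuous_fst.tendsto (z₀, c₀)).comp hlim
  have hlc : Tendsto (fun n => c (θ n)) atTop (𝓝 c₀) :=
    (continuous_snd.tendsto (z₀, c₀)).comp hlim
  -- the limit line is maximizing at each time, by the closedness of `𝒰`
  refine ⟨z₀ - T * deriv f c₀, c₀, S.isDivide_iff_mem.2 fun r hr => ?_, by
    simpa using hz₀.1, by simpa using hz₀.2⟩
  have hpos : z₀ - T * deriv f c₀ + r * deriv f c₀ = z₀ + (r - T) * deriv f c₀ := by ring
  rw [hpos]
  refine S.mem_of_tendsto (l := atTop)
    (p := fun n => (z (θ n) + (r - T) * deriv f (c (θ n)), r)) hr ?_ hlc ?_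
  · exact (hlz.add (((S.flux.continuous_deriv.tendsto c₀).comp hlc).const_mul (r - T))).prodMk_nhds
      tendsto_const_nhds
  · have hbig : ∀ᶠ n : ℕ in atTop, r ≤ τ (θ n) := by
      filter_upwards [eventually_ge_atTop ⌈r⌉₊] with n hn
      have h1 : r ≤ (⌈r⌉₊ : ℝ) := Nat.le_ceil r
      have h2 : ((⌈r⌉₊ : ℕ) : ℝ) ≤ (θ n : ℝ) := by exact_mod_cast hn.trans (hθ.id_le n)
      simp only [hτ]
      linarith
    filter_upwards [hbig] with n hn
    have := S.mem_linePos (hcm (θ n)) hr hn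
    rw [← linePos_linePos _ _ _ T] at this
    exact this

/-! ### Regularity of entropy solutions at fixed times -/

/-- Convergence can be tested after applying a strictly increasing function. -/
theorem tendsto_of_strictMono {ι : Type*} {l : Filter ι} {g : ℝ → ℝ} (hg : StrictMono g)
    {v : ι → ℝ} {c : ℝ} (h : Tendsto (fun i => g (v i)) l (𝓝 (g c))) : Tendsto v l (𝓝 c) :=
  tendsto_order.2 ⟨fun _ ha => ((tendsto_order.1 h).1 _ (hg ha)).mono fun _ hi => hg.lt_iff_lt.1 hi,
    fun _ ha => ((tendsto_order.1 h).2 _ (hg ha)).mono fun _ hi => hg.lt_iff_lt.1 hi⟩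

theorem abs_integral_le {M : ℝ} (hM : ∀ x t, 0 < t → |u x t| ≤ M) {t : ℝ}
    (ht : 0 < t) (a b : ℝ) : |∫ y in a..b, u y t| ≤ M * |b - a| :=
  Real.norm_eq_abs (∫ y in a..b, u y t) ▸
    intervalIntegral.norm_integral_le_of_norm_le_const fun y _ => hM y t ht

/-- An entropy solution together with the assumptions on flux and data. -/
structure IsSolution (f φ : ℝ → ℝ) (u : ℝ → ℝ → ℝ) : Prop extends FluxData f φ where
  entropy : IsEntropySolution f φ u

namespace IsSolution

/-- The one-sided inequality of Oleinik: `f'(u)` increases at most at the rate `1 / t`. -/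
theorem deriv_sub_le (H : IsSolution f φ u) {t x y : ℝ} (ht : 0 < t) (hxy : x ≤ y) :
    deriv f (u y t) ≤ deriv f (u x t) + (y - x) / t := by
  rcases hxy.lt_or_eq with h | rfl
  · linarith [H.entropy.oleinik t ht x y h]
  · simp

theorem antitone (H : IsSolution f φ u) {t : ℝ} (ht : 0 < t) :
    Antitone fun x => deriv f (u x t) - x / t := fun x y hxy => by
  have := H.deriv_sub_le ht hxy
  rw [sub_div] at this
  simp only
  linarith

theorem measurable (H : IsSolution f φ u) {t : ℝ} (ht : 0 < t) : Measurable fun x => u x t := by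
  have h1 : Measurable fun x => deriv f (u x t) := by
    convert (H.antitone ht).measurable.add (measurable_id.div_const t) using 1
    ext x; simp
  refine measurable_of_Iio fun c => ?_
  have : (fun x => u x t) ⁻¹' Iio c = (fun x => deriv f (u x t)) ⁻¹' Iio (deriv f c) := by
    ext x; simp [H.flux.strictMono.lt_iff_lt]
  rw [this]
  exact h1 measurableSet_Iio

theorem intervalIntegrable_comp (H : IsSolution f φ u) {g : ℝ → ℝ} (hg : Continuous g) {t : ℝ}
    (ht : 0 < t) (a b : ℝ) : IntervalIntegrable (fun x => g (u x t)) volume a b := by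
  obtain ⟨M, hM⟩ := H.entropy.bounded
  obtain ⟨K, hK⟩ := (isCompact_Icc (a := -M) (b := M)).exists_bound_of_continuousOn hg.continuousOn
  refine (intervalIntegrable_const (c := K)).mono_fun
    (hg.measurable.comp (H.measurable ht)).aestronglyMeasurable (ae_of_all _ fun x => ?_)
  exact (hK _ (abs_le.1 (hM x t ht))).trans (le_abs_self K)

theorem intervalIntegrable (H : IsSolution f φ u) {t : ℝ} (ht : 0 < t) (a b : ℝ) :
    IntervalIntegrable (fun x => u x t) volume a b :=
  H.intervalIntegrable_comp continuous_id ht a b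

theorem countable_not_continuousAt (H : IsSolution f φ u) {t : ℝ} (ht : 0 < t) :
    {x | ¬ ContinuousAt (fun y => u y t) x}.Countable := by
  refine (H.antitone ht).countable_not_continuousAt.mono ?_
  intro x hx hc
  refine hx ?_
  refine tendsto_of_strictMono H.flux.strictMono ?_
  have : ContinuousAt (fun y => (deriv f (u y t) - y / t) + y / t) x :=
    ContinuousAt.add hc (by fun_prop)
  simpa [ContinuousAt] using this

theorem ae_continuousAt (H : IsSolution f φ u) {t : ℝ} (ht : 0 < t) :
    ∀ᵐ x, ContinuousAt (fun y => u y t) x :=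
  (H.countable_not_continuousAt ht).ae_notMem volume |>.mono fun x hx => by
    simpa using hx

theorem exists_tendsto_right (H : IsSolution f φ u) (x : ℝ) {t : ℝ} (ht : 0 < t) :
    ∃ c, Tendsto (fun y => u y t) (𝓝[>] x) (𝓝 c) := by
  obtain ⟨M, hM⟩ := H.entropy.bounded
  have h1 := (H.antitone ht).tendsto_nhdsGT x
  set L := sSup ((fun x => deriv f (u x t) - x / t) '' Ioi x)
  have h2 : Tendsto (fun y => deriv f (u y t)) (𝓝[>] x) (𝓝 (L + x / t)) := by
    have h3 : Tendsto (fun y => y / t) (𝓝[>] x) (𝓝 (x / t)) :=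
      ((continuous_id.div_const t).tendsto x).mono_left nhdsWithin_le_nhds
    simpa using h1.add h3
  have hcl : IsClosed (deriv f '' Icc (-M) M) :=
    (isCompact_Icc.image H.flux.continuous_deriv).isClosed
  obtain ⟨c, -, hc⟩ := hcl.mem_of_tendsto h2
    (Eventually.of_forall fun y => mem_image_of_mem _ (abs_le.1 (hM y t ht)))
  rw [← hc] at h2
  exact ⟨c, tendsto_of_strictMono H.flux.strictMono h2⟩

theorem tendsto_rightTrace (H : IsSolution f φ u) (x : ℝ) {t : ℝ} (ht : 0 < t) :
    Tendsto (fun y => u y t) (𝓝[>] x) (𝓝 (rightTrace u x t)) := by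
  obtain ⟨c, hc⟩ := H.exists_tendsto_right x ht
  rwa [rightTrace, rightLim_eq_of_tendsto hc]

theorem abs_rightTrace_le (H : IsSolution f φ u) {M : ℝ} (hM : ∀ x t, 0 < t → |u x t| ≤ M)
    (x : ℝ) {t : ℝ} (ht : 0 < t) : |rightTrace u x t| ≤ M :=
  le_of_tendsto (H.tendsto_rightTrace x ht).abs (Eventually.of_forall fun y => hM y t ht)

theorem integral_sub (H : IsSolution f φ u) {t : ℝ} (ht : 0 < t) (a b : ℝ) :
    (∫ y in (0 : ℝ)..b, u y t) - ∫ y in (0 : ℝ)..a, u y t = ∫ y in a..b, u y t :=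
  intervalIntegral.integral_interval_sub_left (H.intervalIntegrable ht _ _)
    (H.intervalIntegrable ht _ _)

theorem continuousAt_integral (H : IsSolution f φ u) (x : ℝ) {t : ℝ} (ht : 0 < t) :
    ContinuousAt (fun p : ℝ × ℝ => ∫ y in (0 : ℝ)..p.1, u y p.2) (x, t) := by
  obtain ⟨M, hM⟩ := H.entropy.bounded
  have h1 : Tendsto (fun p : ℝ × ℝ => (∫ y in (0 : ℝ)..x, u y p.2) + ∫ y in x..p.1, u y p.2)
      (𝓝 (x, t)) (𝓝 ((∫ y in (0 : ℝ)..x, u y t) + 0)) := by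
    refine Tendsto.add ?_ ?_
    · exact ((H.entropy.time_continuous 0 x).continuousAt (Ioi_mem_nhds ht)).tendsto.comp
        (continuous_snd.tendsto (x, t))
    · refine squeeze_zero_norm' (a := fun p : ℝ × ℝ => M * |p.1 - x|) ?_ ?_
      · filter_upwards [continuous_snd.continuousAt.eventually (lt_mem_nhds ht)] with p hp
        exact abs_integral_le hM hp _ _
      · have : Continuous fun p : ℝ × ℝ => M * |p.1 - x| := by fun_prop
        simpa using this.tendsto (x, t)
  rw [add_zero] at h1
  refine h1.congr' ?_
  filter_upwards [continuous_snd.continuousAt.eventually (lt_mem_nhds ht)] with p hp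
  rw [← H.integral_sub hp x]; ring

theorem continuousAt_integral_shift (H : IsSolution f φ u) (x a b : ℝ) {t : ℝ} (ht : 0 < t) :
    ContinuousAt (fun p : ℝ × ℝ => ∫ y in (p.1 + a)..(p.1 + b), u y p.2) (x, t) := by
  have hc : ∀ c : ℝ, ContinuousAt (fun p : ℝ × ℝ => ∫ y in (0 : ℝ)..(p.1 + c), u y p.2) (x, t) :=
    fun c => ContinuousAt.comp (f := fun p : ℝ × ℝ => (p.1 + c, p.2))
      (g := fun p : ℝ × ℝ => ∫ y in (0 : ℝ)..p.1, u y p.2)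
      (H.continuousAt_integral (x + c) ht) (by fun_prop)
  refine ((hc b).sub (hc a)).congr ?_
  filter_upwards [continuous_snd.continuousAt.eventually (lt_mem_nhds ht)] with p hp
  exact H.integral_sub hp _ _

/-- At a point where `u(·, t)` is continuous, `u` is continuous in both variables: by the one-sided
inequality, a different value of `u` nearby would show in the mean values of `u`, which are
continuous in time. -/
theorem tendsto_of_continuousAt (H : IsSolution f φ u) {x t : ℝ} (ht : 0 < t)
    (hx : ContinuousAt (fun y => u y t) x) :
    Tendsto (fun p : ℝ × ℝ => u p.1 p.2) (𝓝 (x, t)) (𝓝 (u x t)) := by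
  have htime : ∀ᶠ p : ℝ × ℝ in 𝓝 (x, t), t / 2 < p.2 :=
    continuous_snd.continuousAt.eventually (lt_mem_nhds (half_lt_self ht))
  have hδ : ∀ {a b δ₀ : ℝ}, a < b → 0 < δ₀ →
      ∃ δ, 0 < δ ∧ δ < δ₀ ∧ deriv f a + 2 * δ / t < deriv f b := by
    intro a b δ₀ hab h0
    have hab' := sub_pos.2 (H.flux.strictMono hab)
    refine ⟨min (δ₀ / 2) (t * (deriv f b - deriv f a) / 4), by positivity, ?_, ?_⟩
    · exact (min_le_left _ _).trans_lt (half_lt_self h0)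
    · have := min_le_right (δ₀ / 2) (t * (deriv f b - deriv f a) / 4)
      have h2 : 2 * min (δ₀ / 2) (t * (deriv f b - deriv f a) / 4) / t ≤
          (deriv f b - deriv f a) / 2 := by
        rw [div_le_iff₀ ht]; linarith
      linarith
  refine tendsto_order.2 ⟨fun a ha => ?_, fun a ha => ?_⟩
  · obtain ⟨a', ha', hac⟩ := exists_between ha
    obtain ⟨a'', ha'', hac'⟩ := exists_between hac
    obtain ⟨δ₀, hδ₀, hb⟩ := Metric.eventually_nhds_iff.1 (hx.eventually (lt_mem_nhds hac'))
    obtain ⟨δ, hδ0, hδ1, hδ2⟩ := hδ ha' hδ₀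
    -- a value below `a` at a nearby point would keep the mean over the next `δ` below `a'`
    have hlow : a' * δ < ∫ y in (x + 0)..(x + δ), u y t := by
      have h1 : ∫ _ in (x + 0)..(x + δ), a'' ≤ ∫ y in (x + 0)..(x + δ), u y t := by
        refine intervalIntegral.integral_mono_on (by linarith) intervalIntegrable_const
          (H.intervalIntegrable ht _ _) fun y hy => (hb ?_).le
        rw [Real.dist_eq, abs_lt]; constructor <;> linarith [hy.1, hy.2]
      simp only [intervalIntegral.integral_const, smul_eq_mul] at h1
      nlinarith
    filter_upwards [htime, (H.continuousAt_integral_shift x 0 δ ht).eventually (lt_mem_nhds hlow)]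
      with p hp hint
    by_contra! hle
    have hp0 : 0 < p.2 := by linarith
    have h2 : ∫ y in (p.1 + 0)..(p.1 + δ), u y p.2 ≤ ∫ _ in (p.1 + 0)..(p.1 + δ), a' := by
      refine intervalIntegral.integral_mono_on (by linarith)
        (H.intervalIntegrable hp0 _ _) intervalIntegrable_const fun y hy => ?_
      refine (H.flux.strictMono.lt_iff_lt.1 ?_).le
      have h3 := H.deriv_sub_le hp0 (x := p.1) (y := y) (by linarith [hy.1])
      have h4 := H.flux.monotone_deriv hle
      have h5 : (y - p.1) / p.2 ≤ 2 * δ / t := by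
        rw [div_le_div_iff₀ hp0 ht]
        nlinarith [hy.1, hy.2]
      linarith
    simp only [intervalIntegral.integral_const, smul_eq_mul] at h2
    linarith
  · obtain ⟨a', hac, ha'⟩ := exists_between ha
    obtain ⟨a'', hac', ha''⟩ := exists_between hac
    obtain ⟨δ₀, hδ₀, hb⟩ := Metric.eventually_nhds_iff.1 (hx.eventually (gt_mem_nhds hac'))
    obtain ⟨δ, hδ0, hδ1, hδ2⟩ := hδ ha' hδ₀
    -- a value above `a` at a nearby point would keep the mean over the previous `δ` above `a'`
    have hlow : ∫ y in (x + -δ)..(x + 0), u y t < a' * δ := by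
      have h1 : ∫ y in (x + -δ)..(x + 0), u y t ≤ ∫ _ in (x + -δ)..(x + 0), a'' := by
        refine intervalIntegral.integral_mono_on (by linarith)
          (H.intervalIntegrable ht _ _) intervalIntegrable_const fun y hy => (hb ?_).le
        rw [Real.dist_eq, abs_lt]; constructor <;> linarith [hy.1, hy.2]
      simp only [intervalIntegral.integral_const, smul_eq_mul] at h1
      nlinarith
    filter_upwards [htime, (H.continuousAt_integral_shift x (-δ) 0 ht).eventually
      (gt_mem_nhds hlow)] with p hp hint
    by_contra! hle
    have hp0 : 0 < p.2 := by linarith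
    have h2 : ∫ _ in (p.1 + -δ)..(p.1 + 0), a' ≤ ∫ y in (p.1 + -δ)..(p.1 + 0), u y p.2 := by
      refine intervalIntegral.integral_mono_on (by linarith)
        intervalIntegrable_const (H.intervalIntegrable hp0 _ _) fun y hy => ?_
      refine (H.flux.strictMono.lt_iff_lt.1 ?_).le
      have h3 := H.deriv_sub_le hp0 (x := y) (y := p.1) (by linarith [hy.2])
      have h4 := H.flux.monotone_deriv hle
      have h5 : (p.1 - y) / p.2 ≤ 2 * δ / t := by
        rw [div_le_div_iff₀ hp0 ht]
        nlinarith [hy.1, hy.2]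
      linarith
    simp only [intervalIntegral.integral_const, smul_eq_mul] at h2
    linarith

/-- The right traces inherit the joint continuity. -/
theorem tendsto_rightTrace_of_continuousAt (H : IsSolution f φ u) {x t : ℝ} (ht : 0 < t)
    (hx : ContinuousAt (fun y => u y t) x) :
    Tendsto (fun p : ℝ × ℝ => rightTrace u p.1 p.2) (𝓝 (x, t)) (𝓝 (u x t)) := by
  have h := H.tendsto_of_continuousAt ht hx
  refine (closed_nhds_basis (u x t)).tendsto_right_iff.2 fun C hC => ?_
  have h1 := (h.eventually hC.1).eventually_nhds
  filter_upwards [h1, continuous_snd.continuousAt.eventually (lt_mem_nhds ht)] with p hp hp2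
  refine hC.2.mem_of_tendsto (H.tendsto_rightTrace p.1 hp2) ?_
  have : ∀ᶠ y in 𝓝 p.1, u y p.2 ∈ C :=
    ((Continuous.prodMk_left p.2).tendsto p.1).eventually hp
  exact this.filter_mono nhdsWithin_le_nhds

end IsSolution

/-! ### Smooth approximation of indicator functions -/

/-- A smooth step from `0` on `(-∞, a]` to `1` on `[a + ε, ∞)`.  The transition lies to the right
of `a`, so that its derivative selects limits from the right. -/
def smoothStep (ε a x : ℝ) : ℝ := Real.smoothTransition ((x - a) / ε)

theorem contDiff_smoothStep (ε a : ℝ) : ContDiff ℝ ∞ (smoothStep ε a) :=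
  Real.smoothTransition.contDiff.comp ((contDiff_id.sub contDiff_const).div_const ε)

theorem continuous_smoothStep (ε a : ℝ) : Continuous (smoothStep ε a) :=
  (contDiff_smoothStep ε a).continuous

theorem continuous_deriv_smoothStep (ε a : ℝ) : Continuous (deriv (smoothStep ε a)) :=
  (contDiff_smoothStep ε a).continuous_deriv (by norm_num)

theorem hasDerivAt_smoothStep (ε a x : ℝ) :
    HasDerivAt (smoothStep ε a) (deriv (smoothStep ε a) x) x :=
  ((contDiff_smoothStep ε a).differentiable (by norm_num) x).hasDerivAt

theorem smoothStep_nonneg (ε a x : ℝ) : 0 ≤ smoothStep ε a x := Real.smoothTransition.nonneg _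

theorem smoothStep_le_one (ε a x : ℝ) : smoothStep ε a x ≤ 1 := Real.smoothTransition.le_one _

theorem smoothStep_of_le {ε a x : ℝ} (hε : 0 < ε) (h : x ≤ a) : smoothStep ε a x = 0 :=
  Real.smoothTransition.zero_of_nonpos (div_nonpos_of_nonpos_of_nonneg (by linarith) hε.le)

theorem smoothStep_of_ge {ε a x : ℝ} (hε : 0 < ε) (h : a + ε ≤ x) : smoothStep ε a x = 1 :=
  Real.smoothTransition.one_of_one_le (by rw [le_div_iff₀ hε]; linarith)

theorem deriv_smoothStep_nonneg {ε : ℝ} (hε : 0 < ε) (a x : ℝ) : 0 ≤ deriv (smoothStep ε a) x := by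
  refine Monotone.deriv_nonneg fun y z h => Real.smoothTransition.monotone ?_
  exact div_le_div_of_nonneg_right (by linarith) hε.le

theorem deriv_smoothStep_eq_zero {ε a x : ℝ} (hε : 0 < ε) (hx : x ∉ Ioc a (a + ε)) :
    deriv (smoothStep ε a) x = 0 := by
  rcases le_or_gt x a with h | h
  · refine IsLocalMin.deriv_eq_zero (Eventually.of_forall fun y => ?_)
    simpa [smoothStep_of_le hε h] using smoothStep_nonneg ε a y
  · refine IsLocalMax.deriv_eq_zero (Eventually.of_forall fun y => ?_)
    have : a + ε ≤ x := by
      by_contra! h'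
      exact hx ⟨h, h'.le⟩
    simpa [smoothStep_of_ge hε this] using smoothStep_le_one ε a y

theorem integral_deriv_smoothStep {ε : ℝ} (hε : 0 < ε) (a : ℝ) :
    ∫ x in a..(a + ε), deriv (smoothStep ε a) x = 1 := by
  rw [intervalIntegral.integral_eq_sub_of_hasDerivAt (fun x _ => hasDerivAt_smoothStep ε a x)
    ((continuous_deriv_smoothStep ε a).intervalIntegrable _ _), smoothStep_of_ge hε le_rfl,
    smoothStep_of_le hε le_rfl, sub_zero]

theorem integrable_mul_deriv_smoothStep {ε a : ℝ} {g : ℝ → ℝ} (hε : 0 < ε)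
    (hg : IntervalIntegrable g volume a (a + ε)) :
    Integrable (fun x => g x * deriv (smoothStep ε a) x) ∧
      ∫ x, g x * deriv (smoothStep ε a) x =
        ∫ x in a..(a + ε), g x * deriv (smoothStep ε a) x := by
  have hle : a ≤ a + ε := by linarith
  have hz : ∀ x, x ∉ Ioc a (a + ε) → g x * deriv (smoothStep ε a) x = 0 := fun x hx => by
    rw [deriv_smoothStep_eq_zero hε hx, mul_zero]
  have h1 : IntegrableOn (fun x => g x * deriv (smoothStep ε a) x) (Ioc a (a + ε)) :=
    (intervalIntegrable_iff_integrableOn_Ioc_of_le hle).1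
      (hg.mul_continuousOn (continuous_deriv_smoothStep ε a).continuousOn)
  exact ⟨h1.integrable_of_forall_notMem_eq_zero hz, by
    rw [intervalIntegral.integral_of_le hle, setIntegral_eq_integral_of_forall_compl_eq_zero hz]⟩

theorem abs_integral_mul_deriv_smoothStep_le {ε a C : ℝ} {g : ℝ → ℝ} (hε : 0 < ε)
    (hC : ∀ x ∈ Ioc a (a + ε), |g x| ≤ C) :
    |∫ x in a..(a + ε), g x * deriv (smoothStep ε a) x| ≤ C := by
  have h := intervalIntegral.norm_integral_le_of_norm_le (μ := volume)
    (f := fun x => g x * deriv (smoothStep ε a) x)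
    (g := fun x => C * deriv (smoothStep ε a) x) (a := a) (b := a + ε) (by linarith)
    (ae_of_all _ fun x hx => by
      rw [Real.norm_eq_abs, abs_mul, abs_of_nonneg (deriv_smoothStep_nonneg hε a x)]
      exact mul_le_mul_of_nonneg_right (hC x hx) (deriv_smoothStep_nonneg hε a x))
    (((continuous_deriv_smoothStep ε a).const_mul C).intervalIntegrable _ _)
  rwa [intervalIntegral.integral_const_mul, integral_deriv_smoothStep hε, mul_one] at h

/-- The derivatives of the steps at `a` are kernels supported on the right of `a`; in the limit they
pick out the right limit. -/
theorem tendsto_integral_mul_deriv_smoothStep {a b L : ℝ} {g : ℝ → ℝ} (hab : a < b)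
    (hg : IntervalIntegrable g volume a b) (hL : Tendsto g (𝓝[>] a) (𝓝 L)) :
    Tendsto (fun ε => ∫ x in a..(a + ε), g x * deriv (smoothStep ε a) x) (𝓝[>] 0) (𝓝 L) := by
  refine Metric.tendsto_nhds.2 fun η hη => ?_
  obtain ⟨δ, hδ, hb⟩ : ∃ δ, 0 < δ ∧ ∀ x ∈ Ioo a (a + δ), |g x - L| < η / 2 := by
    obtain ⟨c, hc, hsub⟩ := mem_nhdsGT_iff_exists_Ioo_subset.1
      (Metric.tendsto_nhds.1 hL _ (half_pos hη))
    refine ⟨c - a, sub_pos.2 hc, fun x hx => ?_⟩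
    have := hsub ⟨hx.1, by linarith [hx.2]⟩
    rwa [mem_ofPred_eq, Real.dist_eq] at this
  filter_upwards [Ioo_mem_nhdsGT (lt_min hδ (sub_pos.2 hab))] with ε hε
  have hε1 : ε < δ := hε.2.trans_le (min_le_left _ _)
  have hε2 : ε < b - a := hε.2.trans_le (min_le_right _ _)
  have hga : IntervalIntegrable g volume a (a + ε) :=
    hg.mono_set (by
      rw [uIcc_of_le (by linarith [hε.1]), uIcc_of_le hab.le]
      exact Icc_subset_Icc le_rfl (by linarith))
  have hk := (continuous_deriv_smoothStep ε a)
  have h1 := abs_integral_mul_deriv_smoothStep_le (a := a) (C := η / 2)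
    (g := fun x => g x - L) hε.1 fun x hx => (hb x ⟨hx.1, by linarith [hx.2]⟩).le
  have h2 : ∫ x in a..(a + ε), (g x - L) * deriv (smoothStep ε a) x =
      (∫ x in a..(a + ε), g x * deriv (smoothStep ε a) x) - L := by
    simp_rw [sub_mul]
    rw [intervalIntegral.integral_sub (hga.mul_continuousOn hk.continuousOn)
      ((hk.const_mul L).intervalIntegrable _ _), intervalIntegral.integral_const_mul,
      integral_deriv_smoothStep hε.1, mul_one]
  rw [h2] at h1
  rw [Real.dist_eq]
  linarith

theorem tendsto_integral_mul_smoothStep {a b : ℝ} {g : ℝ → ℝ} (hab : a ≤ b)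
    (hg : IntervalIntegrable g volume a b) :
    Tendsto (fun ε => ∫ x in a..b, g x * smoothStep ε a x) (𝓝[>] 0) (𝓝 (∫ x in a..b, g x)) := by
  refine intervalIntegral.tendsto_integral_filter_of_dominated_convergence (fun x => |g x|)
    (Eventually.of_forall fun ε => ?_) (Eventually.of_forall fun ε => ae_of_all _ fun x _ => ?_)
    hg.abs (ae_of_all _ fun x hx => ?_)
  · exact (hg.mul_continuousOn
      (continuous_smoothStep ε a).continuousOn).def'.aestronglyMeasurable
  · rw [Real.norm_eq_abs, abs_mul, abs_of_nonneg (smoothStep_nonneg ε a x)]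
    exact mul_le_of_le_one_right (abs_nonneg _) (smoothStep_le_one ε a x)
  · rw [uIoc_of_le hab] at hx
    refine tendsto_const_nhds.congr' ?_
    filter_upwards [Ioo_mem_nhdsGT (sub_pos.2 hx.1)] with ε hε
    rw [smoothStep_of_ge hε.1 (by linarith [hε.2]), mul_one]

/-- A smooth approximation of the indicator function of `(a, b]`. -/
def smoothInd (ε a b x : ℝ) : ℝ := smoothStep ε a x - smoothStep ε b x

theorem contDiff_smoothInd (ε a b : ℝ) : ContDiff ℝ ∞ (smoothInd ε a b) :=
  (contDiff_smoothStep ε a).sub (contDiff_smoothStep ε b)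

theorem smoothInd_eq_zero {ε a b x : ℝ} (hε : 0 < ε) (hab : a ≤ b) (hx : x ∉ Icc a (b + ε)) :
    smoothInd ε a b x = 0 := by
  rcases lt_or_ge x a with h | h
  · rw [smoothInd, smoothStep_of_le hε h.le, smoothStep_of_le hε (h.le.trans hab), sub_zero]
  · have h' : b + ε < x := by
      by_contra! h'
      exact hx ⟨h, h'⟩
    rw [smoothInd, smoothStep_of_ge hε (by linarith), smoothStep_of_ge hε h'.le, sub_self]

theorem deriv_smoothInd (ε a b x : ℝ) :
    deriv (smoothInd ε a b) x = deriv (smoothStep ε a) x - deriv (smoothStep ε b) x :=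
  ((hasDerivAt_smoothStep ε a x).sub (hasDerivAt_smoothStep ε b x)).deriv

theorem tsupport_smoothInd {ε a b : ℝ} (hε : 0 < ε) (hab : a ≤ b) :
    tsupport (smoothInd ε a b) ⊆ Icc a (b + ε) :=
  closure_minimal (fun x hx => by
    by_contra h
    exact hx (smoothInd_eq_zero hε hab h)) isClosed_Icc

theorem hasCompactSupport_smoothInd {ε a b : ℝ} (hε : 0 < ε) (hab : a ≤ b) :
    HasCompactSupport (smoothInd ε a b) :=
  HasCompactSupport.of_support_subset_isCompact isCompact_Icc
    (subset_closure.trans (tsupport_smoothInd hε hab))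

theorem integral_mul_smoothInd {ε a b : ℝ} {g : ℝ → ℝ} (hε : 0 < ε) (hε1 : ε ≤ 1) (hab : a ≤ b)
    (hg : IntervalIntegrable g volume a (b + 1)) :
    Integrable (fun x => g x * smoothInd ε a b x) ∧
    ∫ x, g x * smoothInd ε a b x =
      (∫ x in a..(b + 1), g x * smoothStep ε a x) - ∫ x in b..(b + 1), g x * smoothStep ε b x := by
  have hle : a ≤ b + 1 := by linarith
  have hz : ∀ x, x ∉ Ioc a (b + 1) → g x * smoothInd ε a b x = 0 := fun x hx => by
    rcases eq_or_ne x a with rfl | hne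
    · rw [smoothInd, smoothStep_of_le hε le_rfl, smoothStep_of_le hε hab, sub_zero, mul_zero]
    · rw [smoothInd_eq_zero hε hab, mul_zero]
      exact fun h => hx ⟨lt_of_le_of_ne h.1 hne.symm, h.2.trans (by linarith)⟩
  have ia := hg.mul_continuousOn (continuous_smoothStep ε a).continuousOn
  have ib := hg.mul_continuousOn (continuous_smoothStep ε b).continuousOn
  have hi : IntervalIntegrable (fun x => g x * smoothInd ε a b x) volume a (b + 1) := by
    have := ia.sub ib
    simpa only [smoothInd, mul_sub] using this
  refine ⟨((intervalIntegrable_iff_integrableOn_Ioc_of_le hle).1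
    hi).integrable_of_forall_notMem_eq_zero hz, ?_⟩
  have hsub : ∀ {c d}, a ≤ c → c ≤ d → d ≤ b + 1 →
      IntervalIntegrable (fun x => g x * smoothStep ε b x) volume c d := fun hc hcd hd =>
    ib.mono_set (by rw [uIcc_of_le hcd, uIcc_of_le hle]; exact Icc_subset_Icc hc hd)
  have h0 : ∫ x in a..b, g x * smoothStep ε b x = 0 := by
    rw [intervalIntegral.integral_congr (g := fun _ => (0 : ℝ)), intervalIntegral.integral_zero]
    intro x hx
    rw [uIcc_of_le hab] at hx
    simp only [smoothStep_of_le hε hx.2, mul_zero]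
  rw [← setIntegral_eq_integral_of_forall_compl_eq_zero hz, ← intervalIntegral.integral_of_le hle]
  simp_rw [smoothInd, mul_sub]
  rw [intervalIntegral.integral_sub ia ib, ← intervalIntegral.integral_add_adjacent_intervals
    (hsub le_rfl hab (by linarith)) (hsub hab (by linarith) le_rfl), h0, zero_add]

theorem tendsto_integral_mul_smoothInd {a b : ℝ} {g : ℝ → ℝ} (hab : a ≤ b)
    (hg : IntervalIntegrable g volume a (b + 1)) :
    Tendsto (fun ε => ∫ x, g x * smoothInd ε a b x) (𝓝[>] 0) (𝓝 (∫ x in a..b, g x)) := by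
  have hsub : ∀ {c d}, a ≤ c → c ≤ d → d ≤ b + 1 → IntervalIntegrable g volume c d :=
    fun hc hcd hd => hg.mono_set (by
      rw [uIcc_of_le hcd, uIcc_of_le (by linarith)]; exact Icc_subset_Icc hc hd)
  have h := (tendsto_integral_mul_smoothStep (by linarith) hg).sub
    (tendsto_integral_mul_smoothStep (by linarith) (hsub hab (by linarith) le_rfl))
  rw [← intervalIntegral.integral_add_adjacent_intervals (hsub le_rfl hab (by linarith))
    (hsub hab (by linarith) le_rfl), add_sub_cancel_right] at h
  refine h.congr' ?_
  filter_upwards [Ioo_mem_nhdsGT one_pos] with ε hε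
  rw [(integral_mul_smoothInd hε.1 hε.2.le hab hg).2]

theorem integral_mul_deriv_smoothInd {ε a b : ℝ} {g : ℝ → ℝ} (hε : 0 < ε) (hε1 : ε ≤ 1)
    (hab : a ≤ b) (hg : IntervalIntegrable g volume a (b + 1)) :
    Integrable (fun x => g x * deriv (smoothInd ε a b) x) ∧
    ∫ x, g x * deriv (smoothInd ε a b) x =
      (∫ x in a..(a + ε), g x * deriv (smoothStep ε a) x) -
        ∫ x in b..(b + ε), g x * deriv (smoothStep ε b) x := by
  have hsub : ∀ {c d}, a ≤ c → c ≤ d → d ≤ b + 1 → IntervalIntegrable g volume c d :=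
    fun hc hcd hd => hg.mono_set (by
      rw [uIcc_of_le hcd, uIcc_of_le (by linarith)]; exact Icc_subset_Icc hc hd)
  obtain ⟨ha, ha'⟩ := integrable_mul_deriv_smoothStep hε
    (hsub le_rfl (by linarith) (by linarith : a + ε ≤ b + 1))
  obtain ⟨hb, hb'⟩ := integrable_mul_deriv_smoothStep hε
    (hsub hab (by linarith) (by linarith : b + ε ≤ b + 1))
  simp_rw [deriv_smoothInd, mul_sub]
  exact ⟨ha.sub hb, by rw [integral_sub ha hb, ha', hb']⟩

theorem tendsto_integral_mul_deriv_smoothInd {a b La Lb : ℝ} {g : ℝ → ℝ} (hab : a ≤ b)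
    (hg : IntervalIntegrable g volume a (b + 1)) (ha : Tendsto g (𝓝[>] a) (𝓝 La))
    (hb : Tendsto g (𝓝[>] b) (𝓝 Lb)) :
    Tendsto (fun ε => ∫ x, g x * deriv (smoothInd ε a b) x) (𝓝[>] 0) (𝓝 (La - Lb)) := by
  have hg' : IntervalIntegrable g volume b (b + 1) := hg.mono_set (by
    rw [uIcc_of_le (by linarith), uIcc_of_le (by linarith)]; exact Icc_subset_Icc hab le_rfl)
  have h := (tendsto_integral_mul_deriv_smoothStep (by linarith) hg ha).sub
    (tendsto_integral_mul_deriv_smoothStep (by linarith) hg' hb)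
  refine h.congr' ?_
  filter_upwards [Ioo_mem_nhdsGT one_pos] with ε hε
  rw [(integral_mul_deriv_smoothInd hε.1 hε.2.le hab hg).2]

/-! ### The integrated conservation law -/

theorem restrict_halfPlane :
    (volume : Measure (ℝ × ℝ)).restrict halfPlane =
      (volume : Measure ℝ).prod ((volume : Measure ℝ).restrict (Ioi 0)) := by
  have : halfPlane = univ ×ˢ Ioi (0 : ℝ) := by ext p; simp [halfPlane]
  rw [this, Measure.volume_eq_prod, ← Measure.prod_restrict, Measure.restrict_univ]

namespace IsSolution

/-- Weak continuity in time, also of nonlinear functions of `u`, from the almost everywhere joint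
continuity of `u`. -/
theorem continuousOn_integral_comp (H : IsSolution f φ u) {g k : ℝ → ℝ} (hg : Continuous g)
    (hk : Integrable k) : ContinuousOn (fun t => ∫ x, g (u x t) * k x) (Ioi 0) := by
  intro t ht
  have ht : 0 < t := ht
  obtain ⟨M, hM⟩ := H.entropy.bounded
  obtain ⟨K, hK⟩ := (isCompact_Icc (a := -M) (b := M)).exists_bound_of_continuousOn hg.continuousOn
  have hpos : ∀ᶠ s in 𝓝[Ioi 0] t, 0 < s := self_mem_nhdsWithin
  refine tendsto_integral_filter_of_dominated_convergence (fun x => K * |k x|) ?_ ?_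
    (hk.abs.const_mul K) ?_
  · filter_upwards [hpos] with s hs
    exact (hg.measurable.comp (H.measurable hs)).aestronglyMeasurable.mul hk.aestronglyMeasurable
  · filter_upwards [hpos] with s hs
    refine ae_of_all _ fun x => ?_
    rw [norm_mul]
    exact mul_le_mul_of_nonneg_right (hK _ (abs_le.1 (hM x s hs))) (norm_nonneg _)
  · filter_upwards [H.ae_continuousAt ht] with x hx
    have h1 := (H.tendsto_of_continuousAt ht hx).comp
      ((Continuous.prodMk_right x).tendsto t)
    exact (((hg.tendsto _).comp h1).mul_const _).mono_left nhdsWithin_le_nhds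

/-- The weak formulation tested with a product `α(x) β(t)`. -/
theorem weak_product (H : IsSolution f φ u) {α β : ℝ → ℝ} (hα : ContDiff ℝ ∞ α)
    (hα' : HasCompactSupport α) (hβ : ContDiff ℝ ∞ β) (hβ' : HasCompactSupport β)
    (hβ0 : tsupport β ⊆ Ioi 0) :
    ∫ t in Ioi (0 : ℝ), ((∫ x, u x t * α x) * deriv β t + (∫ x, f (u x t) * deriv α x) * β t)
      = 0 := by
  obtain ⟨M, hM⟩ := H.entropy.bounded
  obtain ⟨K, hK⟩ := (isCompact_Icc (a := -M) (b := M)).exists_bound_of_continuousOn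
    H.flux.continuous.continuousOn
  have hdα : Continuous (deriv α) := hα.continuous_deriv (by norm_num)
  have hdβ : Continuous (deriv β) := hβ.continuous_deriv (by norm_num)
  set ψ : ℝ × ℝ → ℝ := fun p => α p.1 * β p.2 with hψ
  have hts : tsupport ψ ⊆ tsupport α ×ˢ tsupport β := by
    refine closure_minimal (fun p hp => ?_) ((isClosed_tsupport α).prod (isClosed_tsupport β))
    exact ⟨subset_tsupport α (left_ne_zero_of_mul hp), subset_tsupport β (right_ne_zero_of_mul hp)⟩
  have hfd : ∀ p : ℝ × ℝ, fderiv ℝ ψ p (0, 1) = α p.1 * deriv β p.2 ∧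
      fderiv ℝ ψ p (1, 0) = deriv α p.1 * β p.2 := by
    intro p
    have ha : HasFDerivAt (fun q : ℝ × ℝ => α q.1) _ p :=
      ((hα.differentiable (by norm_num) p.1).hasDerivAt).hasFDerivAt.comp p hasFDerivAt_fst
    have hb : HasFDerivAt (fun q : ℝ × ℝ => β q.2) _ p :=
      ((hβ.differentiable (by norm_num) p.2).hasDerivAt).hasFDerivAt.comp p hasFDerivAt_snd
    have h := (ha.mul hb).fderiv
    rw [hψ]
    constructor <;>
    · erw [h]
      simp [mul_comm]
  have heq := H.entropy.equation ψ
    ((hα.comp contDiff_fst).mul (hβ.comp contDiff_snd))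
    (HasCompactSupport.of_support_subset_isCompact (hα'.isCompact.prod hβ'.isCompact)
      (subset_closure.trans hts))
    (hts.trans fun p hp => hβ0 hp.2)
  simp only [(hfd _).1, (hfd _).2] at heq
  rw [restrict_halfPlane] at heq
  have hmeas := H.entropy.measurable
  rw [restrict_halfPlane] at hmeas
  have hbd : ∀ᵐ p ∂((volume : Measure ℝ).prod ((volume : Measure ℝ).restrict (Ioi 0))),
      0 < p.2 := by
    rw [← restrict_halfPlane]
    refine ae_restrict_mem ?_
    exact measurableSet_lt measurable_const measurable_snd
  have hint : ∀ (a b : ℝ → ℝ), Continuous a → HasCompactSupport a → Continuous b →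
      HasCompactSupport b → Integrable (fun p : ℝ × ℝ => a p.1 * b p.2)
        ((volume : Measure ℝ).prod ((volume : Measure ℝ).restrict (Ioi 0))) :=
    fun a b ha ha' hb hb' => (ha.integrable_of_hasCompactSupport ha').mul_prod
      (hb.integrable_of_hasCompactSupport hb').integrableOn
  have i1 : Integrable (fun p : ℝ × ℝ => u p.1 p.2 * (α p.1 * deriv β p.2))
      ((volume : Measure ℝ).prod ((volume : Measure ℝ).restrict (Ioi 0))) :=
    (hint α _ hα.continuous hα' hdβ hβ'.deriv).bdd_mul (c := M) hmeas.aestronglyMeasurable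
      (hbd.mono fun p hp => hM _ _ hp)
  have i2 : Integrable (fun p : ℝ × ℝ => f (u p.1 p.2) * (deriv α p.1 * β p.2))
      ((volume : Measure ℝ).prod ((volume : Measure ℝ).restrict (Ioi 0))) :=
    (hint _ β hdα hα'.deriv hβ.continuous hβ').bdd_mul (c := K)
      (H.flux.continuous.measurable.comp_aemeasurable hmeas).aestronglyMeasurable
      (hbd.mono fun p hp => hK _ (abs_le.1 (hM _ _ hp)))
  rw [integral_add i1 i2, integral_prod_symm _ i1, integral_prod_symm _ i2] at heq
  have j1 := i1.integral_prod_right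
  have j2 := i2.integral_prod_right
  rw [← integral_add j1 j2] at heq
  refine Eq.trans ?_ heq
  refine integral_congr_ae (ae_of_all _ fun t => ?_)
  simp only [← mul_assoc]
  rw [integral_mul_const, integral_mul_const]

/-- The conservation law integrated over a time interval against a test function of `x` alone. -/
theorem integral_smooth_sub (H : IsSolution f φ u) {α : ℝ → ℝ} (hα : ContDiff ℝ ∞ α)
    (hα' : HasCompactSupport α) {t₁ t₂ : ℝ} (h₁ : 0 < t₁) (h₁₂ : t₁ ≤ t₂) :
    (∫ x, u x t₂ * α x) - ∫ x, u x t₁ * α x =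
      ∫ t in t₁..t₂, ∫ x, f (u x t) * deriv α x := by
  have hm := H.continuousOn_integral_comp (g := fun v => v) (k := α) continuous_id
    (hα.continuous.integrable_of_hasCompactSupport hα')
  have hn := H.continuousOn_integral_comp (g := f) (k := deriv α) H.flux.continuous
    ((hα.continuous_deriv (by norm_num)).integrable_of_hasCompactSupport hα'.deriv)
  set m := fun t => ∫ x, u x t * α x with hmdef
  set n := fun t => ∫ x, f (u x t) * deriv α x with hndef
  have hI : ∀ g : ℝ → ℝ, ContinuousOn g (Ioi 0) → IntervalIntegrable g volume t₁ (t₂ + 1) :=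
    fun g hg => (hg.mono fun t ht => by
      rw [uIcc_of_le (by linarith)] at ht
      exact h₁.trans_le ht.1).intervalIntegrable
  have hlim : ∀ t, 0 < t → Tendsto m (𝓝[>] t) (𝓝 (m t)) := fun t ht =>
    (hm.continuousAt (Ioi_mem_nhds ht)).tendsto.mono_left nhdsWithin_le_nhds
  have hL := (tendsto_integral_mul_deriv_smoothInd h₁₂ (hI m hm) (hlim t₁ h₁)
    (hlim t₂ (h₁.trans_le h₁₂))).add (tendsto_integral_mul_smoothInd h₁₂ (hI n hn))
  have h0 : ∀ᶠ ε in 𝓝[>] (0 : ℝ), (∫ t, m t * deriv (smoothInd ε t₁ t₂) t) +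
      ∫ t, n t * smoothInd ε t₁ t₂ t = 0 := by
    filter_upwards [Ioo_mem_nhdsGT one_pos] with ε hε
    have hs : tsupport (smoothInd ε t₁ t₂) ⊆ Ioi 0 := (tsupport_smoothInd hε.1 h₁₂).trans
      fun t ht => h₁.trans_le ht.1
    have hw := H.weak_product hα hα' (contDiff_smoothInd ε t₁ t₂)
      (hasCompactSupport_smoothInd hε.1 h₁₂) hs
    rw [setIntegral_eq_integral_of_forall_compl_eq_zero] at hw
    · rw [← integral_add (integral_mul_deriv_smoothInd hε.1 hε.2.le h₁₂ (hI m hm)).1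
        (integral_mul_smoothInd hε.1 hε.2.le h₁₂ (hI n hn)).1]
      exact hw
    · intro t ht
      have ht' : t ∉ tsupport (smoothInd ε t₁ t₂) := fun h => ht (hs h)
      rw [image_eq_zero_of_notMem_tsupport ht',
        image_eq_zero_of_notMem_tsupport (fun h => ht' (tsupport_deriv_subset h)), mul_zero,
        mul_zero, add_zero]
  have := tendsto_nhds_unique_of_eventuallyEq hL tendsto_const_nhds h0
  linarith

/-- The conservation law in integrated form, with the flux through the right traces. -/
theorem integral_sub_eq_flux (H : IsSolution f φ u) {a b t₁ t₂ : ℝ} (hab : a ≤ b) (h₁ : 0 < t₁)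
    (h₁₂ : t₁ ≤ t₂) : (∫ x in a..b, u x t₂) - ∫ x in a..b, u x t₁ =
      ∫ t in t₁..t₂, (f (rightTrace u a t) - f (rightTrace u b t)) := by
  obtain ⟨M, hM⟩ := H.entropy.bounded
  obtain ⟨K, hK⟩ := (isCompact_Icc (a := -M) (b := M)).exists_bound_of_continuousOn
    H.flux.continuous.continuousOn
  have hL := (tendsto_integral_mul_smoothInd hab (H.intervalIntegrable (h₁.trans_le h₁₂) _ _)).sub
    (tendsto_integral_mul_smoothInd hab (H.intervalIntegrable h₁ _ _))
  have hR : Tendsto (fun ε => ∫ t in t₁..t₂, ∫ x, f (u x t) * deriv (smoothInd ε a b) x) (𝓝[>] 0)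
      (𝓝 (∫ t in t₁..t₂, (f (rightTrace u a t) - f (rightTrace u b t)))) := by
    have hsub : uIoc t₁ t₂ ⊆ Ioi 0 := fun t ht => by
      rw [uIoc_of_le h₁₂] at ht
      exact h₁.trans ht.1
    refine intervalIntegral.tendsto_integral_filter_of_dominated_convergence (fun _ => K + K)
      ?_ ?_ intervalIntegrable_const (ae_of_all _ fun t ht => ?_)
    · filter_upwards [self_mem_nhdsWithin] with ε hε
      exact ((H.continuousOn_integral_comp H.flux.continuous
        (((contDiff_smoothInd ε a b).continuous_deriv
          (by norm_num)).integrable_of_hasCompactSupport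
            (hasCompactSupport_smoothInd hε hab).deriv)).mono hsub).aestronglyMeasurable
        measurableSet_uIoc
    · filter_upwards [Ioo_mem_nhdsGT one_pos] with ε hε
      refine ae_of_all _ fun t ht => ?_
      have ht0 : 0 < t := hsub ht
      rw [(integral_mul_deriv_smoothInd hε.1 hε.2.le hab
        (H.intervalIntegrable_comp H.flux.continuous ht0 _ _)).2]
      refine (norm_sub_le _ _).trans (add_le_add ?_ ?_) <;>
      exact abs_integral_mul_deriv_smoothStep_le hε.1 fun x _ => hK _ (abs_le.1 (hM x t ht0))
    · have ht0 : 0 < t := hsub ht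
      exact tendsto_integral_mul_deriv_smoothInd hab
        (H.intervalIntegrable_comp H.flux.continuous ht0 _ _)
        ((H.flux.continuous.tendsto _).comp (H.tendsto_rightTrace a ht0))
        ((H.flux.continuous.tendsto _).comp (H.tendsto_rightTrace b ht0))
  refine tendsto_nhds_unique_of_eventuallyEq hL hR ?_
  filter_upwards [self_mem_nhdsWithin] with ε hε
  exact H.integral_smooth_sub (contDiff_smoothInd ε a b) (hasCompactSupport_smoothInd hε hab)
    h₁ h₁₂

end IsSolution

/-! ### The potential of an entropy solution -/

/-- The potential `W` of `u`, with `W_x = u` and `W_t = -f(u)`.  It is integrated in time along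
`x = 0`, where the values of `u` are replaced by its right traces, and then in space. -/
def potential (f : ℝ → ℝ) (u : ℝ → ℝ → ℝ) (x t : ℝ) : ℝ :=
  (∫ y in (0 : ℝ)..x, u y t) - ∫ r in (0 : ℝ)..t, f (rightTrace u 0 r)

theorem abs_integral_sub_mul_le {g : ℝ → ℝ} {a b c ε : ℝ} (hg : IntervalIntegrable g volume a b)
    (h : ∀ y ∈ uIoc a b, |g y - c| ≤ ε) : |(∫ y in a..b, g y) - c * (b - a)| ≤ ε * |b - a| := by
  have h1 : (∫ y in a..b, g y) - c * (b - a) = ∫ y in a..b, (g y - c) := by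
    rw [intervalIntegral.integral_sub hg intervalIntegrable_const, intervalIntegral.integral_const,
      smul_eq_mul, mul_comm c]
  rw [h1, ← Real.norm_eq_abs]
  exact intervalIntegral.norm_integral_le_of_norm_le_const h

namespace IsSolution

theorem exists_bound (H : IsSolution f φ u) : ∃ C, 0 ≤ C ∧
    (∀ x t, 0 < t → |u x t| ≤ C) ∧ (∀ x t, 0 < t → |f (u x t)| ≤ C) ∧
    (∀ x t, 0 < t → |deriv f (u x t)| ≤ C) ∧ ∀ x t, 0 < t → |f (rightTrace u x t)| ≤ C := by
  obtain ⟨M, hM⟩ := H.entropy.bounded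
  obtain ⟨K, hK⟩ := (isCompact_Icc (a := -M) (b := M)).exists_bound_of_continuousOn
    H.flux.continuous.continuousOn
  obtain ⟨L, hL⟩ := (isCompact_Icc (a := -M) (b := M)).exists_bound_of_continuousOn
    H.flux.continuous_deriv.continuousOn
  have h1 : M ≤ max M (max K L) := le_max_left _ _
  have h2 : K ≤ max M (max K L) := (le_max_left _ _).trans (le_max_right _ _)
  have h3 : L ≤ max M (max K L) := (le_max_right _ _).trans (le_max_right _ _)
  refine ⟨max M (max K L), ((abs_nonneg _).trans (hM 0 1 one_pos)).trans h1,
    fun x t ht => (hM x t ht).trans h1, fun x t ht => (hK _ (abs_le.1 (hM x t ht))).trans h2,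
    fun x t ht => (hL _ (abs_le.1 (hM x t ht))).trans h3,
    fun x t ht => (hK _ (abs_le.1 (H.abs_rightTrace_le hM x ht))).trans h2⟩

/-- The flux through a vertical line is a limit of smooth averages in `x`, which are continuous in
time. -/
theorem aestronglyMeasurable_flux (H : IsSolution f φ u) (x : ℝ) :
    AEStronglyMeasurable (fun r => f (rightTrace u x r)) (volume.restrict (Ioi 0)) := by
  refine aestronglyMeasurable_of_tendsto_ae (u := 𝓝[>] (0 : ℝ))
    (f := fun ε r => ∫ y, f (u y r) * (if 0 < ε then deriv (smoothStep ε x) y else 0))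
    (fun ε => ?_) ?_
  · refine (H.continuousOn_integral_comp H.flux.continuous ?_).aestronglyMeasurable
      measurableSet_Ioi
    split_ifs with hε
    · simpa using (integrable_mul_deriv_smoothStep (a := x) (g := fun _ => (1 : ℝ)) hε
        intervalIntegrable_const).1
    · exact integrable_zero _ _ _
  · filter_upwards [ae_restrict_mem measurableSet_Ioi] with r hr
    have hi := H.intervalIntegrable_comp H.flux.continuous hr
    refine (tendsto_integral_mul_deriv_smoothStep (lt_add_one x) (hi x (x + 1))
      ((H.flux.continuous.tendsto _).comp (H.tendsto_rightTrace x hr))).congr' ?_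
    filter_upwards [self_mem_nhdsWithin] with ε hε
    have hε' : 0 < ε := hε
    simp only [if_pos hε']
    exact (integrable_mul_deriv_smoothStep hε (hi x (x + ε))).2.symm

theorem intervalIntegrable_flux (H : IsSolution f φ u) (x : ℝ) {a b : ℝ} (ha : 0 ≤ a)
    (hb : 0 ≤ b) : IntervalIntegrable (fun r => f (rightTrace u x r)) volume a b := by
  obtain ⟨C, -, -, -, -, hC⟩ := H.exists_bound
  have hsub : uIoc a b ⊆ Ioi 0 := fun r hr => (le_min ha hb).trans_lt hr.1
  refine (intervalIntegrable_const (c := C)).mono_fun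
    ((H.aestronglyMeasurable_flux x).mono_set hsub) ?_
  filter_upwards [ae_restrict_mem measurableSet_uIoc] with r hr
  exact (hC x r (hsub hr)).trans (le_abs_self C)

theorem potential_sub_space (H : IsSolution f φ u) (x y : ℝ) {t : ℝ} (ht : 0 < t) :
    potential f u y t - potential f u x t = ∫ z in x..y, u z t := by
  rw [← H.integral_sub ht]
  unfold potential
  ring

theorem potential_sub_time (H : IsSolution f φ u) (x : ℝ) {s t : ℝ} (hs : 0 < s) (ht : 0 < t) :
    potential f u x t - potential f u x s = -∫ r in s..t, f (rightTrace u x r) := by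
  wlog hst : s ≤ t generalizing s t
  · have := this ht hs (le_of_not_ge hst)
    rw [intervalIntegral.integral_symm]
    linarith
  have hI := fun y => H.intervalIntegrable_flux y hs.le ht.le
  have h0 : (∫ r in (0 : ℝ)..t, f (rightTrace u 0 r)) - ∫ r in (0 : ℝ)..s, f (rightTrace u 0 r) =
      ∫ r in s..t, f (rightTrace u 0 r) :=
    intervalIntegral.integral_interval_sub_left (H.intervalIntegrable_flux 0 le_rfl ht.le)
      (H.intervalIntegrable_flux 0 le_rfl hs.le)
  unfold potential
  rcases le_total 0 x with hx | hx
  · have := H.integral_sub_eq_flux hx hs hst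
    rw [intervalIntegral.integral_sub (hI _) (hI _)] at this
    linarith
  · have := H.integral_sub_eq_flux hx hs hst
    rw [intervalIntegral.integral_sub (hI _) (hI _)] at this
    rw [intervalIntegral.integral_symm x 0, intervalIntegral.integral_symm x 0]
    linarith

theorem abs_potential_sub_space_le (H : IsSolution f φ u) {C : ℝ}
    (hC : ∀ x t, 0 < t → |u x t| ≤ C) (x y : ℝ) {t : ℝ} (ht : 0 < t) :
    |potential f u y t - potential f u x t| ≤ C * |y - x| := by
  rw [H.potential_sub_space x y ht]
  exact abs_integral_le hC ht x y

theorem abs_potential_sub_time_le (H : IsSolution f φ u) {C : ℝ}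
    (hC : ∀ x t, 0 < t → |f (rightTrace u x t)| ≤ C) (x : ℝ) {s t : ℝ} (hs : 0 < s) (ht : 0 < t) :
    |potential f u x t - potential f u x s| ≤ C * |t - s| := by
  rw [H.potential_sub_time x hs ht, abs_neg, ← Real.norm_eq_abs]
  exact intervalIntegral.norm_integral_le_of_norm_le_const fun r hr =>
    hC x r ((lt_min hs ht).trans hr.1)

theorem abs_potential_sub_primitive_le (H : IsSolution f φ u) {C : ℝ}
    (hC : ∀ x t, 0 < t → |f (rightTrace u x t)| ≤ C) (x : ℝ) {t : ℝ} (ht : 0 < t) :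
    |potential f u x t - primitive φ x| ≤ C * t := by
  have hlim : Tendsto (fun s => potential f u x s) (𝓝[>] 0) (𝓝 (primitive φ x)) := by
    have h1 := H.entropy.initial 0 x
    have h2 : Tendsto (fun s => ∫ r in (0 : ℝ)..s, f (rightTrace u 0 r)) (𝓝[>] 0) (𝓝 0) := by
      refine squeeze_zero_norm' (a := fun s => C * |s - 0|) ?_ ?_
      · filter_upwards [self_mem_nhdsWithin] with s hs
        have hs : (0 : ℝ) < s := hs
        exact intervalIntegral.norm_integral_le_of_norm_le_const fun r hr =>
          hC 0 r ((le_min le_rfl hs.le).trans_lt hr.1)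
      · have : Continuous fun s : ℝ => C * |s - 0| := by fun_prop
        simpa using (this.tendsto 0).mono_left (nhdsWithin_le_nhds (s := Ioi 0))
    simpa [potential, primitive] using h1.sub h2
  have h3 : Tendsto (fun s => |potential f u x t - potential f u x s|) (𝓝[>] 0)
      (𝓝 |potential f u x t - primitive φ x|) := (tendsto_const_nhds.sub hlim).abs
  have h4 : Tendsto (fun s => C * |t - s|) (𝓝[>] 0) (𝓝 (C * t)) := by
    have : Continuous fun s : ℝ => C * |t - s| := by fun_prop
    simpa [abs_of_pos ht] using (this.tendsto 0).mono_left (nhdsWithin_le_nhds (s := Ioi 0))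
  refine le_of_tendsto_of_tendsto h3 h4 ?_
  filter_upwards [self_mem_nhdsWithin] with s hs
  exact H.abs_potential_sub_time_le hC x hs ht

theorem continuous_potential (H : IsSolution f φ u) {t : ℝ} (ht : 0 < t) :
    Continuous fun x => potential f u x t := by
  obtain ⟨C, -, hC, -⟩ := H.exists_bound
  refine (LipschitzWith.of_dist_le' (K := C) fun x y => ?_).continuous
  rw [Real.dist_eq, Real.dist_eq]
  exact H.abs_potential_sub_space_le hC y x ht

/-- At a point of continuity of `u` the potential is differentiable, with gradient `(u, -f(u))`. -/
theorem hasFDerivAt_potential (H : IsSolution f φ u) {x t : ℝ} (ht : 0 < t)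
    (hx : ContinuousAt (fun y => u y t) x) :
    HasFDerivAt (fun p : ℝ × ℝ => potential f u p.1 p.2)
      (u x t • ContinuousLinearMap.fst ℝ ℝ ℝ - f (u x t) • ContinuousLinearMap.snd ℝ ℝ ℝ)
      (x, t) := by
  refine HasFDerivAt.of_isLittleO (Asymptotics.isLittleO_iff.2 fun ε hε => ?_)
  have h1 := H.tendsto_of_continuousAt ht hx
  have h2 := (H.flux.continuous.tendsto _).comp (H.tendsto_rightTrace_of_continuousAt ht hx)
  obtain ⟨δ₁, hδ₁, hb₁⟩ := Metric.eventually_nhds_iff.1 (Metric.tendsto_nhds.1 h1 _ (half_pos hε))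
  obtain ⟨δ₂, hδ₂, hb₂⟩ := Metric.eventually_nhds_iff.1 (Metric.tendsto_nhds.1 h2 _ (half_pos hε))
  have hδ : 0 < min t (min δ₁ δ₂) := lt_min ht (lt_min hδ₁ hδ₂)
  filter_upwards [Metric.ball_mem_nhds (x, t) hδ] with p hp
  have hp' : dist p (x, t) < min t (min δ₁ δ₂) := hp
  rw [Prod.dist_eq, max_lt_iff, Real.dist_eq, Real.dist_eq] at hp'
  have l1 : min t (min δ₁ δ₂) ≤ t := min_le_left _ _
  have l2 : min t (min δ₁ δ₂) ≤ δ₁ := (min_le_right _ _).trans (min_le_left _ _)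
  have l3 : min t (min δ₁ δ₂) ≤ δ₂ := (min_le_right _ _).trans (min_le_right _ _)
  have hp2 : 0 < p.2 := by linarith [(abs_lt.1 hp'.2).1]
  have e1 := abs_integral_sub_mul_le (c := u x t) (ε := ε / 2) (H.intervalIntegrable ht x p.1)
    fun y hy => by
      have hy' : |y - x| ≤ |p.1 - x| := by
        have := abs_sub_left_of_mem_uIcc (uIoc_subset_uIcc hy)
        simpa using this
      have := hb₁ (y := (y, t)) (by
        rw [Prod.dist_eq, max_lt_iff, Real.dist_eq, dist_self]
        exact ⟨by linarith [hp'.1], hδ₁⟩)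
      exact (le_of_lt (by simpa [Real.dist_eq] using this))
  have e2 := abs_integral_sub_mul_le (c := f (u x t)) (ε := ε / 2)
    (H.intervalIntegrable_flux p.1 ht.le hp2.le)
    fun r hr => by
      have hr' : |r - t| ≤ |p.2 - t| := by
        have := abs_sub_left_of_mem_uIcc (uIoc_subset_uIcc hr)
        simpa using this
      have := hb₂ (y := (p.1, r)) (by
        rw [Prod.dist_eq, max_lt_iff, Real.dist_eq, Real.dist_eq]
        exact ⟨by linarith [hp'.1], by linarith [hp'.2]⟩)
      exact (le_of_lt (by simpa [Real.dist_eq] using this))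
  rw [← H.potential_sub_space x p.1 ht] at e1
  rw [← neg_neg (∫ r in t..p.2, _), ← H.potential_sub_time p.1 ht hp2] at e2
  have n1 : |p.1 - x| ≤ ‖p - (x, t)‖ := norm_fst_le (p - (x, t))
  have n2 : |p.2 - t| ≤ ‖p - (x, t)‖ := norm_snd_le (p - (x, t))
  have e3 := (abs_add_le (potential f u p.1 t - potential f u x t - u x t * (p.1 - x))
    (-(-(potential f u p.1 p.2 - potential f u p.1 t) - f (u x t) * (p.2 - t))))
  rw [abs_neg] at e3
  have e4 : potential f u p.1 p.2 - potential f u x t -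
      (u x t • ContinuousLinearMap.fst ℝ ℝ ℝ - f (u x t) • ContinuousLinearMap.snd ℝ ℝ ℝ)
        (p - (x, t)) =
      potential f u p.1 t - potential f u x t - u x t * (p.1 - x) +
      -(-(potential f u p.1 p.2 - potential f u p.1 t) - f (u x t) * (p.2 - t)) := by
    simp
    ring
  rw [Real.norm_eq_abs, e4]
  nlinarith

/-- Along a line, the potential grows at most at the rate given by the Legendre transform.  The line
may run in the set where `W` is not differentiable; almost all its translates at a given time do
not, so the inequality is integrated for the averages of `W` over intervals of `x`. -/
theorem potential_le_step (H : IsSolution f φ u) (x v : ℝ) {s t : ℝ} (hs : 0 < s) (hst : s ≤ t) :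
    potential f u x t ≤ potential f u (x - (t - s) * deriv f v) s + (t - s) * legendre f v := by
  obtain ⟨C, hC0, hu, hfu, -, hF⟩ := H.exists_bound
  set b := deriv f v with hb
  have ht : 0 < t := hs.trans_le hst
  have hderiv : ∀ h r, 0 < h → 0 < r → ∃ d ≤ h * legendre f v,
      HasDerivAt (fun r => ∫ y in x..(x + h), potential f u (y - (t - r) * b) r) d r := by
    intro h r hh hr
    have hcont : ∀ r, 0 < r → Continuous fun y => potential f u (y - (t - r) * b) r := fun r hr =>
      (H.continuous_potential hr).comp (by fun_prop)
    have hmeas : Measurable fun y => b * u (y - (t - r) * b) r - f (u (y - (t - r) * b) r) := by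
      have h1 : Measurable fun y => u (y - (t - r) * b) r :=
        (H.measurable hr).comp (by fun_prop)
      exact (h1.const_mul b).sub (H.flux.continuous.measurable.comp h1)
    have hd := intervalIntegral.hasDerivAt_integral_of_dominated_loc_of_lip (μ := volume)
      (F := fun r y => potential f u (y - (t - r) * b) r)
      (F' := fun y => b * u (y - (t - r) * b) r - f (u (y - (t - r) * b) r))
      (bound := fun _ => C * |b| + C) (a := x) (b := x + h) (Ioi_mem_nhds hr)
      (by
        filter_upwards [Ioi_mem_nhds hr] with r' hr'
        exact (hcont r' hr').aestronglyMeasurable)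
      ((hcont r hr).intervalIntegrable _ _) hmeas.aestronglyMeasurable
      (ae_of_all _ fun y _ => ?_) intervalIntegrable_const ?_
    · refine ⟨_, ?_, hd.2⟩
      have h2 : ∫ y in x..(x + h), (b * u (y - (t - r) * b) r - f (u (y - (t - r) * b) r)) ≤
          ∫ _ in x..(x + h), legendre f v := by
        refine intervalIntegral.integral_mono_on (by linarith) hd.1 intervalIntegrable_const
          fun y _ => ?_
        -- the derivative along the line is `f'(v) u - f(u)`, at most `ℓ(v)` by the tangent at `v`
        have := H.flux.tangent_le (u (y - (t - r) * b) r) v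
        unfold legendre
        rw [← hb] at this ⊢
        linarith
      simpa using h2
    · refine LipschitzOnWith.of_dist_le_mul fun r₁ h₁ r₂ h₂ => ?_
      have e1 := H.abs_potential_sub_space_le hu (y - (t - r₂) * b) (y - (t - r₁) * b) h₁
      have e2 := H.abs_potential_sub_time_le hF (y - (t - r₂) * b) h₂ h₁
      have e3 : y - (t - r₁) * b - (y - (t - r₂) * b) = (r₁ - r₂) * b := by ring
      rw [e3, abs_mul] at e1
      have e4 := abs_add_le
        (potential f u (y - (t - r₁) * b) r₁ - potential f u (y - (t - r₂) * b) r₁)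
        (potential f u (y - (t - r₂) * b) r₁ - potential f u (y - (t - r₂) * b) r₂)
      rw [sub_add_sub_cancel] at e4
      rw [Real.dist_eq, Real.dist_eq, Real.coe_nnabs,
        abs_of_nonneg (by positivity : 0 ≤ C * |b| + C)]
      linarith
    · have hae : ∀ᵐ y, ContinuousAt (fun z => u z r) (y - (t - r) * b) :=
        (measurePreserving_sub_right volume ((t - r) * b)).quasiMeasurePreserving.ae
          (H.ae_continuousAt hr)
      filter_upwards [hae] with y hy _
      have h1 := H.hasFDerivAt_potential hr hy
      have h2 : HasDerivAt (fun r => (y - (t - r) * b, r)) (b, (1 : ℝ)) r := by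
        refine HasDerivAt.prodMk ?_ (hasDerivAt_id r)
        have := (((hasDerivAt_id r).const_sub t).mul_const b).const_sub y
        simpa using this
      have h3 := h1.comp_hasDerivAt (f := fun r => (y - (t - r) * b, r)) r h2
      exact h3.congr_deriv (by simp [mul_comm])
  have hmean : ∀ h, 0 < h → (∫ y in x..(x + h), potential f u y t) -
      ∫ y in x..(x + h), potential f u (y - (t - s) * b) s ≤ (t - s) * (h * legendre f v) := by
    intro h hh
    set g := fun r => (∫ y in x..(x + h), potential f u (y - (t - r) * b) r) -
      r * (h * legendre f v) with hg
    have hanti : AntitoneOn g (Icc s t) := by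
      refine antitoneOn_of_deriv_nonpos (convex_Icc s t) ?_ ?_ ?_
      · intro r hr
        obtain ⟨d, -, hd⟩ := hderiv h r hh (hs.trans_le hr.1)
        exact (hd.sub ((hasDerivAt_id r).mul_const _)).continuousAt.continuousWithinAt
      · intro r hr
        rw [interior_Icc] at hr
        obtain ⟨d, -, hd⟩ := hderiv h r hh (hs.trans hr.1)
        exact (hd.sub ((hasDerivAt_id r).mul_const _)).differentiableAt.differentiableWithinAt
      · intro r hr
        rw [interior_Icc] at hr
        obtain ⟨d, hd1, hd⟩ := hderiv h r hh (hs.trans hr.1)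
        have h4 := (hd.sub ((hasDerivAt_id r).mul_const (h * legendre f v))).deriv
        change deriv g r = _ at h4
        rw [h4]
        simpa using hd1
    have := hanti (left_mem_Icc.2 hst) (right_mem_Icc.2 hst) hst
    simp only [hg, sub_self, zero_mul, sub_zero] at this
    linarith
  by_contra! hlt
  have hc1 := H.continuous_potential ht
  have hc2 : Continuous fun y => potential f u (y - (t - s) * b) s + (t - s) * legendre f v :=
    ((H.continuous_potential hs).comp (by fun_prop)).add continuous_const
  obtain ⟨δ, hδ, hball⟩ := Metric.eventually_nhds_iff.1
    (hc2.continuousAt.eventually_lt hc1.continuousAt hlt)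
  have h5 := intervalIntegral.intervalIntegral_pos_of_pos_on
    ((hc1.sub hc2).intervalIntegrable x (x + δ / 2)) (fun y hy => sub_pos.2 (hball (by
      rw [Real.dist_eq, abs_lt]; constructor <;> linarith [hy.1, hy.2]))) (by linarith)
  have h6 := hmean (δ / 2) (half_pos hδ)
  simp only [Pi.sub_apply] at h5
  have hi : IntervalIntegrable (fun y => potential f u (y - (t - s) * b) s) volume x (x + δ / 2) :=
    ((H.continuous_potential hs).comp
      (by fun_prop : Continuous fun y => y - (t - s) * b)).intervalIntegrable _ _
  rw [intervalIntegral.integral_sub (hc1.intervalIntegrable _ _) (hc2.intervalIntegrable _ _),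
    intervalIntegral.integral_add hi intervalIntegrable_const,
    intervalIntegral.integral_const] at h5
  simp only [add_sub_cancel_left, smul_eq_mul] at h5
  linarith

theorem potential_le_cost (H : IsSolution f φ u) (x v : ℝ) {t : ℝ} (ht : 0 < t) :
    potential f u x t ≤ cost f φ x t v := by
  obtain ⟨C, hC0, -, -, -, hF⟩ := H.exists_bound
  have hc : Continuous fun s => primitive φ (x - (t - s) * deriv f v) + C * s +
      (t - s) * legendre f v := by
    have := H.continuous_primitive
    fun_prop
  have hlim := (hc.tendsto 0).mono_left (nhdsWithin_le_nhds (s := Ioi 0))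
  simp only [sub_zero, mul_zero, add_zero] at hlim
  refine ge_of_tendsto hlim ?_
  filter_upwards [Ioo_mem_nhdsGT ht] with s hs
  have h1 := H.potential_le_step x v hs.1 hs.2.le
  have h2 := (abs_le.1 (H.abs_potential_sub_primitive_le hF (x - (t - s) * deriv f v) hs.1)).2
  linarith

end IsSolution

/-! ### The Lax–Oleinik formula -/

/-- The minimal cost `V(x, t)` of reaching `(x, t)`; velocities beyond the bound of the data play
no role. -/
def value (f φ : ℝ → ℝ) (x t : ℝ) : ℝ :=
  sInf (cost f φ x t '' Icc (-dataBound φ) (dataBound φ))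

theorem FluxData.continuous_value (S : FluxData f φ) :
    Continuous fun p : ℝ × ℝ => value f φ p.1 p.2 :=
  isCompact_Icc.continuous_sInf (f := fun (p : ℝ × ℝ) v => cost f φ p.1 p.2 v) S.continuous_cost

theorem FluxData.value_eq (S : FluxData f φ) {x t v : ℝ} (ht : 0 < t)
    (hv : v ∈ maximizers f φ x t) : value f φ x t = cost f φ x t v := by
  have hl : IsLeast (cost f φ x t '' Icc (-dataBound φ) (dataBound φ)) (cost f φ x t v) :=
    ⟨mem_image_of_mem _ (abs_le.1 (S.abs_le_dataBound ht hv)), by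
      rintro _ ⟨w, -, rfl⟩
      exact (S.mem_maximizers ht).1 hv w⟩
  exact hl.csInf_eq

theorem FluxData.value_le_cost (S : FluxData f φ) (x v : ℝ) {t : ℝ} (ht : 0 < t) :
    value f φ x t ≤ cost f φ x t v := by
  obtain ⟨w, hw⟩ := S.nonempty x ht
  rw [S.value_eq ht hw]
  exact (S.mem_maximizers ht).1 hw v

/-- Dynamic programming: a broken path costs at least as much as the straight one. -/
theorem FluxData.value_le_step (S : FluxData f φ) (x v : ℝ) {s t : ℝ} (hs : 0 < s) (ht : 0 < t) :
    value f φ x (t + s) ≤ value f φ (x - s * deriv f v) t + s * legendre f v := by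
  obtain ⟨w, hw⟩ := S.nonempty (x - s * deriv f v) ht
  obtain ⟨q, hq, hle, -⟩ := S.flux.exists_mean ht hs w v
  have := S.value_le_cost x q (add_pos ht hs)
  rw [S.value_eq ht hw]
  unfold cost at this ⊢
  have he : x - (t + s) * deriv f q = x - s * deriv f v - t * deriv f w := by rw [hq]; ring
  rw [he] at this
  linarith

/-- Along a characteristic segment the value is attained. -/
theorem FluxData.value_eq_linePos (S : FluxData f φ) {x t v r : ℝ} (hr : 0 < r) (hrt : r ≤ t)
    (hv : v ∈ maximizers f φ x t) :
    value f φ x t = value f φ (linePos f x t v r) r + (t - r) * legendre f v := by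
  rw [S.value_eq (hr.trans_le hrt) hv, S.value_eq hr (S.mem_linePos hv hr hrt)]
  have : linePos f x t v r - r * deriv f v = x - t * deriv f v := by unfold linePos; ring
  rw [cost, cost, this]
  ring

/-- A map which contracts no distance by more than the factor `k` increases no integral by more
than the factor `k⁻¹`. -/
theorem integral_comp_le {T g : ℝ → ℝ} {k : ℝ} (hk : 0 < k) (hT : Measurable T)
    (hexp : ∀ x y, x ≤ y → k * (y - x) ≤ T y - T x) (hg0 : ∀ x, 0 ≤ g x) (hg : Integrable g) :
    Integrable (fun x => g (T x)) ∧ ∫ x, g (T x) ≤ k⁻¹ * ∫ x, g x := by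
  have hanti : AntilipschitzWith (Real.toNNReal k⁻¹) T := by
    refine AntilipschitzWith.of_le_mul_dist fun x y => ?_
    rw [Real.coe_toNNReal _ (inv_pos.2 hk).le, Real.dist_eq, Real.dist_eq, inv_mul_eq_div,
      le_div_iff₀ hk]
    rcases le_total x y with h | h
    · have := hexp x y h
      rw [abs_sub_comm, abs_of_nonneg (sub_nonneg.2 h), abs_sub_comm (T x)]
      exact (by linarith : _ ≤ T y - T x).trans (le_abs_self _)
    · have := hexp y x h
      rw [abs_of_nonneg (sub_nonneg.2 h)]
      exact (by linarith : _ ≤ T x - T y).trans (le_abs_self _)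
  have hmap : (volume : Measure ℝ).map T ≤ ENNReal.ofReal k⁻¹ • volume := by
    refine Measure.le_iff.2 fun A hA => ?_
    rw [Measure.map_apply hT hA, Measure.smul_apply, smul_eq_mul, ← hausdorffMeasure_real]
    have := hanti.hausdorffMeasure_preimage_le zero_le_one A
    rwa [ENNReal.rpow_one] at this
  have hi : Integrable g (ENNReal.ofReal k⁻¹ • volume) := hg.smul_measure ENNReal.ofReal_ne_top
  have him : Integrable g ((volume : Measure ℝ).map T) := hi.mono_measure hmap
  refine ⟨him.comp_measurable hT, ?_⟩
  have h1 := integral_mono_measure hmap (ae_of_all _ hg0) hi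
  rwa [integral_map hT.aemeasurable him.aestronglyMeasurable, integral_smul_measure,
    ENNReal.toReal_ofReal (inv_pos.2 hk).le, smul_eq_mul] at h1

/-- A function with nonpositive upper right Dini derivative is nonincreasing. -/
theorem le_of_slope_bound {h : ℝ → ℝ} {a b : ℝ} (hab : a ≤ b) (hc : ContinuousOn h (Icc a b))
    (hs : ∀ t ∈ Ico a b, ∃ ρ : ℝ → ℝ, Tendsto ρ (𝓝[>] 0) (𝓝 0) ∧
      ∀ᶠ s in 𝓝[>] (0 : ℝ), h (t + s) ≤ h t + s * ρ s) : h b ≤ h a := by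
  refine image_le_of_liminf_slope_right_le_deriv_boundary (B := fun _ => h a) (B' := fun _ => 0)
    hc le_rfl continuousOn_const (fun x _ => hasDerivWithinAt_const _ _ _) ?_
    (right_mem_Icc.2 hab)
  intro t ht r hr
  obtain ⟨ρ, hρ, hev⟩ := hs t ht
  have h1 : ∀ᶠ s in 𝓝[>] (0 : ℝ), (h (t + s) - h t) / s < r := by
    filter_upwards [hev, hρ.eventually (gt_mem_nhds hr), self_mem_nhdsWithin] with s h1 h2 h3
    have h3 : 0 < s := h3
    rw [div_lt_iff₀ h3]
    nlinarith
  have h2 : Tendsto (fun z => z - t) (𝓝[>] t) (𝓝[>] 0) := by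
    refine tendsto_nhdsWithin_iff.2 ⟨?_, ?_⟩
    · have : Continuous fun z : ℝ => z - t := by fun_prop
      simpa using (this.tendsto t).mono_left (nhdsWithin_le_nhds (s := Ioi t))
    · filter_upwards [self_mem_nhdsWithin] with z hz using sub_pos.2 (mem_Ioi.1 hz)
  refine (h2.eventually h1).frequently.mono fun z hz => ?_
  rw [add_sub_cancel] at hz
  rwa [slope_def_field]

namespace IsSolution

/-- One step of the comparison of the value `V` with the potential `W`: the weighted `L²` norm of
`V - W` over one time step.  The characteristic speeds `f'(u)` satisfy a one-sided Lipschitz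
condition, so the map `x ↦ x - s f'(u(x, t))` contracts by at most the factor `1 - s / t`. -/
theorem integral_sq_step (H : IsSolution f φ u) {C : ℝ} (hC0 : 0 ≤ C)
    (hu : ∀ x t, 0 < t → |u x t| ≤ C) (hfu : ∀ x t, 0 < t → |f (u x t)| ≤ C)
    (hb : ∀ x t, 0 < t → |deriv f (u x t)| ≤ C)
    (hF : ∀ x t, 0 < t → |f (rightTrace u x t)| ≤ C) {D : ℝ → ℝ → ℝ} {C' : ℝ}
    (hD : ∀ x t, D x t = value f φ x t - potential f u x t)
    (hD0 : ∀ x t, 0 < t → 0 ≤ D x t) (hDC : ∀ x t, 0 < t → D x t ≤ C' * t) {t : ℝ} (ht : 0 < t) :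
    ∃ η : ℝ → ℝ, Tendsto η (𝓝[>] 0) (𝓝 0) ∧ ∀ᶠ s in 𝓝[>] (0 : ℝ),
      ∫ x, D x (t + s) ^ 2 * (1 + x ^ 2)⁻¹ ≤
        (1 + s * C) ^ 2 * (t / (t - s)) * (∫ x, D x t ^ 2 * (1 + x ^ 2)⁻¹) + s * η s := by
  have hw := integrable_inv_one_add_sq
  have hw0 : ∀ x : ℝ, 0 ≤ (1 + x ^ 2)⁻¹ := fun x => by positivity
  have hC'0 : 0 ≤ C' := by
    have := (hD0 0 1 one_pos).trans (hDC 0 1 one_pos)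
    linarith
  have hDc : ∀ t, 0 < t → Continuous fun x => D x t := fun t ht => by
    simp only [hD]
    exact (H.continuous_value.comp (Continuous.prodMk_left t)).sub (H.continuous_potential ht)
  have hsq : ∀ t, 0 < t → Integrable fun x => D x t ^ 2 * (1 + x ^ 2)⁻¹ := fun t ht => by
    refine hw.bdd_mul (c := (C' * t) ^ 2) ((hDc t ht).pow 2).aestronglyMeasurable
      (ae_of_all _ fun x => ?_)
    rw [Real.norm_eq_abs, abs_of_nonneg (sq_nonneg _)]
    exact pow_le_pow_left₀ (hD0 x t ht) (hDC x t ht) 2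
  set b : ℝ → ℝ := fun x => deriv f (u x t) with hbdef
  -- the error, per unit of time, of `W` following its own characteristic through one step; it is
  -- bounded, and it tends to `0` wherever `W` is differentiable
  set e : ℝ → ℝ → ℝ := fun s x => s⁻¹ * (potential f u (x - s * b x) t +
    s * legendre f (u x t) - potential f u x (t + s)) with he
  have hbm : Measurable b := H.flux.continuous_deriv.measurable.comp (H.measurable ht)
  have hem : ∀ s, 0 < s → Measurable (e s) := fun s hs => by
    refine Measurable.const_mul ?_ _
    refine Measurable.sub (Measurable.add ?_ ?_) (H.continuous_potential (by linarith)).measurable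
    · exact (H.continuous_potential ht).measurable.comp
        (measurable_id.sub (hbm.const_mul s))
    · exact (H.flux.continuous_legendre.measurable.comp (H.measurable ht)).const_mul s
  have heb : ∀ s, 0 < s → ∀ x, |e s x| ≤ 2 * C * C + 2 * C := by
    intro s hs x
    have h1 := abs_le.1 (H.abs_potential_sub_space_le hu x (x - s * b x) ht)
    have h2 := abs_le.1 (H.abs_potential_sub_time_le hF x ht (by linarith : 0 < t + s))
    have h3 := abs_le.1 (hfu x t ht)
    have h4 : |x - s * b x - x| ≤ s * C := by
      rw [sub_sub_cancel_left, abs_neg, abs_mul, abs_of_pos hs]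
      exact mul_le_mul_of_nonneg_left (hb x t ht) hs.le
    have h5 := abs_le.1 (show |u x t * b x| ≤ C * C by
      rw [abs_mul]; exact mul_le_mul (hu x t ht) (hb x t ht) (abs_nonneg _) hC0)
    rw [add_sub_cancel_left, abs_of_pos hs] at h2
    have h6 := mul_le_mul_of_nonneg_left h4 hC0
    have h7 : legendre f (u x t) = u x t * b x - f (u x t) := rfl
    rw [he]
    simp only
    rw [abs_mul, abs_of_pos (inv_pos.2 hs), inv_mul_le_iff₀ hs, abs_le, h7]
    constructor <;> nlinarith
  have hlim : ∀ᵐ x, Tendsto (fun s => e s x) (𝓝[>] 0) (𝓝 0) := by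
    filter_upwards [H.ae_continuousAt ht] with x hx
    have hp := H.hasFDerivAt_potential ht hx
    have d1 : HasDerivAt (fun s : ℝ => (x - s * b x, t)) (-b x, (0 : ℝ)) 0 := by
      refine HasDerivAt.prodMk ?_ (hasDerivAt_const _ _)
      simpa using ((hasDerivAt_id (0 : ℝ)).mul_const (b x)).const_sub x
    have d2 : HasDerivAt (fun s : ℝ => (x, t + s)) ((0 : ℝ), (1 : ℝ)) 0 := by
      refine HasDerivAt.prodMk (hasDerivAt_const _ _) ?_
      simpa using (hasDerivAt_id (0 : ℝ)).const_add t
    have hp1 : HasFDerivAt (fun p : ℝ × ℝ => potential f u p.1 p.2)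
      (u x t • ContinuousLinearMap.fst ℝ ℝ ℝ - f (u x t) • ContinuousLinearMap.snd ℝ ℝ ℝ)
      ((fun s : ℝ => (x - s * b x, t)) 0) := by simpa using hp
    have hp2 : HasFDerivAt (fun p : ℝ × ℝ => potential f u p.1 p.2)
      (u x t • ContinuousLinearMap.fst ℝ ℝ ℝ - f (u x t) • ContinuousLinearMap.snd ℝ ℝ ℝ)
      ((fun s : ℝ => (x, t + s)) 0) := by simpa using hp
    have h1 := ((hp1.comp_hasDerivAt 0 d1).add
      ((hasDerivAt_id (0 : ℝ)).mul_const (legendre f (u x t)))).sub (hp2.comp_hasDerivAt 0 d2)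
    have h2 := (hasDerivAt_iff_tendsto_slope_zero.1 h1).mono_left
      (nhdsGT_le_nhdsNE 0)
    have hz : (u x t • ContinuousLinearMap.fst ℝ ℝ ℝ -
        f (u x t) • ContinuousLinearMap.snd ℝ ℝ ℝ) (-b x, 0) + 1 * legendre f (u x t) -
        (u x t • ContinuousLinearMap.fst ℝ ℝ ℝ -
        f (u x t) • ContinuousLinearMap.snd ℝ ℝ ℝ) (0, 1) = 0 := by
      simp [legendre, hbdef]
      ring
    rw [hz] at h2
    refine h2.congr fun s => ?_
    simp [he]
  refine ⟨fun s => (2 * (C' * t) + 2 * C * C + 2 * C) * ∫ x, |e s x| * (1 + x ^ 2)⁻¹, ?_, ?_⟩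
  · have : Tendsto (fun s => ∫ x, |e s x| * (1 + x ^ 2)⁻¹) (𝓝[>] 0)
        (𝓝 (∫ _ : ℝ, (0 : ℝ))) := by
      refine tendsto_integral_filter_of_dominated_convergence
        (fun x => (2 * C * C + 2 * C) * (1 + x ^ 2)⁻¹) ?_ ?_ (hw.const_mul _) ?_
      · filter_upwards [self_mem_nhdsWithin] with s hs
        exact (((hem s hs).abs).mul (by fun_prop)).aestronglyMeasurable
      · filter_upwards [self_mem_nhdsWithin] with s hs
        refine ae_of_all _ fun x => ?_
        rw [Real.norm_eq_abs, abs_mul, abs_abs, abs_of_nonneg (hw0 x)]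
        exact mul_le_mul_of_nonneg_right (heb s hs x) (hw0 x)
      · filter_upwards [hlim] with x hx
        simpa using hx.abs.mul_const ((1 + x ^ 2)⁻¹)
    simpa using this.const_mul (2 * (C' * t) + 2 * C * C + 2 * C)
  · filter_upwards [Ioo_mem_nhdsGT (lt_min ht one_pos)] with s hs
    have hs0 : 0 < s := hs.1
    have hst : s < t := hs.2.trans_le (min_le_left _ _)
    have hs1 : s < 1 := hs.2.trans_le (min_le_right _ _)
    have hts : 0 < t - s := sub_pos.2 hst
    have hk : 0 < (t - s) / t := div_pos hts ht
    have hTm : Measurable fun x => x - s * b x := measurable_id.sub (hbm.const_mul s)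
    -- the one-sided inequality for `f'(u)` bounds the contraction
    have hexp : ∀ x y, x ≤ y → (t - s) / t * (y - x) ≤ (y - s * b y) - (x - s * b x) := by
      intro x y hxy
      have h1 := H.deriv_sub_le ht hxy
      have h2 : (t - s) / t * (y - x) = (y - x) - s * ((y - x) / t) := by field_simp
      have h3 := mul_le_mul_of_nonneg_left h1 hs0.le
      rw [h2]
      simp only [hbdef]
      linarith
    obtain ⟨i1, h1⟩ := integral_comp_le hk hTm hexp
      (fun x => mul_nonneg (sq_nonneg (D x t)) (hw0 x)) (hsq t ht)
    have i2 : Integrable fun x => |e s x| * (1 + x ^ 2)⁻¹ :=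
      hw.bdd_mul (c := 2 * C * C + 2 * C) ((hem s hs0).abs).aestronglyMeasurable
        (ae_of_all _ fun x => by rw [Real.norm_eq_abs, abs_abs]; exact heb s hs0 x)
    have hpt : ∀ x, D x (t + s) ^ 2 * (1 + x ^ 2)⁻¹ ≤
        (1 + s * C) ^ 2 * (D (x - s * b x) t ^ 2 * (1 + (x - s * b x) ^ 2)⁻¹) +
          s * (2 * (C' * t) + 2 * C * C + 2 * C) * (|e s x| * (1 + x ^ 2)⁻¹) := by
      intro x
      have a1 : D x (t + s) ≤ D (x - s * b x) t + s * |e s x| := by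
        have v1 := H.value_le_step x (u x t) hs0 ht
        have v2 : s * e s x = potential f u (x - s * b x) t +
            s * legendre f (u x t) - potential f u x (t + s) := by
          simp only [he]; field_simp
        have v3 := mul_le_mul_of_nonneg_left (le_abs_self (e s x)) hs0.le
        rw [hD, hD]
        change value f φ x (t + s) ≤ value f φ (x - s * b x) t + _ at v1
        linarith
      have a2 := hDC (x - s * b x) t ht
      have a3 := hD0 (x - s * b x) t ht
      have a4 := hD0 x (t + s) (by linarith)
      have a5 := heb s hs0 x
      have a6 := abs_nonneg (e s x)
      have a7 : D x (t + s) ^ 2 ≤ D (x - s * b x) t ^ 2 +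
          s * (2 * (C' * t) + 2 * C * C + 2 * C) * |e s x| := by
        have c1 : D x (t + s) ^ 2 ≤ (D (x - s * b x) t + s * |e s x|) ^ 2 :=
          pow_le_pow_left₀ a4 a1 2
        have c2 : s * |e s x| * (2 * D (x - s * b x) t + s * |e s x|) ≤
            s * |e s x| * (2 * (C' * t) + 2 * C * C + 2 * C) := by
          refine mul_le_mul_of_nonneg_left ?_ (mul_nonneg hs0.le a6)
          have : s * |e s x| ≤ 1 * |e s x| := mul_le_mul_of_nonneg_right hs1.le a6
          linarith
        nlinarith
      -- the weight changes at most by the factor `(1 + s C) ^ 2` under a shift by `s C`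
      have a8 : (1 + x ^ 2)⁻¹ ≤ (1 + s * C) ^ 2 * (1 + (x - s * b x) ^ 2)⁻¹ := by
        rw [← div_eq_mul_inv, le_div_iff₀ (by positivity), inv_mul_le_iff₀ (by positivity)]
        have c1 := abs_le.1 (show |s * b x| ≤ s * C by
          rw [abs_mul, abs_of_pos hs0]
          exact mul_le_mul_of_nonneg_left (hb x t ht) hs0.le)
        have c2 : 0 ≤ s * C := mul_nonneg hs0.le hC0
        have c3 : (s * b x) ^ 2 ≤ (s * C) ^ 2 := sq_le_sq' c1.1 c1.2
        have c4 : -2 * x * (s * b x) ≤ s * C * (1 + x ^ 2) := by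
          rcases le_total 0 x with hx | hx
          · nlinarith [mul_nonneg c2 (sq_nonneg (x - 1)), mul_nonneg hx (by linarith [c1.1] :
              0 ≤ s * b x + s * C)]
          · nlinarith [mul_nonneg c2 (sq_nonneg (x + 1)), mul_nonneg (neg_nonneg.2 hx)
              (by linarith [c1.2] : 0 ≤ s * C - s * b x)]
        nlinarith [mul_nonneg c2 (sq_nonneg x), mul_nonneg (sq_nonneg (s * C)) (sq_nonneg x)]
      have a9 := mul_le_mul_of_nonneg_right a7 (hw0 x)
      have a10 := mul_le_mul_of_nonneg_left a8 (sq_nonneg (D (x - s * b x) t))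
      nlinarith
    have h2 := integral_mono (hsq (t + s) (by linarith))
      ((i1.const_mul ((1 + s * C) ^ 2)).add
        (i2.const_mul (s * (2 * (C' * t) + 2 * C * C + 2 * C)))) hpt
    simp only [Pi.add_apply] at h2
    rw [integral_add (i1.const_mul _) (i2.const_mul _), integral_const_mul,
      integral_const_mul] at h2
    rw [inv_div] at h1
    have h3 := mul_le_mul_of_nonneg_left h1 (sq_nonneg (1 + s * C))
    nlinarith

/-- The potential of an entropy solution is the value function.  With `G(t)` the integral of
`(V - W) ^ 2 / (1 + x ^ 2)` at time `t`, the inequality of `integral_sq_step` shows that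
`exp (-2 C t) G(t) / t` is nonincreasing; since `G(t) = O(t ^ 2)`, it vanishes. -/
theorem potential_eq_value (H : IsSolution f φ u) (x : ℝ) {t : ℝ} (ht : 0 < t) :
    potential f u x t = value f φ x t := by
  obtain ⟨C, hC0, hu, hfu, hb, hF⟩ := H.exists_bound
  set D : ℝ → ℝ → ℝ := fun x t => value f φ x t - potential f u x t with hD
  set C' := C + dataBound φ * |deriv f 0| + |legendre f 0| with hC'
  have hD0 : ∀ x t, 0 < t → 0 ≤ D x t := fun x t ht => by
    obtain ⟨v, hv⟩ := H.nonempty x ht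
    have := H.potential_le_cost x v ht
    rw [← H.value_eq ht hv] at this
    exact sub_nonneg.2 this
  have hDC : ∀ x t, 0 < t → D x t ≤ C' * t := fun x t ht => by
    have h1 := H.value_le_cost x 0 ht
    have h2 := (abs_le.1 (H.abs_potential_sub_primitive_le hF x ht)).1
    have h3 := (abs_le.1 (H.abs_primitive_sub_le x (x - t * deriv f 0))).2
    rw [sub_sub_cancel_left, abs_neg, abs_mul, abs_of_pos ht] at h3
    have h4 := mul_le_mul_of_nonneg_left (le_abs_self (legendre f 0)) ht.le
    unfold cost at h1
    simp only [hD, hC']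
    nlinarith
  have hC'0 : 0 ≤ C' := by
    have := (hD0 0 1 one_pos).trans (hDC 0 1 one_pos)
    linarith
  have hw := integrable_inv_one_add_sq
  have hw0 : ∀ x : ℝ, 0 ≤ (1 + x ^ 2)⁻¹ := fun x => by positivity
  have hDc : ∀ t, 0 < t → Continuous fun x => D x t := fun t ht =>
    (H.continuous_value.comp (Continuous.prodMk_left t)).sub (H.continuous_potential ht)
  set G : ℝ → ℝ := fun t => ∫ x, D x t ^ 2 * (1 + x ^ 2)⁻¹ with hG
  have hG0 : ∀ t, 0 ≤ G t := fun t => integral_nonneg fun x => mul_nonneg (sq_nonneg _) (hw0 x)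
  have hpt : ∀ t, 0 < t → ∀ x, D x t ^ 2 ≤ (C' * t) ^ 2 := fun t ht x =>
    pow_le_pow_left₀ (hD0 x t ht) (hDC x t ht) 2
  have hsq : ∀ t, 0 < t → Integrable fun x => D x t ^ 2 * (1 + x ^ 2)⁻¹ := fun t ht => by
    refine hw.bdd_mul (c := (C' * t) ^ 2) ((hDc t ht).pow 2).aestronglyMeasurable
      (ae_of_all _ fun x => ?_)
    rw [Real.norm_eq_abs, abs_of_nonneg (sq_nonneg _)]
    exact hpt t ht x
  have hGle : ∀ t, 0 < t → G t ≤ (C' * t) ^ 2 * ∫ x : ℝ, (1 + x ^ 2)⁻¹ := fun t ht => by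
    rw [← integral_const_mul]
    exact integral_mono (hsq t ht) (hw.const_mul _) fun x =>
      mul_le_mul_of_nonneg_right (hpt t ht x) (hw0 x)
  have hGc : ContinuousOn G (Ioi 0) := by
    intro t ht
    have ht : 0 < t := ht
    have hev : ∀ᶠ s in 𝓝[Ioi 0] t, 0 < s ∧ s < 2 * t := by
      filter_upwards [self_mem_nhdsWithin,
        mem_nhdsWithin_of_mem_nhds (Iio_mem_nhds (by linarith : t < 2 * t))] with s h1 h2
      exact ⟨h1, h2⟩
    refine tendsto_integral_filter_of_dominated_convergence
      (fun x => (C' * (2 * t)) ^ 2 * (1 + x ^ 2)⁻¹) ?_ ?_ (hw.const_mul _) ?_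
    · filter_upwards [hev] with s hs
      exact (hsq s hs.1).aestronglyMeasurable
    · filter_upwards [hev] with s hs
      refine ae_of_all _ fun x => ?_
      rw [Real.norm_eq_abs, abs_of_nonneg (mul_nonneg (sq_nonneg _) (hw0 x))]
      refine mul_le_mul_of_nonneg_right ((hpt s hs.1 x).trans ?_) (hw0 x)
      exact pow_le_pow_left₀ (mul_nonneg hC'0 hs.1.le)
        (mul_le_mul_of_nonneg_left hs.2.le hC'0) 2
    · refine ae_of_all _ fun x => ?_
      have h1 : Tendsto (fun s => value f φ x s) (𝓝[Ioi 0] t) (𝓝 (value f φ x t)) :=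
        ((H.continuous_value.comp (Continuous.prodMk_right x)).tendsto t).mono_left
          nhdsWithin_le_nhds
      have h2 : Tendsto (fun s => potential f u x s) (𝓝[Ioi 0] t) (𝓝 (potential f u x t)) := by
        refine tendsto_iff_norm_sub_tendsto_zero.2 (squeeze_zero' (g := fun s => C * |s - t|)
          (Eventually.of_forall fun _ => norm_nonneg _) ?_ ?_)
        · filter_upwards [self_mem_nhdsWithin] with s hs
          exact H.abs_potential_sub_time_le hF x ht hs
        · have : Continuous fun s : ℝ => C * |s - t| := by fun_prop
          simpa using (this.tendsto t).mono_left (nhdsWithin_le_nhds (s := Ioi 0))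
      exact ((h1.sub h2).pow 2).mul_const _
  -- dividing by `t` absorbs the contraction factor `t / (t - s)` of one step, up to terms of
  -- second order in `s`, and the exponential absorbs the factor `(1 + s C) ^ 2` of the weight
  set h : ℝ → ℝ := fun t => Real.exp (-(2 * C * t)) * (G t / t) with hh
  have hmono : ∀ a, 0 < a → a ≤ t → h t ≤ h a := by
    intro a ha hat
    refine le_of_slope_bound hat ?_ ?_
    · refine ContinuousOn.mul (by fun_prop) (ContinuousOn.div
        (hGc.mono fun s hs => ha.trans_le hs.1) continuousOn_id fun s hs => ?_)
      exact (ha.trans_le hs.1).ne'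
    · intro τ hτ
      have hτ0 : 0 < τ := ha.trans_le hτ.1
      obtain ⟨η, hη, hev⟩ := H.integral_sq_step hC0 hu hfu hb hF (fun _ _ => rfl) hD0 hDC hτ0
      refine ⟨fun s => h τ * (s / (τ ^ 2 - s ^ 2)) + |η s| / τ, ?_, ?_⟩
      · have h1 : ContinuousAt (fun s : ℝ => h τ * (s / (τ ^ 2 - s ^ 2))) 0 := by
          refine continuousAt_const.mul (ContinuousAt.div (by fun_prop) (by fun_prop) ?_)
          simp [hτ0.ne']
        have h2 := h1.tendsto.mono_left (nhdsWithin_le_nhds (s := Ioi 0))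
        simpa using h2.add (hη.abs.div_const τ)
      · filter_upwards [hev, Ioo_mem_nhdsGT hτ0] with s hs hsτ
        have hs0 : 0 < s := hsτ.1
        have hd : 0 < τ - s := sub_pos.2 hsτ.2
        have hds : 0 < τ + s := by linarith
        have k1 : Real.exp (-(2 * C * (τ + s))) * (1 + s * C) ^ 2 ≤
            Real.exp (-(2 * C * τ)) := by
          have k2 : (1 + s * C) ^ 2 ≤ Real.exp (2 * C * s) := by
            have : (1 + s * C) ≤ Real.exp (s * C) := by
              have := Real.add_one_le_exp (s * C)
              linarith
            calc (1 + s * C) ^ 2 ≤ Real.exp (s * C) ^ 2 :=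
                  pow_le_pow_left₀ (by positivity) this 2
              _ = Real.exp (2 * C * s) := by
                  rw [← Real.exp_nat_mul]; congr 1; push_cast; ring
          calc _ ≤ Real.exp (-(2 * C * (τ + s))) * Real.exp (2 * C * s) :=
                mul_le_mul_of_nonneg_left k2 (Real.exp_pos _).le
            _ = _ := by rw [← Real.exp_add]; congr 1; ring
        have k3 : Real.exp (-(2 * C * (τ + s))) ≤ 1 := by
          rw [Real.exp_le_one_iff]
          have : 0 ≤ 2 * C * (τ + s) := by positivity
          linarith
        have k4 : h (τ + s) ≤ Real.exp (-(2 * C * τ)) * (τ / (τ - s)) * G τ / (τ + s) +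
            s * |η s| / (τ + s) := by
          have k5 : Real.exp (-(2 * C * (τ + s))) * G (τ + s) ≤
              Real.exp (-(2 * C * τ)) * (τ / (τ - s)) * G τ + s * |η s| := by
            have p1 := mul_le_mul_of_nonneg_left hs (Real.exp_pos (-(2 * C * (τ + s)))).le
            have p2 := mul_le_mul_of_nonneg_right k1
              (mul_nonneg (div_pos hτ0 hd).le (hG0 τ))
            have p3 : Real.exp (-(2 * C * (τ + s))) * (s * η s) ≤ 1 * (s * |η s|) :=
              (mul_le_mul_of_nonneg_left (mul_le_mul_of_nonneg_left (le_abs_self _) hs0.le)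
                (Real.exp_pos _).le).trans
                (mul_le_mul_of_nonneg_right k3 (mul_nonneg hs0.le (abs_nonneg _)))
            calc _ ≤ _ := p1
              _ = Real.exp (-(2 * C * (τ + s))) * (1 + s * C) ^ 2 * (τ / (τ - s) * G τ) +
                  Real.exp (-(2 * C * (τ + s))) * (s * η s) := by ring
              _ ≤ _ := by linarith
          have := div_le_div_of_nonneg_right k5 hds.le
          rw [add_div] at this
          simp only [hh]
          rw [← mul_div_assoc]
          exact this
        have k6 : Real.exp (-(2 * C * τ)) * (τ / (τ - s)) * G τ / (τ + s) =
            h τ + s * (h τ * (s / (τ ^ 2 - s ^ 2))) := by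
          have : τ ^ 2 - s ^ 2 = (τ - s) * (τ + s) := by ring
          simp only [hh]
          rw [this]
          field_simp
          ring
        have k7 : s * |η s| / (τ + s) ≤ s * (|η s| / τ) := by
          rw [← mul_div_assoc]
          exact div_le_div_of_nonneg_left (by positivity) hτ0 (by linarith)
        rw [k6] at k4
        linarith
  have hzero : G t = 0 := by
    have h1 : h t ≤ 0 := by
      have hlim : Tendsto (fun a : ℝ => C' ^ 2 * a * ∫ x : ℝ, (1 + x ^ 2)⁻¹) (𝓝[>] 0) (𝓝 0) := by
        have : Continuous fun a : ℝ => C' ^ 2 * a * ∫ x : ℝ, (1 + x ^ 2)⁻¹ := by fun_prop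
        simpa using (this.tendsto 0).mono_left (nhdsWithin_le_nhds (s := Ioi 0))
      refine ge_of_tendsto hlim ?_
      filter_upwards [Ioo_mem_nhdsGT ht] with a ha
      have ha0 : 0 < a := ha.1
      refine (hmono a ha0 ha.2.le).trans ?_
      have k1 : Real.exp (-(2 * C * a)) ≤ 1 := by
        rw [Real.exp_le_one_iff]
        have : 0 ≤ 2 * C * a := by positivity
        linarith
      have k2 : G a / a ≤ C' ^ 2 * a * ∫ x : ℝ, (1 + x ^ 2)⁻¹ := by
        rw [div_le_iff₀ ha0]
        have := hGle a ha0
        nlinarith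
      exact (mul_le_of_le_one_left (div_nonneg (hG0 a) ha0.le) k1).trans k2
    have h2 : 0 < Real.exp (-(2 * C * t)) := Real.exp_pos _
    have h3 : G t / t ≤ 0 := by
      by_contra! hpos
      have := mul_pos h2 hpos
      simp only [hh] at h1
      linarith
    rw [div_le_iff₀ ht, zero_mul] at h3
    exact le_antisymm h3 (hG0 t)
  have hae := (integral_eq_zero_iff_of_nonneg
    (fun x => mul_nonneg (sq_nonneg (D x t)) (hw0 x)) (hsq t ht)).1 hzero
  have hcont : Continuous fun x => D x t ^ 2 * (1 + x ^ 2)⁻¹ :=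
    ((hDc t ht).pow 2).mul (Continuous.inv₀ (by fun_prop) fun x => by positivity)
  have h5 := congr_fun (hcont.ae_eq_iff_eq volume continuous_const |>.1 hae) x
  have h6 : D x t = 0 := by
    have h7 : (1 + x ^ 2)⁻¹ ≠ 0 := by positivity
    have h8 : D x t ^ 2 * (1 + x ^ 2)⁻¹ = 0 := h5
    simpa [h7] using h8
  simp only [hD] at h6
  linarith

end IsSolution

/-! ### Limits of maximizers and traces of the solution -/

/-- All the elements of `𝒰(p)` tend to `w` along the filter `l` of points `p`. -/
def MaximizersTendsto (f φ : ℝ → ℝ) (l : Filter (ℝ × ℝ)) (w : ℝ) : Prop :=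
  ∀ ε, 0 < ε → ∀ᶠ p in l, ∀ v ∈ maximizers f φ p.1 p.2, |v - w| < ε

/-- Upper semicontinuity of `𝒰` in terms of closed conditions: every limit of maximizers is a
maximizer. -/
theorem FluxData.eventually_notMem (S : FluxData f φ) {x t : ℝ} (ht : 0 < t)
    {C : Set ((ℝ × ℝ) × ℝ)} (hC : IsClosed C) (h : ∀ v ∈ maximizers f φ x t, ((x, t), v) ∉ C) :
    ∀ᶠ p : ℝ × ℝ in 𝓝 (x, t), ∀ v ∈ maximizers f φ p.1 p.2, (p, v) ∉ C := by
  by_contra hcon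
  have hpos : ∀ᶠ p in 𝓝 (x, t), 0 < p.2 :=
    (continuous_snd.continuousAt (x := (x, t))).eventually (lt_mem_nhds ht)
  set B := {p : ℝ × ℝ | ∃ v, v ∈ maximizers f φ p.1 p.2 ∧ (p, v) ∈ C} with hB
  have hfr : ∃ᶠ p in 𝓝 (x, t), p ∈ B := by
    refine (not_eventually.1 hcon).mono fun p hp => ?_
    push Not at hp
    exact hp
  have : (𝓝 (x, t) ⊓ 𝓟 B).NeBot := frequently_mem_iff_neBot.1 hfr
  let U : Ultrafilter (ℝ × ℝ) := Ultrafilter.of (𝓝 (x, t) ⊓ 𝓟 B)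
  have hU : (U : Filter (ℝ × ℝ)) ≤ 𝓝 (x, t) ⊓ 𝓟 B := Ultrafilter.of_le _
  have hUl : (U : Filter (ℝ × ℝ)) ≤ 𝓝 (x, t) := hU.trans inf_le_left
  let v : ℝ × ℝ → ℝ := fun p => Classical.epsilon fun v =>
    v ∈ maximizers f φ p.1 p.2 ∧ (p, v) ∈ C
  have hv : ∀ᶠ p in (U : Filter (ℝ × ℝ)), v p ∈ maximizers f φ p.1 p.2 ∧ (p, v p) ∈ C := by
    have hUB : (U : Filter (ℝ × ℝ)) ≤ 𝓟 B := hU.trans inf_le_right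
    filter_upwards [hUB (mem_principal_self B)] with p hp
    exact Classical.epsilon_spec (p := fun v => v ∈ maximizers f φ p.1 p.2 ∧ (p, v) ∈ C) hp
  have hcpt : ∀ᶠ p in (U : Filter (ℝ × ℝ)), v p ∈ Icc (-dataBound φ) (dataBound φ) := by
    filter_upwards [hv, hUl hpos] with p hp hp2
    exact abs_le.1 (S.abs_le_dataBound hp2 hp.1)
  obtain ⟨c, -, hc⟩ := isCompact_Icc.ultrafilter_le_nhds (U.map v) (le_principal_iff.2 hcpt)
  have hc : Tendsto v U (𝓝 c) := hc
  have hp : Tendsto (fun p : ℝ × ℝ => p) U (𝓝 (x, t)) := hUl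
  exact h c (S.mem_of_tendsto ht hp hc (hv.mono fun p hp => hp.1))
    (hC.mem_of_tendsto (hp.prodMk_nhds hc) (hv.mono fun p hp => hp.2))

theorem FluxData.eventually_dist_lt (S : FluxData f φ) {x t w : ℝ} (ht : 0 < t)
    {C : Set ((ℝ × ℝ) × ℝ)} (hC : IsClosed C)
    (huniq : ∀ v ∈ maximizers f φ x t, ((x, t), v) ∈ C → v = w) {ε : ℝ} (hε : 0 < ε) :
    ∀ᶠ p : ℝ × ℝ in 𝓝 (x, t), ∀ v ∈ maximizers f φ p.1 p.2, (p, v) ∈ C → |v - w| < ε := by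
  have hC' : IsClosed (C ∩ {q : (ℝ × ℝ) × ℝ | ε ≤ |q.2 - w|}) :=
    hC.inter (isClosed_le continuous_const (by fun_prop))
  filter_upwards [S.eventually_notMem ht hC' (fun v hv hvC => by
    have h1 := hvC.2
    simp only [mem_ofPred_eq, huniq v hv hvC.1, sub_self, abs_zero] at h1
    exact absurd hε h1.not_gt)] with p hp v hv hvC
  by_contra! hcon
  exact hp v hv ⟨hvC, hcon⟩

/-- If the maximizers near `(x, t)` satisfy a closed condition which singles out the element `w` of
`𝒰(x, t)`, then they converge to `w`. -/
theorem FluxData.maximizersTendsto (S : FluxData f φ) {x t w : ℝ} (ht : 0 < t)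
    {l : Filter (ℝ × ℝ)} (hl : l ≤ 𝓝 (x, t)) {C : Set ((ℝ × ℝ) × ℝ)} (hC : IsClosed C)
    (hmem : ∀ᶠ p in l, ∀ v ∈ maximizers f φ p.1 p.2, (p, v) ∈ C)
    (huniq : ∀ v ∈ maximizers f φ x t, ((x, t), v) ∈ C → v = w) :
    MaximizersTendsto f φ l w := by
  intro ε hε
  filter_upwards [hmem, hl (S.eventually_dist_lt ht hC huniq hε)] with p h1 h2 v hv
  exact h2 v hv (h1 v hv)

/-- Convergence of selected maximizers. -/
theorem FluxData.tendsto_selection (S : FluxData f φ) {ι : Type*} {l : Filter ι} {p : ι → ℝ × ℝ}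
    {v : ι → ℝ} {x t w : ℝ} (ht : 0 < t) (hp : Tendsto p l (𝓝 (x, t)))
    {C : Set ((ℝ × ℝ) × ℝ)} (hC : IsClosed C)
    (hv : ∀ᶠ i in l, v i ∈ maximizers f φ (p i).1 (p i).2 ∧ (p i, v i) ∈ C)
    (huniq : ∀ v ∈ maximizers f φ x t, ((x, t), v) ∈ C → v = w) : Tendsto v l (𝓝 w) := by
  refine Metric.tendsto_nhds.2 fun ε hε => ?_
  filter_upwards [hv, hp.eventually (S.eventually_dist_lt ht hC huniq hε)] with i h1 h2
  exact h2 _ h1.1 h1.2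

theorem isClosed_linePos_le (hf : IsFlux f) (r K : ℝ) :
    IsClosed {q : (ℝ × ℝ) × ℝ | linePos f q.1.1 q.1.2 q.2 r ≤ K} := by
  have := hf.continuous_deriv
  unfold linePos
  exact isClosed_le (by fun_prop) continuous_const

theorem isClosed_le_linePos (hf : IsFlux f) (r K : ℝ) :
    IsClosed {q : (ℝ × ℝ) × ℝ | K ≤ linePos f q.1.1 q.1.2 q.2 r} := by
  have := hf.continuous_deriv
  unfold linePos
  exact isClosed_le continuous_const (by fun_prop)

/-- Points from which all the backward characteristics stay on the left of the backward triangle of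
`(x, t)`. -/
theorem FluxData.maximizersTendsto_vmax (S : FluxData f φ) {x t : ℝ} (ht : 0 < t)
    {l : Filter (ℝ × ℝ)} (hl : l ≤ 𝓝 (x, t))
    (h : ∀ᶠ p in l, ∀ v ∈ maximizers f φ p.1 p.2,
      linePos f p.1 p.2 v 0 ≤ leftEdge f φ x t 0) :
    MaximizersTendsto f φ l (vmax f φ x t) := by
  refine S.maximizersTendsto ht hl (isClosed_linePos_le S.flux 0 _) h fun v hv hle => ?_
  by_contra hne
  have hlt := lt_of_le_of_ne ((S.isGreatest_vmax x ht).2 hv) hne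
  exact absurd ((linePos_lt_linePos_iff S.flux ht).2 hlt) (not_lt.2 hle)

/-- Points from which all the backward characteristics stay on the right of the backward triangle
of `(x, t)`. -/
theorem FluxData.maximizersTendsto_vmin (S : FluxData f φ) {x t : ℝ} (ht : 0 < t)
    {l : Filter (ℝ × ℝ)} (hl : l ≤ 𝓝 (x, t))
    (h : ∀ᶠ p in l, ∀ v ∈ maximizers f φ p.1 p.2,
      rightEdge f φ x t 0 ≤ linePos f p.1 p.2 v 0) :
    MaximizersTendsto f φ l (vmin f φ x t) := by
  refine S.maximizersTendsto ht hl (isClosed_le_linePos S.flux 0 _) h fun v hv hle => ?_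
  by_contra hne
  have hlt := lt_of_le_of_ne ((S.isLeast_vmin x ht).2 hv) (Ne.symm hne)
  exact absurd ((linePos_lt_linePos_iff S.flux ht).2 hlt) (not_lt.2 hle)

/-- On the left of `(x, t)`, at the same time, the maximizers tend to the greatest one. -/
theorem FluxData.maximizersTendsto_left (S : FluxData f φ) (x : ℝ) {t : ℝ} (ht : 0 < t) :
    MaximizersTendsto f φ (map (fun y => (y, t)) (𝓝[<] x)) (vmax f φ x t) := by
  refine S.maximizersTendsto_vmax ht
    (((Continuous.prodMk_left t).tendsto x).mono_left nhdsWithin_le_nhds) ?_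
  rw [eventually_map]
  filter_upwards [self_mem_nhdsWithin] with y hy v hv
  exact S.linePos_le hv (S.isGreatest_vmax x ht).1 le_rfl ht ht.le le_rfl le_rfl
    (by rw [linePos_self, linePos_self]; exact hy)

/-- On the right of `(x, t)`, at the same time, the maximizers tend to the least one. -/
theorem FluxData.maximizersTendsto_right (S : FluxData f φ) (x : ℝ) {t : ℝ} (ht : 0 < t) :
    MaximizersTendsto f φ (map (fun y => (y, t)) (𝓝[>] x)) (vmin f φ x t) := by
  refine S.maximizersTendsto_vmin ht
    (((Continuous.prodMk_left t).tendsto x).mono_left nhdsWithin_le_nhds) ?_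
  rw [eventually_map]
  filter_upwards [self_mem_nhdsWithin] with y hy v hv
  exact S.linePos_le (S.isLeast_vmin x ht).1 hv le_rfl ht ht.le le_rfl le_rfl
    (by rw [linePos_self, linePos_self]; exact hy)

/-- The properties of an entropy solution given by the Lax–Oleinik formula: `u` is the derivative of
the value function, and its values lie between the extreme maximizers. -/
structure IsLaxSolution (f φ : ℝ → ℝ) (u : ℝ → ℝ → ℝ) : Prop extends FluxData f φ where
  intervalIntegrable : ∀ ⦃t : ℝ⦄, 0 < t → ∀ a b, IntervalIntegrable (fun x => u x t) volume a b
  integral_eq : ∀ ⦃t : ℝ⦄, 0 < t → ∀ a b, ∫ x in a..b, u x t = value f φ b t - value f φ a t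
  between : ∀ x ⦃t : ℝ⦄, 0 < t → u x t ∈ Icc (vmin f φ x t) (vmax f φ x t)

namespace IsSolution

theorem value_sub (H : IsSolution f φ u) {t : ℝ} (ht : 0 < t) (a b : ℝ) :
    ∫ x in a..b, u x t = value f φ b t - value f φ a t := by
  rw [← H.potential_eq_value b ht, ← H.potential_eq_value a ht, H.potential_sub_space a b ht]

/-- At a point of continuity, `u` is the only maximizer. -/
theorem eq_of_mem_of_continuousAt (H : IsSolution f φ u) {x t v : ℝ} (ht : 0 < t)
    (hx : ContinuousAt (fun y => u y t) x) (hv : v ∈ maximizers f φ x t) : v = u x t := by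
  have hd : HasDerivAt (fun y => value f φ y t) (u x t) x := by
    have h1 := H.hasFDerivAt_potential ht hx
    have h2 : HasDerivAt (fun y : ℝ => (y, t)) ((1 : ℝ), (0 : ℝ)) x :=
      (hasDerivAt_id x).prodMk (hasDerivAt_const x t)
    have h3 := h1.comp_hasDerivAt (f := fun y : ℝ => (y, t)) x h2
    refine (h3.congr_deriv (by simp)).congr_of_eventuallyEq (Eventually.of_forall fun y => ?_)
    exact (H.potential_eq_value y ht).symm
  have hs := hasDerivAt_iff_tendsto_slope.1 hd
  -- competitors starting at the same foot point
  set g : ℝ → ℝ := fun m => x + t * (deriv f m - deriv f v) with hg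
  have hgc : Continuous g := by
    have := H.flux.continuous_deriv
    fun_prop
  have hgv : g v = x := by simp [hg]
  have hcomp : ∀ m, value f φ (g m) t - value f φ x t ≤ m * (g m - x) := by
    intro m
    have h1 := H.value_le_cost (g m) m ht
    have h2 := H.flux.legendre_le m v
    have h3 : g m - t * deriv f m = x - t * deriv f v := by simp only [hg]; ring
    rw [H.value_eq ht hv]
    unfold cost at h1 ⊢
    rw [h3] at h1
    have h4 := mul_le_mul_of_nonneg_left h2 ht.le
    have h5 : m * (g m - x) = t * (m * (deriv f m - deriv f v)) := by simp only [hg]; ring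
    rw [h5]
    nlinarith
  refine le_antisymm ?_ ?_
  · have h1 : Tendsto g (𝓝[<] v) (𝓝[≠] x) := by
      refine tendsto_nhdsWithin_iff.2 ⟨?_, ?_⟩
      · rw [← hgv]; exact (hgc.tendsto v).mono_left nhdsWithin_le_nhds
      · filter_upwards [self_mem_nhdsWithin] with m hm
        have := mul_pos ht (sub_pos.2 (H.flux.strictMono (mem_Iio.1 hm)))
        simp only [mem_compl_iff, mem_singleton_iff, hg]
        nlinarith
    have h2 : Tendsto (fun m : ℝ => m) (𝓝[<] v) (𝓝 v) := nhdsWithin_le_nhds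
    refine le_of_tendsto_of_tendsto h2 (hs.comp h1) ?_
    filter_upwards [self_mem_nhdsWithin] with m hm
    have := mul_pos ht (sub_pos.2 (H.flux.strictMono (mem_Iio.1 hm)))
    simp only [Function.comp_apply, slope_def_field]
    rw [le_div_iff_of_neg (by simp only [hg]; nlinarith)]
    exact hcomp m
  · have h1 : Tendsto g (𝓝[>] v) (𝓝[≠] x) := by
      refine tendsto_nhdsWithin_iff.2 ⟨?_, ?_⟩
      · rw [← hgv]; exact (hgc.tendsto v).mono_left nhdsWithin_le_nhds
      · filter_upwards [self_mem_nhdsWithin] with m hm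
        have := mul_pos ht (sub_pos.2 (H.flux.strictMono (mem_Ioi.1 hm)))
        simp only [mem_compl_iff, mem_singleton_iff, hg]
        nlinarith
    have h2 : Tendsto (fun m : ℝ => m) (𝓝[>] v) (𝓝 v) := nhdsWithin_le_nhds
    refine le_of_tendsto_of_tendsto (hs.comp h1) h2 ?_
    filter_upwards [self_mem_nhdsWithin] with m hm
    have := mul_pos ht (sub_pos.2 (H.flux.strictMono (mem_Ioi.1 hm)))
    simp only [Function.comp_apply, slope_def_field]
    rw [div_le_iff₀ (by simp only [hg]; nlinarith)]
    exact hcomp m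

/-- Points of continuity close to `x` on the left have values close to `vmax`, and the one-sided
inequality does not let `u` jump upwards. -/
theorem le_vmax (H : IsSolution f φ u) (x : ℝ) {t : ℝ} (ht : 0 < t) : u x t ≤ vmax f φ x t := by
  refine le_of_forall_pos_lt_add fun ε hε => ?_
  have h1 := H.maximizersTendsto_left x ht (ε / 2) (half_pos hε)
  rw [eventually_map] at h1
  have hlt : deriv f (vmax f φ x t + ε / 2) < deriv f (vmax f φ x t + ε) :=
    H.flux.strictMono (by linarith)
  have h2 : ∀ᶠ y in 𝓝[<] x, (x - y) / t <
      deriv f (vmax f φ x t + ε) - deriv f (vmax f φ x t + ε / 2) := by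
    have : Continuous fun y => (x - y) / t := by fun_prop
    refine (this.tendsto x).mono_left nhdsWithin_le_nhds |>.eventually (gt_mem_nhds ?_)
    simpa using hlt
  obtain ⟨l, hl, hsub⟩ := (mem_nhdsLT_iff_exists_Ioo_subset).1 (h1.and h2)
  obtain ⟨y, hy, hyl⟩ := ((H.countable_not_continuousAt ht).dense_compl ℝ).exists_between hl
  have hy : ContinuousAt (fun z => u z t) y := not_not.1 hy
  obtain ⟨h3, h4⟩ := hsub hyl
  obtain ⟨v, hv⟩ := H.nonempty y ht
  have h5 := h3 v hv
  rw [H.eq_of_mem_of_continuousAt ht hy hv] at h5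
  have h6 := H.deriv_sub_le ht hyl.2.le
  have h7 := H.flux.monotone_deriv (by linarith [(abs_lt.1 h5).2] :
    u y t ≤ vmax f φ x t + ε / 2)
  exact H.flux.strictMono.lt_iff_lt.1 (by linarith)

/-- Points of continuity close to `x` on the right have values close to `vmin`, and the one-sided
inequality does not let `u` jump upwards. -/
theorem vmin_le (H : IsSolution f φ u) (x : ℝ) {t : ℝ} (ht : 0 < t) : vmin f φ x t ≤ u x t := by
  refine le_of_forall_sub_le fun ε hε => ?_
  have h1 := H.maximizersTendsto_right x ht (ε / 2) (half_pos hε)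
  rw [eventually_map] at h1
  have hlt : deriv f (vmin f φ x t - ε) < deriv f (vmin f φ x t - ε / 2) :=
    H.flux.strictMono (by linarith)
  have h2 : ∀ᶠ y in 𝓝[>] x, (y - x) / t <
      deriv f (vmin f φ x t - ε / 2) - deriv f (vmin f φ x t - ε) := by
    have : Continuous fun y => (y - x) / t := by fun_prop
    refine (this.tendsto x).mono_left nhdsWithin_le_nhds |>.eventually (gt_mem_nhds ?_)
    simpa using hlt
  obtain ⟨l, hl, hsub⟩ := (mem_nhdsGT_iff_exists_Ioo_subset).1 (h1.and h2)
  obtain ⟨y, hy, hyl⟩ := ((H.countable_not_continuousAt ht).dense_compl ℝ).exists_between hl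
  have hy : ContinuousAt (fun z => u z t) y := not_not.1 hy
  obtain ⟨h3, h4⟩ := hsub hyl
  obtain ⟨v, hv⟩ := H.nonempty y ht
  have h5 := h3 v hv
  rw [H.eq_of_mem_of_continuousAt ht hy hv] at h5
  have h6 := H.deriv_sub_le ht hyl.1.le
  have h7 := H.flux.monotone_deriv (by linarith [(abs_lt.1 h5).1] :
    vmin f φ x t - ε / 2 ≤ u y t)
  exact (H.flux.strictMono.lt_iff_lt.1 (by linarith)).le

theorem isLaxSolution (H : IsSolution f φ u) : IsLaxSolution f φ u where
  toFluxData := H.toFluxData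
  intervalIntegrable _ ht := H.intervalIntegrable ht
  integral_eq _ ht := H.value_sub ht
  between x _ ht := ⟨H.vmin_le x ht, H.le_vmax x ht⟩

end IsSolution

namespace IsLaxSolution

theorem tendsto_of_maximizersTendsto (S : IsLaxSolution f φ u) {ι : Type*} {l : Filter ι}
    {p : ι → ℝ × ℝ} {w : ℝ} (h : MaximizersTendsto f φ (map p l) w) (hp : ∀ᶠ i in l, 0 < (p i).2)
    {g : ι → ℝ} (hg : ∀ᶠ i in l, g i ∈ Icc (vmin f φ (p i).1 (p i).2) (vmax f φ (p i).1 (p i).2)) :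
    Tendsto g l (𝓝 w) := by
  refine Metric.tendsto_nhds.2 fun ε hε => ?_
  have := h ε hε
  rw [eventually_map] at this
  filter_upwards [this, hp, hg] with i h1 h2 h3
  have a1 := abs_lt.1 (h1 _ (S.isGreatest_vmax (p i).1 h2).1)
  have a2 := abs_lt.1 (h1 _ (S.isLeast_vmin (p i).1 h2).1)
  rw [Real.dist_eq, abs_lt]
  constructor <;> linarith [h3.1, h3.2]

theorem leftTrace_eq (S : IsLaxSolution f φ u) (x : ℝ) {t : ℝ} (ht : 0 < t) :
    leftTrace u x t = vmax f φ x t :=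
  leftLim_eq_of_tendsto (S.tendsto_of_maximizersTendsto (S.maximizersTendsto_left x ht)
      (Eventually.of_forall fun _ => ht) (Eventually.of_forall fun y => S.between y ht))

theorem rightTrace_eq (S : IsLaxSolution f φ u) (x : ℝ) {t : ℝ} (ht : 0 < t) :
    rightTrace u x t = vmin f φ x t :=
  rightLim_eq_of_tendsto (S.tendsto_of_maximizersTendsto (S.maximizersTendsto_right x ht)
      (Eventually.of_forall fun _ => ht) (Eventually.of_forall fun y => S.between y ht))

theorem mem_shockSet (S : IsLaxSolution f φ u) {p : ℝ × ℝ} :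
    p ∈ shockSet u ↔ 0 < p.2 ∧ vmin f φ p.1 p.2 < vmax f φ p.1 p.2 := by
  refine and_congr_right fun ht => ?_
  rw [S.leftTrace_eq _ ht, S.rightTrace_eq _ ht]

theorem eq_of_singleton (S : IsLaxSolution f φ u) {x t c : ℝ} (ht : 0 < t)
    (h : maximizers f φ x t = {c}) : leftTrace u x t = c ∧ rightTrace u x t = c ∧ u x t = c := by
  have h1 := vmax_eq_of_singleton h
  have h2 := vmin_eq_of_singleton h
  have h3 := S.between x ht
  rw [h1, h2] at h3
  exact ⟨(S.leftTrace_eq x ht).trans h1, (S.rightTrace_eq x ht).trans h2, le_antisymm h3.2 h3.1⟩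

theorem tracesTendsto (S : IsLaxSolution f φ u) {T : Set (ℝ × ℝ)} {x t w : ℝ}
    (hT : ∀ p ∈ T, 0 < p.2) (h : MaximizersTendsto f φ (𝓝[T] (x, t)) w) :
    TracesTendsto u T x t w := by
  have h' : MaximizersTendsto f φ (map (fun p => p) (𝓝[T] (x, t))) w := by rwa [map_id']
  have hpos : ∀ᶠ p in 𝓝[T] (x, t), 0 < p.2 := by
    filter_upwards [self_mem_nhdsWithin] with p hp using hT p hp
  refine ⟨S.tendsto_of_maximizersTendsto h' hpos ?_, S.tendsto_of_maximizersTendsto h' hpos ?_⟩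
  · filter_upwards [hpos] with p hp
    rw [S.leftTrace_eq _ hp]
    exact ⟨S.vmin_le_vmax _ hp, le_rfl⟩
  · filter_upwards [hpos] with p hp
    rw [S.rightTrace_eq _ hp]
    exact ⟨le_rfl, S.vmin_le_vmax _ hp⟩

/-- The increment of the value function over an interval on which all the maximizers are close
to `c`. -/
theorem abs_value_sub_le (S : IsLaxSolution f φ u) {a b c ε t : ℝ} (ht : 0 < t) (hab : a ≤ b)
    (h : ∀ y ∈ Ioo a b, ∀ v ∈ maximizers f φ y t, |v - c| ≤ ε) :
    |value f φ b t - value f φ a t - c * (b - a)| ≤ ε * (b - a) := by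
  have h1 : (∫ y in a..b, (u y t - c)) = value f φ b t - value f φ a t - c * (b - a) := by
    rw [intervalIntegral.integral_sub (S.intervalIntegrable ht a b) intervalIntegrable_const,
      S.integral_eq ht, intervalIntegral.integral_const, smul_eq_mul, mul_comm]
  rw [← h1, ← Real.norm_eq_abs]
  refine (intervalIntegral.norm_integral_le_of_norm_le_const_ae (C := ε) ?_).trans_eq
    (by rw [abs_of_nonneg (sub_nonneg.2 hab)])
  have hb : ∀ᵐ y, y ≠ b := by simp [ae_iff]
  filter_upwards [hb] with y hy hy2
  rw [uIoc_of_le hab] at hy2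
  have hy3 : y ∈ Ioo a b := ⟨hy2.1, lt_of_le_of_ne hy2.2 hy⟩
  have a1 := abs_le.1 (h y hy3 _ (S.isGreatest_vmax y ht).1)
  have a2 := abs_le.1 (h y hy3 _ (S.isLeast_vmin y ht).1)
  have a3 := S.between y ht
  rw [Real.norm_eq_abs, abs_le]
  constructor <;> linarith [a3.1, a3.2]

end IsLaxSolution

/-! ### Supporting lines of the primitive and divides -/

/-- The line of slope `c` through `(x₀, Φ(x₀))` supports `Φ` from below. -/
def Supports (φ : ℝ → ℝ) (x₀ c : ℝ) : Prop :=
  ∀ y, primitive φ x₀ + c * (y - x₀) ≤ primitive φ y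

theorem Supports.slope_mono {x₁ c₁ x₂ c₂ : ℝ} (h₁ : Supports φ x₁ c₁) (h₂ : Supports φ x₂ c₂)
    (hx : x₁ < x₂) : c₁ ≤ c₂ := by
  have a := h₁ x₂
  have b := h₂ x₁
  nlinarith

theorem Supports.of_between {x₀ c₁ c₂ c : ℝ} (h₁ : Supports φ x₀ c₁) (h₂ : Supports φ x₀ c₂)
    (hc₁ : c₁ ≤ c) (hc₂ : c ≤ c₂) : Supports φ x₀ c := fun y => by
  rcases le_total y x₀ with hy | hy
  · have := h₁ y
    nlinarith [mul_nonneg (sub_nonneg.2 hc₁) (sub_nonneg.2 hy)]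
  · have := h₂ y
    nlinarith [mul_nonneg (sub_nonneg.2 hc₂) (sub_nonneg.2 hy)]

/-- Below a supporting line at `a`, an inequality of larger slope extends to the left of `a`. -/
theorem Supports.extend_left {a c z s y : ℝ} (h : Supports φ a c) (hcs : c ≤ s)
    (hz : primitive φ z + s * (a - z) ≤ primitive φ a) (hy : y ≤ a) :
    primitive φ z + s * (y - z) ≤ primitive φ y := by
  have := h y
  nlinarith [mul_nonneg (sub_nonneg.2 hcs) (sub_nonneg.2 hy)]

theorem Supports.extend_right {a c z s y : ℝ} (h : Supports φ a c) (hcs : s ≤ c)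
    (hz : primitive φ z + s * (a - z) ≤ primitive φ a) (hy : a ≤ y) :
    primitive φ z + s * (y - z) ≤ primitive φ y := by
  have := h y
  nlinarith [mul_nonneg (sub_nonneg.2 hcs) (sub_nonneg.2 hy)]

theorem FluxData.abs_slope_le (S : FluxData f φ) {x₀ c : ℝ} (h : Supports φ x₀ c) :
    |c| ≤ dataBound φ := by
  have h1 := h (x₀ + 1)
  have h2 := h (x₀ - 1)
  have h3 := (abs_le.1 (S.abs_primitive_sub_le x₀ (x₀ + 1))).2
  have h4 := (abs_le.1 (S.abs_primitive_sub_le x₀ (x₀ - 1))).2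
  simp only [add_sub_cancel_left, sub_sub_cancel_left, abs_neg, abs_one, mul_one] at *
  rw [abs_le]
  constructor <;> linarith

/-- The line `x = x₀ + t f'(c)` is a divide if and only if `c` is the slope of a supporting line
of `Φ` at `x₀`. -/
theorem FluxData.isDivide_iff (S : FluxData f φ) {x₀ c : ℝ} :
    IsDivide f φ x₀ c ↔ Supports φ x₀ c := by
  rw [S.isDivide_iff_mem]
  constructor
  · intro h
    -- competitors of velocity `v` with foot point `y`
    have key : ∀ y v, v ≠ c → 0 < (y - x₀) / (deriv f c - deriv f v) →
        primitive φ x₀ + v * (y - x₀) ≤ primitive φ y := by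
      intro y v hvc ht
      set t := (y - x₀) / (deriv f c - deriv f v) with htdef
      have hne : deriv f c - deriv f v ≠ 0 := by
        intro h0
        rw [htdef, h0, div_zero] at ht
        exact ht.false
      have e1 : t * (deriv f c - deriv f v) = y - x₀ := by
        rw [htdef]; field_simp
      have h1 := (S.mem_maximizers ht).1 (h t ht) v
      unfold cost at h1
      rw [show x₀ + t * deriv f c - t * deriv f c = x₀ by ring,
        show x₀ + t * deriv f c - t * deriv f v = y by linarith] at h1
      have h2 := mul_le_mul_of_nonneg_left (S.flux.legendre_le v c) ht.le
      have h3 : t * (v * (deriv f c - deriv f v)) = v * (y - x₀) := by rw [← e1]; ring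
      nlinarith
    intro y
    have hcont : Continuous fun v : ℝ => primitive φ x₀ + v * (y - x₀) := by fun_prop
    rcases lt_trichotomy y x₀ with hy | rfl | hy
    · refine le_of_tendsto ((hcont.tendsto c).mono_left (nhdsWithin_le_nhds (s := Ioi c))) ?_
      filter_upwards [self_mem_nhdsWithin] with v hv
      exact key y v (ne_of_gt hv)
        (div_pos_of_neg_of_neg (sub_neg.2 hy) (sub_neg.2 (S.flux.strictMono hv)))
    · simp
    · refine le_of_tendsto ((hcont.tendsto c).mono_left (nhdsWithin_le_nhds (s := Iio c))) ?_
      filter_upwards [self_mem_nhdsWithin] with v hv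
      exact key y v (ne_of_lt hv)
        (div_pos (sub_pos.2 hy) (sub_pos.2 (S.flux.strictMono hv)))
  · intro h t ht
    rw [S.mem_maximizers ht]
    intro v
    have h1 := h (x₀ + t * deriv f c - t * deriv f v)
    have h2 := mul_le_mul_of_nonneg_left (S.flux.legendre_le c v) ht.le
    unfold cost
    rw [show x₀ + t * deriv f c - t * deriv f c = x₀ by ring]
    nlinarith

/-! ### The convex hull of the primitive -/

theorem convexEnvelope_bddAbove {s : Set ℝ} {g : ℝ → ℝ} {x : ℝ} (hx : x ∈ s) :
    BddAbove {y | ∃ k : ℝ → ℝ, ConvexOn ℝ s k ∧ (∀ z ∈ s, k z ≤ g z) ∧ y = k x} :=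
  ⟨g x, by rintro y ⟨k, -, hk, rfl⟩; exact hk x hx⟩

theorem le_convexEnvelope {s : Set ℝ} {g k : ℝ → ℝ} {x : ℝ} (hx : x ∈ s) (hk : ConvexOn ℝ s k)
    (hkg : ∀ z ∈ s, k z ≤ g z) : k x ≤ convexEnvelope s g x :=
  le_csSup (convexEnvelope_bddAbove hx) ⟨k, hk, hkg, rfl⟩

theorem convexEnvelope_le {s : Set ℝ} {g : ℝ → ℝ} {x B : ℝ}
    (hne : ∃ k : ℝ → ℝ, ConvexOn ℝ s k ∧ ∀ z ∈ s, k z ≤ g z)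
    (h : ∀ k : ℝ → ℝ, ConvexOn ℝ s k → (∀ z ∈ s, k z ≤ g z) → k x ≤ B) :
    convexEnvelope s g x ≤ B := by
  obtain ⟨k, hk, hkg⟩ := hne
  refine csSup_le ⟨k x, k, hk, hkg, rfl⟩ ?_
  rintro y ⟨k, hk, hkg, rfl⟩
  exact h k hk hkg

theorem convexOn_convexEnvelope {s : Set ℝ} {g : ℝ → ℝ} (hs : Convex ℝ s)
    (hne : ∃ k : ℝ → ℝ, ConvexOn ℝ s k ∧ ∀ z ∈ s, k z ≤ g z) :
    ConvexOn ℝ s (convexEnvelope s g) := by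
  refine ⟨hs, fun x hx y hy a b ha hb hab => convexEnvelope_le hne fun k hk hkg => ?_⟩
  refine (hk.2 hx hy ha hb hab).trans ?_
  simp only [smul_eq_mul]
  gcongr
  · exact le_convexEnvelope hx hk hkg
  · exact le_convexEnvelope hy hk hkg

theorem FluxData.exists_convex_minorant (S : FluxData f φ) (N : ℝ) :
    ∃ k : ℝ → ℝ, ConvexOn ℝ (Icc (-N) N) k ∧ ∀ z ∈ Icc (-N) N, k z ≤ primitive φ z := by
  obtain ⟨m, hm⟩ := (isCompact_Icc.image S.continuous_primitive).bddBelow (s := _ '' Icc (-N) N)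
  exact ⟨fun _ => m, convexOn_const _ (convex_Icc _ _), fun z hz => hm (mem_image_of_mem _ hz)⟩

theorem convexEnvelope_anti {s t : Set ℝ} {g : ℝ → ℝ} {x : ℝ} (hst : s ⊆ t) (hx : x ∈ s)
    (hs : Convex ℝ s) (hne : ∃ k : ℝ → ℝ, ConvexOn ℝ t k ∧ ∀ z ∈ t, k z ≤ g z) :
    convexEnvelope t g x ≤ convexEnvelope s g x :=
  convexEnvelope_le hne fun _ hk hkg =>
    le_convexEnvelope hx (hk.subset hst hs) fun z hz => hkg z (hst hz)

/-- The truncated hulls at `x` are eventually nonincreasing, and they converge to `Φ̄(x)`. -/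
theorem FluxData.tendsto_hull (S : FluxData f φ) (x : ℝ) :
    Tendsto (fun N : ℝ => ((truncatedHull φ N x : ℝ) : EReal)) atTop (𝓝 (hull φ x)) ∧
      ∀ N, |x| ≤ N → hull φ x ≤ (convexEnvelope (Icc (-N) N) (primitive φ) x : ℝ) := by
  classical
  set G : ℝ → EReal := fun N =>
    if |x| ≤ N then ((convexEnvelope (Icc (-N) N) (primitive φ) x : ℝ) : EReal) else ⊤ with hG
  have hanti : Antitone G := by
    intro N M hNM
    by_cases h : |x| ≤ N
    · simp only [hG, if_pos h, if_pos (h.trans hNM)]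
      exact EReal.coe_le_coe_iff.2 (convexEnvelope_anti (Icc_subset_Icc (neg_le_neg hNM) hNM)
        (abs_le.1 h) (convex_Icc _ _) (S.exists_convex_minorant M))
    · simp only [hG, if_neg h, le_top]
  have heq : G =ᶠ[atTop] fun N : ℝ => ((truncatedHull φ N x : ℝ) : EReal) := by
    filter_upwards [eventually_ge_atTop |x|] with N hN
    simp only [hG, if_pos hN, truncatedHull]
  have ht := (tendsto_atTop_iInf hanti).congr' heq
  have hlim : hull φ x = ⨅ N, G N := ht.limUnder_eq
  refine ⟨hlim ▸ ht, fun N hN => ?_⟩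
  rw [hlim]
  refine (iInf_le G N).trans_eq ?_
  simp only [hG, if_pos hN]

theorem FluxData.le_hull (S : FluxData f φ) {x c : ℝ}
    (h : ∀ᶠ N in atTop, c ≤ convexEnvelope (Icc (-N) N) (primitive φ) x) :
    (c : EReal) ≤ hull φ x := by
  refine ge_of_tendsto (S.tendsto_hull x).1 ?_
  filter_upwards [h, eventually_ge_atTop |x|] with N h1 h2
  rw [truncatedHull, if_pos h2]
  exact EReal.coe_le_coe_iff.2 h1

theorem FluxData.hull_le_primitive (S : FluxData f φ) (x : ℝ) :
    hull φ x ≤ (primitive φ x : ℝ) :=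
  ((S.tendsto_hull x).2 |x| le_rfl).trans (EReal.coe_le_coe_iff.2
    (convexEnvelope_le (S.exists_convex_minorant _) fun _ _ hkg => hkg x (abs_le.1 le_rfl)))

/-- The hull lies below the chords of `Φ`. -/
theorem FluxData.hull_le_chord (S : FluxData f φ) {x α β : ℝ} (hα : 0 ≤ α) (hβ : 0 ≤ β)
    (hαβ : 0 < α + β) : hull φ x ≤
      ((β * primitive φ (x - α) + α * primitive φ (x + β)) / (α + β) : ℝ) := by
  set N := |x| + α + β with hN
  have hx := abs_le.1 (le_refl |x|)
  refine ((S.tendsto_hull x).2 N (by linarith)).trans (EReal.coe_le_coe_iff.2 ?_)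
  refine convexEnvelope_le (S.exists_convex_minorant _) fun k hk hkg => ?_
  have m1 : x - α ∈ Icc (-N) N := ⟨by linarith [hx.1], by linarith [hx.2]⟩
  have m2 : x + β ∈ Icc (-N) N := ⟨by linarith [hx.1], by linarith [hx.2]⟩
  have h1 := hk.2 m1 m2 (div_nonneg hβ hαβ.le) (div_nonneg hα hαβ.le) (by field_simp; ring)
  simp only [smul_eq_mul] at h1
  rw [show β / (α + β) * (x - α) + α / (α + β) * (x + β) = x by field_simp; ring] at h1
  refine h1.trans ?_
  rw [add_div, mul_div_right_comm, mul_div_right_comm]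
  have := hkg _ m1
  have := hkg _ m2
  gcongr

theorem FluxData.affine_le_hull (S : FluxData f φ) {x₀ c : ℝ} (h : Supports φ x₀ c) (y : ℝ) :
    ((primitive φ x₀ + c * (y - x₀) : ℝ) : EReal) ≤ hull φ y := by
  refine S.le_hull ?_
  filter_upwards [eventually_ge_atTop |y|] with N hN
  refine le_convexEnvelope (k := fun y => primitive φ x₀ + c * (y - x₀)) (abs_le.1 hN) ?_
    fun z _ => h z
  refine ⟨convex_Icc _ _, fun a _ b _ p q _ _ hpq => le_of_eq ?_⟩
  simp only [smul_eq_mul]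
  linear_combination (c * x₀ - primitive φ x₀) * hpq

/-- The contact points are the points with a supporting line, and also the points at which `Φ` does
not exceed any of its chords; the second form is visibly closed. -/
theorem FluxData.mem_contactSet_iff_chord (S : FluxData f φ) {x : ℝ} :
    (x ∈ contactSet φ ↔ ∃ c, Supports φ x c) ∧
    (x ∈ contactSet φ ↔ ∀ α β, 0 ≤ α → 0 ≤ β →
      (α + β) * primitive φ x ≤ β * primitive φ (x - α) + α * primitive φ (x + β)) := by
  have h1 : x ∈ contactSet φ → ∀ α β, 0 ≤ α → 0 ≤ β →
      (α + β) * primitive φ x ≤ β * primitive φ (x - α) + α * primitive φ (x + β) := by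
    intro hx α β hα hβ
    rcases (add_nonneg hα hβ).eq_or_lt with h0 | h0
    · rw [show α = 0 by linarith, show β = 0 by linarith]
      simp
    · have hx : ((primitive φ x : ℝ) : EReal) = hull φ x := hx
      have := S.hull_le_chord (x := x) hα hβ h0
      rw [← hx, EReal.coe_le_coe_iff, le_div_iff₀ h0] at this
      linarith
  have h2 : (∀ α β, 0 ≤ α → 0 ≤ β →
      (α + β) * primitive φ x ≤ β * primitive φ (x - α) + α * primitive φ (x + β)) →
      ∃ c, Supports φ x c := by
    intro h
    set L : Set ℝ := {s | ∃ α, 0 < α ∧ s = (primitive φ x - primitive φ (x - α)) / α} with hL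
    have hub : ∀ β, 0 < β → ∀ s ∈ L, s ≤ (primitive φ (x + β) - primitive φ x) / β := by
      rintro β hβ s ⟨α, hα, rfl⟩
      rw [div_le_div_iff₀ hα hβ]
      linarith [h α β hα.le hβ.le]
    have hne : L.Nonempty := ⟨_, 1, one_pos, rfl⟩
    have hbdd : BddAbove L := ⟨_, hub 1 one_pos⟩
    refine ⟨sSup L, fun y => ?_⟩
    rcases lt_trichotomy y x with hy | rfl | hy
    · have h3 := le_csSup hbdd (⟨x - y, sub_pos.2 hy, rfl⟩ : _ ∈ L)
      rw [div_le_iff₀ (sub_pos.2 hy), sub_sub_cancel] at h3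
      linarith
    · simp
    · have h3 := csSup_le hne (hub (y - x) (sub_pos.2 hy))
      rw [le_div_iff₀ (sub_pos.2 hy), add_sub_cancel] at h3
      linarith
  have h3 : (∃ c, Supports φ x c) → x ∈ contactSet φ := by
    rintro ⟨c, hc⟩
    have h4 := S.affine_le_hull hc x
    rw [sub_self, mul_zero, add_zero] at h4
    exact le_antisymm h4 (S.hull_le_primitive x)
  exact ⟨⟨fun hx => h2 (h1 hx), h3⟩, ⟨h1, fun h => h3 (h2 h)⟩⟩

theorem FluxData.mem_contactSet (S : FluxData f φ) {x : ℝ} :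
    x ∈ contactSet φ ↔ ∃ c, Supports φ x c := S.mem_contactSet_iff_chord.1

theorem FluxData.isClosed_contactSet (S : FluxData f φ) : IsClosed (contactSet φ) := by
  have : contactSet φ = ⋂ α : ℝ, ⋂ β : ℝ, ⋂ _ : 0 ≤ α, ⋂ _ : 0 ≤ β, {x |
      (α + β) * primitive φ x ≤ β * primitive φ (x - α) + α * primitive φ (x + β)} := by
    ext x
    simp only [mem_iInter]
    exact S.mem_contactSet_iff_chord.2
  rw [this]
  have hc := S.continuous_primitive
  exact isClosed_iInter fun α => isClosed_iInter fun β => isClosed_iInter fun _ =>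
    isClosed_iInter fun _ => isClosed_le (by fun_prop) (by fun_prop)

theorem FluxData.hull_ne_bot (S : FluxData f φ) {x₀ c : ℝ} (h : Supports φ x₀ c) (x : ℝ) :
    hull φ x ≠ ⊥ := fun hx => by
  have := S.affine_le_hull h x
  rw [hx, le_bot_iff] at this
  exact EReal.coe_ne_bot _ this

theorem FluxData.coe_toReal_hull (S : FluxData f φ) {x₀ c : ℝ} (h : Supports φ x₀ c) (x : ℝ) :
    (((hull φ x).toReal : ℝ) : EReal) = hull φ x :=
  EReal.coe_toReal (ne_top_of_le_ne_top (EReal.coe_ne_top _) (S.hull_le_primitive x))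
    (S.hull_ne_bot h x)

theorem FluxData.convexOn_hull (S : FluxData f φ) {x₀ c : ℝ} (h : Supports φ x₀ c) :
    ConvexOn ℝ univ fun x => (hull φ x).toReal := by
  have hlim : ∀ x, Tendsto (fun N => convexEnvelope (Icc (-N) N) (primitive φ) x) atTop
      (𝓝 (hull φ x).toReal) := by
    intro x
    have h1 := (S.tendsto_hull x).1
    rw [← S.coe_toReal_hull h x] at h1
    refine (EReal.tendsto_coe.1 h1).congr' ?_
    filter_upwards [eventually_ge_atTop |x|] with N hN
    rw [truncatedHull, if_pos hN]
  refine ⟨convex_univ, fun x _ y _ a b ha hb hab => ?_⟩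
  refine le_of_tendsto_of_tendsto (hlim _) (((hlim x).const_mul a).add ((hlim y).const_mul b)) ?_
  filter_upwards [eventually_ge_atTop |x|, eventually_ge_atTop |y|] with N hx hy
  exact (convexOn_convexEnvelope (convex_Icc _ _) (S.exists_convex_minorant N)).2
    (abs_le.1 hx) (abs_le.1 hy) ha hb hab

/-- The slopes of the supporting lines at a contact point fill the interval between the one-sided
derivatives of the hull. -/
theorem FluxData.supports_iff (S : FluxData f φ) {x₀ c : ℝ} (hx : x₀ ∈ contactSet φ) :
    Supports φ x₀ c ↔ hullLeftDeriv φ x₀ ≤ c ∧ c ≤ hullRightDeriv φ x₀ := by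
  obtain ⟨c₀, hc₀⟩ := S.mem_contactSet.1 hx
  have hconv := S.convexOn_hull hc₀
  set g : ℝ → ℝ := fun x => (hull φ x).toReal with hg
  have hx0 : g x₀ = primitive φ x₀ := by
    have hx : ((primitive φ x₀ : ℝ) : EReal) = hull φ x₀ := hx
    simp only [hg, ← hx, EReal.toReal_coe]
  have hgle : ∀ y, g y ≤ primitive φ y := fun y => by
    have := S.hull_le_primitive y
    rw [← S.coe_toReal_hull hc₀ y] at this
    exact EReal.coe_le_coe_iff.1 this
  have hint : ∀ y : ℝ, y ∈ interior (univ : Set ℝ) := fun y => by simp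
  have hiff : Supports φ x₀ c ↔ ∀ y, g x₀ + c * (y - x₀) ≤ g y := by
    constructor
    · intro h y
      have := S.affine_le_hull h y
      rw [← S.coe_toReal_hull hc₀ y] at this
      rw [hx0]
      exact EReal.coe_le_coe_iff.1 this
    · intro h y
      rw [← hx0]
      exact (h y).trans (hgle y)
  rw [hiff]
  change _ ↔ derivWithin g (Iio x₀) x₀ ≤ c ∧ c ≤ derivWithin g (Ioi x₀) x₀
  constructor
  · intro h
    constructor
    · refine le_of_tendsto
        ((hasDerivWithinAt_iff_tendsto_slope' (by simp)).1
          (hconv.hasDerivWithinAt_leftDeriv_of_mem_interior (hint x₀))) ?_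
      filter_upwards [self_mem_nhdsWithin] with y hy
      have hy : y < x₀ := hy
      rw [slope_def_field, div_le_iff_of_neg (sub_neg.2 hy)]
      linarith [h y]
    · refine ge_of_tendsto
        ((hasDerivWithinAt_iff_tendsto_slope' (by simp)).1
          (hconv.hasDerivWithinAt_rightDeriv_of_mem_interior (hint x₀))) ?_
      filter_upwards [self_mem_nhdsWithin] with y hy
      have hy : x₀ < y := hy
      rw [slope_def_field, le_div_iff₀ (sub_pos.2 hy)]
      linarith [h y]
  · rintro ⟨h1, h2⟩ y
    rcases lt_trichotomy y x₀ with hy | rfl | hy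
    · have h3 := hconv.slope_le_leftDeriv_of_mem_interior (mem_univ y) (hint x₀) hy
      rw [slope_def_field, div_le_iff₀ (sub_pos.2 hy)] at h3
      nlinarith [mul_nonneg (sub_nonneg.2 h1) (sub_nonneg.2 hy.le)]
    · simp
    · have h3 := hconv.rightDeriv_le_slope_of_mem_interior (hint x₀) (mem_univ y) hy
      rw [slope_def_field, le_div_iff₀ (sub_pos.2 hy)] at h3
      nlinarith [mul_nonneg (sub_nonneg.2 h2) (sub_nonneg.2 hy.le)]

/-! ### Mean values of the data and the slopes of divides -/

theorem FluxData.abs_mean_le (S : FluxData f φ) (x : ℝ) : |x⁻¹ * primitive φ x| ≤ dataBound φ := by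
  have h := S.abs_primitive_sub_le 0 x
  have h0 : primitive φ 0 = 0 := by simp [primitive]
  rw [h0, sub_zero, sub_zero] at h
  rcases eq_or_ne x 0 with rfl | hx
  · simpa using dataBound_nonneg φ
  · rw [abs_mul, abs_inv, inv_mul_le_iff₀ (abs_pos.2 hx), mul_comm]
    exact h

theorem FluxData.isBoundedUnder_mean (S : FluxData f φ) (l : Filter ℝ) :
    IsBoundedUnder (· ≤ ·) l (fun x => x⁻¹ * primitive φ x) ∧
      IsBoundedUnder (· ≥ ·) l (fun x => x⁻¹ * primitive φ x) :=
  ⟨isBoundedUnder_of ⟨dataBound φ, fun x => (abs_le.1 (S.abs_mean_le x)).2⟩,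
    isBoundedUnder_of ⟨-dataBound φ, fun x => (abs_le.1 (S.abs_mean_le x)).1⟩⟩

theorem FluxData.eventually_lt_primitive (S : FluxData f φ) {c : ℝ} (hc : c < lowerMeanRight φ) :
    ∀ᶠ x in atTop, c * x < primitive φ x := by
  filter_upwards [eventually_lt_of_lt_liminf hc (S.isBoundedUnder_mean _).2,
    eventually_gt_atTop 0] with x h1 h2
  rwa [inv_mul_eq_div, lt_div_iff₀ h2] at h1

theorem FluxData.eventually_lt_primitive_left (S : FluxData f φ) {c : ℝ}
    (hc : upperMeanLeft φ < c) : ∀ᶠ x in atBot, c * x < primitive φ x := by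
  filter_upwards [eventually_lt_of_limsup_lt hc (S.isBoundedUnder_mean _).1,
    eventually_lt_atBot 0] with x h1 h2
  rwa [inv_mul_eq_div, div_lt_iff_of_neg h2] at h1

theorem FluxData.slope_le_lowerMeanRight (S : FluxData f φ) {x₀ c : ℝ} (h : Supports φ x₀ c) :
    c ≤ lowerMeanRight φ := by
  have hlim : Tendsto (fun x : ℝ => x⁻¹ * (primitive φ x₀ - c * x₀) + c) atTop (𝓝 c) := by
    simpa using (tendsto_inv_atTop_zero.mul_const (primitive φ x₀ - c * x₀)).add_const c
  rw [← hlim.liminf_eq]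
  refine liminf_le_liminf ?_ hlim.isBoundedUnder_ge (S.isBoundedUnder_mean _).1.isCoboundedUnder_ge
  filter_upwards [eventually_gt_atTop 0] with x hx
  have := mul_le_mul_of_nonneg_left (h x) (inv_nonneg.2 hx.le)
  refine le_trans (le_of_eq ?_) this
  field_simp
  ring

theorem FluxData.upperMeanLeft_le_slope (S : FluxData f φ) {x₀ c : ℝ} (h : Supports φ x₀ c) :
    upperMeanLeft φ ≤ c := by
  have hlim : Tendsto (fun x : ℝ => x⁻¹ * (primitive φ x₀ - c * x₀) + c) atBot (𝓝 c) := by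
    simpa using (tendsto_inv_atBot_zero.mul_const (primitive φ x₀ - c * x₀)).add_const c
  rw [← hlim.limsup_eq]
  refine limsup_le_limsup ?_ (S.isBoundedUnder_mean _).2.isCoboundedUnder_le hlim.isBoundedUnder_le
  filter_upwards [eventually_lt_atBot 0] with x hx
  have := mul_le_mul_of_nonpos_left (h x) (inv_nonpos.2 hx.le)
  refine this.trans (le_of_eq ?_)
  have hx0 : x ≠ 0 := hx.ne
  field_simp
  ring

/-- If the mean values of the data at `-∞` stay below those at `∞`, then `Φ` has a supporting line:
after subtraction of a linear function of intermediate slope, `Φ` attains its minimum. -/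
theorem FluxData.exists_supports (S : FluxData f φ) (h : upperMeanLeft φ < lowerMeanRight φ) :
    ∃ x₀ c, Supports φ x₀ c := by
  obtain ⟨c, hc1, hc2⟩ := exists_between h
  have hcont : Continuous fun x => primitive φ x - c * x :=
    S.continuous_primitive.sub (by fun_prop)
  obtain ⟨x₀, hx₀⟩ := hcont.exists_forall_le' (x₀ := 0) (by
    rw [cocompact_eq_atBot_atTop, eventually_sup]
    have h0 : primitive φ 0 = 0 := by simp [primitive]
    constructor
    · filter_upwards [S.eventually_lt_primitive_left hc1] with x hx
      rw [h0]; linarith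
    · filter_upwards [S.eventually_lt_primitive hc2] with x hx
      rw [h0]; linarith)
  exact ⟨x₀, c, fun y => by linarith [hx₀ y]⟩

/-! ### Gaps and ends of the contact set -/

/-- The chord of `Φ` over a gap of the contact set is a supporting line: a point of the gap where
`Φ` lies lowest with respect to the chord would be a contact point. -/
theorem FluxData.supports_gapSlope (S : FluxData f φ) {e h : ℝ} (hg : IsGap (contactSet φ) e h) :
    Supports φ e (gapSlope φ e h) ∧ Supports φ h (gapSlope φ e h) := by
  obtain ⟨heh, he, hh, hdis⟩ := hg
  obtain ⟨c₁, hc₁⟩ := S.mem_contactSet.1 he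
  obtain ⟨c₂, hc₂⟩ := S.mem_contactSet.1 hh
  set s := gapSlope φ e h with hs
  have hpos : 0 < h - e := sub_pos.2 heh
  have hsl : s * (h - e) = primitive φ h - primitive φ e := by
    rw [hs, gapSlope]; field_simp
  have h1 : c₁ ≤ s := by
    have := hc₁ h
    exact le_of_mul_le_mul_right (by linarith) hpos
  have h2 : s ≤ c₂ := by
    have := hc₂ e
    exact le_of_mul_le_mul_right (by linarith) hpos
  obtain ⟨z, hz, hmin⟩ := isCompact_Icc.exists_isMinOn (nonempty_Icc.2 heh.le)
    (S.continuous_primitive.sub (by fun_prop : Continuous fun x => s * x)).continuousOn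
  have hmin : ∀ y ∈ Icc e h, primitive φ z + s * (y - z) ≤ primitive φ y := fun y hy => by
    have : primitive φ z - s * z ≤ primitive φ y - s * y := hmin hy
    linarith
  have hsup : Supports φ z s := fun y => by
    rcases le_total y e with hy | hy
    · exact hc₁.extend_left h1 (hmin e ⟨le_rfl, heh.le⟩) hy
    · rcases le_total y h with hy' | hy'
      · exact hmin y ⟨hy, hy'⟩
      · exact hc₂.extend_right h2 (hmin h ⟨heh.le, le_rfl⟩) hy'
  have hzc : z ∉ Ioo e h := fun hz' => disjoint_left.1 hdis hz' (S.mem_contactSet.2 ⟨s, hsup⟩)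
  rcases hz.1.eq_or_lt with rfl | hz1
  · exact ⟨hsup, fun y => by linarith [hsup y]⟩
  · have hzh : z = h := le_antisymm hz.2 (not_lt.1 fun hlt => hzc ⟨hz1, hlt⟩)
    rw [hzh] at hsup
    exact ⟨fun y => by linarith [hsup y], hsup⟩

/-- At the right end `M` of the contact set, the mean value of the data at `∞` is the slope of a
supporting line.  For smaller slopes `s`, at least that of some supporting line at `M`, the minimum
of `Φ(y) - s y` over `y ≥ M` is attained at a contact point, hence at `M`; then `s` tends to the
mean value. -/
theorem FluxData.supports_sSup (S : FluxData f φ) (hne : (contactSet φ).Nonempty)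
    (hb : BddAbove (contactSet φ)) : Supports φ (sSup (contactSet φ)) (lowerMeanRight φ) := by
  set M := sSup (contactSet φ) with hM
  obtain ⟨c, hc⟩ := S.mem_contactSet.1 (S.isClosed_contactSet.csSup_mem hne hb)
  rw [← hM] at hc
  have hcr := S.slope_le_lowerMeanRight hc
  have key : ∀ s, c ≤ s → s < lowerMeanRight φ → Supports φ M s := by
    intro s hcs hs
    obtain ⟨s', hss', hs'⟩ := exists_between hs
    have hcont : Continuous fun x => primitive φ x - s * x :=
      S.continuous_primitive.sub (by fun_prop)
    obtain ⟨z, hz, hmin⟩ := hcont.continuousOn.exists_isMinOn' (s := Ici M) (x₀ := M) isClosed_Ici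
      self_mem_Ici (by
        rw [cocompact_eq_atBot_atTop, inf_sup_right, eventually_sup]
        constructor
        · filter_upwards [mem_inf_of_left (Iio_mem_atBot M), mem_inf_of_right
            (mem_principal_self (Ici M))] with x h1 h2
          exact absurd (mem_Iio.1 h1) (not_lt.2 h2)
        · filter_upwards [mem_inf_of_left (S.eventually_lt_primitive hs'), mem_inf_of_left
            (eventually_ge_atTop ((primitive φ M - s * M) / (s' - s)))] with x h1 h2
          rw [div_le_iff₀ (sub_pos.2 hss')] at h2
          have h1 : s' * x < primitive φ x := h1
          linarith)
    have hmin : ∀ y, M ≤ y → primitive φ z + s * (y - z) ≤ primitive φ y := fun y hy => by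
      have : primitive φ z - s * z ≤ primitive φ y - s * y := hmin hy
      linarith
    have hsup : Supports φ z s := fun y => by
      rcases le_total y M with hy | hy
      · exact hc.extend_left hcs (hmin M le_rfl) hy
      · exact hmin y hy
    have hzM : z = M := le_antisymm (le_csSup hb (S.mem_contactSet.2 ⟨s, hsup⟩)) hz
    rwa [hzM] at hsup
  rcases hcr.eq_or_lt with h | h
  · rwa [h] at hc
  · intro y
    have hcont : Continuous fun s : ℝ => primitive φ M + s * (y - M) := by fun_prop
    refine le_of_tendsto ((hcont.tendsto (lowerMeanRight φ)).mono_left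
      (nhdsWithin_le_nhds (s := Iio (lowerMeanRight φ)))) ?_
    filter_upwards [Ioo_mem_nhdsLT h] with s hs using key s hs.1.le hs.2 y

/-- The counterpart of `FluxData.supports_sSup` at the left end of the contact set. -/
theorem FluxData.supports_sInf (S : FluxData f φ) (hne : (contactSet φ).Nonempty)
    (hb : BddBelow (contactSet φ)) : Supports φ (sInf (contactSet φ)) (upperMeanLeft φ) := by
  set M := sInf (contactSet φ) with hM
  obtain ⟨c, hc⟩ := S.mem_contactSet.1 (S.isClosed_contactSet.csInf_mem hne hb)
  rw [← hM] at hc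
  have hcr := S.upperMeanLeft_le_slope hc
  have key : ∀ s, s ≤ c → upperMeanLeft φ < s → Supports φ M s := by
    intro s hcs hs
    obtain ⟨s', hs', hss'⟩ := exists_between hs
    have hcont : Continuous fun x => primitive φ x - s * x :=
      S.continuous_primitive.sub (by fun_prop)
    obtain ⟨z, hz, hmin⟩ := hcont.continuousOn.exists_isMinOn' (s := Iic M) (x₀ := M) isClosed_Iic
      self_mem_Iic (by
        rw [cocompact_eq_atBot_atTop, inf_sup_right, eventually_sup]
        constructor
        · filter_upwards [mem_inf_of_left (S.eventually_lt_primitive_left hs'), mem_inf_of_left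
            (eventually_le_atBot ((primitive φ M - s * M) / (s' - s)))] with x h1 h2
          rw [le_div_iff_of_neg (sub_neg.2 hss')] at h2
          have h1 : s' * x < primitive φ x := h1
          linarith
        · filter_upwards [mem_inf_of_left (Ioi_mem_atTop M), mem_inf_of_right
            (mem_principal_self (Iic M))] with x h1 h2
          exact absurd (mem_Ioi.1 h1) (not_lt.2 h2))
    have hmin : ∀ y, y ≤ M → primitive φ z + s * (y - z) ≤ primitive φ y := fun y hy => by
      have : primitive φ z - s * z ≤ primitive φ y - s * y := hmin hy
      linarith
    have hsup : Supports φ z s := fun y => by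
      rcases le_total y M with hy | hy
      · exact hmin y hy
      · exact hc.extend_right hcs (hmin M le_rfl) hy
    have hzM : z = M := le_antisymm hz (csInf_le hb (S.mem_contactSet.2 ⟨s, hsup⟩))
    rwa [hzM] at hsup
  rcases hcr.eq_or_lt with h | h
  · rwa [← h] at hc
  · intro y
    have hcont : Continuous fun s : ℝ => primitive φ M + s * (y - M) := by fun_prop
    refine le_of_tendsto ((hcont.tendsto (upperMeanLeft φ)).mono_left
      (nhdsWithin_le_nhds (s := Ioi (upperMeanLeft φ)))) ?_
    filter_upwards [Ioo_mem_nhdsGT h] with s hs using key s hs.2.le hs.1 y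

/-! ### The partition of the half-plane -/

/-- A point between two points of a closed set lies in the set or in one of its gaps. -/
theorem exists_isGap {K : Set ℝ} (hK : IsClosed K) {a w b : ℝ} (ha : a ∈ K) (hb : b ∈ K)
    (haw : a ≤ w) (hwb : w ≤ b) (hw : w ∉ K) : ∃ c d, IsGap K c d ∧ w ∈ Ioo c d := by
  have hne1 : (K ∩ Iic w).Nonempty := ⟨a, ha, haw⟩
  have hne2 : (K ∩ Ici w).Nonempty := ⟨b, hb, hwb⟩
  have hb1 : BddAbove (K ∩ Iic w) := ⟨w, fun x hx => hx.2⟩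
  have hb2 : BddBelow (K ∩ Ici w) := ⟨w, fun x hx => hx.2⟩
  have hc := (hK.inter isClosed_Iic).csSup_mem hne1 hb1
  have hd := (hK.inter isClosed_Ici).csInf_mem hne2 hb2
  set c := sSup (K ∩ Iic w)
  set d := sInf (K ∩ Ici w)
  have hcw : c < w := lt_of_le_of_ne hc.2 fun h => hw (h ▸ hc.1)
  have hwd : w < d := lt_of_le_of_ne hd.2 fun h => hw (h ▸ hd.1)
  refine ⟨c, d, ⟨hcw.trans hwd, hc.1, hd.1, disjoint_left.2 fun x hx hxK => ?_⟩, hcw, hwd⟩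
  rcases le_total x w with h | h
  · exact absurd hx.1 (not_lt.2 (le_csSup hb1 ⟨hxK, h⟩))
  · exact absurd hx.2 (not_lt.2 (csInf_le hb2 ⟨hxK, h⟩))

theorem IsGap.eq_of_mem {K : Set ℝ} {c d c' d' w : ℝ} (h : IsGap K c d) (h' : IsGap K c' d')
    (hw : w ∈ Ioo c d) (hw' : w ∈ Ioo c' d') : c = c' ∧ d = d' := by
  have key : ∀ {c d c' d'}, IsGap K c d → IsGap K c' d' → w ∈ Ioo c d → w ∈ Ioo c' d' →
      c' ≤ c ∧ d ≤ d' := by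
    intro c d c' d' h h' hw hw'
    constructor
    · by_contra! hlt
      exact disjoint_left.1 h.2.2.2 ⟨hlt, hw'.1.trans hw.2⟩ h'.2.1
    · by_contra! hlt
      exact disjoint_left.1 h.2.2.2 ⟨hw.1.trans hw'.2, hlt⟩ h'.2.2.1
  have h1 := key h h' hw hw'
  have h2 := key h' h hw' hw
  exact ⟨le_antisymm h2.1 h1.1, le_antisymm h1.2 h2.2⟩

/-- The positions of the divides at time `t`. -/
def dividePositions (f φ : ℝ → ℝ) (t : ℝ) : Set ℝ :=
  {q | ∃ c, Supports φ (q - t * deriv f c) c}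

theorem Supports.mem_dividePositions {x₀ c : ℝ} (h : Supports φ x₀ c) (t : ℝ) :
    x₀ + t * deriv f c ∈ dividePositions f φ t := ⟨c, by rwa [add_sub_cancel_right]⟩

/-- The slopes of supporting lines are bounded, and limits of supporting lines are supporting lines. -/
theorem FluxData.isClosed_dividePositions (S : FluxData f φ) (t : ℝ) :
    IsClosed (dividePositions f φ t) := by
  refine IsSeqClosed.isClosed fun q q₀ hq hlim => ?_
  choose c hc using hq
  obtain ⟨c₀, -, ψ, hψ, hcψ⟩ := isCompact_Icc.tendsto_subseq
    fun n => abs_le.1 (S.abs_slope_le (hc n))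
  have h1 := hlim.comp hψ.tendsto_atTop
  refine ⟨c₀, fun y => ?_⟩
  have hfoot : Tendsto (fun n => q (ψ n) - t * deriv f (c (ψ n))) atTop
      (𝓝 (q₀ - t * deriv f c₀)) :=
    h1.sub (((S.flux.continuous_deriv.tendsto c₀).comp hcψ).const_mul t)
  have hl : Tendsto (fun n => primitive φ (q (ψ n) - t * deriv f (c (ψ n))) +
      c (ψ n) * (y - (q (ψ n) - t * deriv f (c (ψ n))))) atTop
      (𝓝 (primitive φ (q₀ - t * deriv f c₀) + c₀ * (y - (q₀ - t * deriv f c₀)))) :=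
    ((S.continuous_primitive.tendsto _).comp hfoot).add (hcψ.mul (hfoot.const_sub y))
  exact le_of_tendsto' hl fun n => hc (ψ n) y

theorem Supports.position_lt (hf : IsFlux f) {x₁ c₁ x₂ c₂ t : ℝ} (ht : 0 < t)
    (h₁ : Supports φ x₁ c₁) (h₂ : Supports φ x₂ c₂) (hx : x₁ < x₂) :
    x₁ + t * deriv f c₁ < x₂ + t * deriv f c₂ :=
  add_lt_add_of_lt_of_le hx
    (mul_le_mul_of_nonneg_left (hf.monotone_deriv (h₁.slope_mono h₂ hx)) ht.le)

theorem FluxData.mem_divideSet (S : FluxData f φ) {p : ℝ × ℝ} :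
    p ∈ divideSet f φ ↔ 0 < p.2 ∧ p.1 ∈ dividePositions f φ p.2 := by
  refine and_congr_right fun _ => ⟨?_, ?_⟩
  · rintro ⟨x₀, c, h, hp⟩
    rw [hp]
    exact (S.isDivide_iff.1 h).mem_dividePositions _
  · rintro ⟨c, hc⟩
    exact ⟨_, c, S.isDivide_iff.2 hc, by ring⟩

/-- Between two consecutive divide positions, the point lies in the strip over a gap of the
contact set. -/
theorem FluxData.mem_strip_of_isGap (S : FluxData f φ) {t q₁ q₂ w : ℝ} (ht : 0 < t)
    (hg : IsGap (dividePositions f φ t) q₁ q₂) (hw : w ∈ Ioo q₁ q₂) :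
    ∃ e h, IsGap (contactSet φ) e h ∧ (w, t) ∈ strip f φ e h := by
  obtain ⟨hq, ⟨c₁, hc₁⟩, ⟨c₂, hc₂⟩, hdis⟩ := hg
  set e := q₁ - t * deriv f c₁ with he
  set h := q₂ - t * deriv f c₂ with hh
  have hq₁ : q₁ = e + t * deriv f c₁ := by rw [he]; ring
  have hq₂ : q₂ = h + t * deriv f c₂ := by rw [hh]; ring
  have heh : e < h := by
    rcases lt_trichotomy e h with h' | h' | h'
    · exact h'
    · exfalso
      rw [← h'] at hq₂ hc₂
      have hd1 : deriv f c₁ ≤ (w - e) / t := by rw [le_div_iff₀ ht]; linarith [hw.1]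
      have hd2 : (w - e) / t ≤ deriv f c₂ := by rw [div_le_iff₀ ht]; linarith [hw.2]
      obtain ⟨c, hc, hdc⟩ := S.flux.exists_deriv_eq
        (S.flux.strictMono.le_iff_le.1 (hd1.trans hd2)) hd1 hd2
      refine disjoint_left.1 hdis hw ?_
      have := (hc₁.of_between hc₂ hc.1 hc.2).mem_dividePositions (f := f) t
      rwa [hdc, mul_div_cancel₀ _ ht.ne', add_sub_cancel] at this
    · have := hc₂.position_lt S.flux ht hc₁ h'
      linarith
  have hgap : IsGap (contactSet φ) e h := by
    refine ⟨heh, S.mem_contactSet.2 ⟨_, hc₁⟩, S.mem_contactSet.2 ⟨_, hc₂⟩,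
      disjoint_left.2 fun z hz hzc => ?_⟩
    obtain ⟨c, hc⟩ := S.mem_contactSet.1 hzc
    refine disjoint_left.1 hdis ⟨?_, ?_⟩ (hc.mem_dividePositions (f := f) t)
    · rw [hq₁]; exact hc₁.position_lt S.flux ht hc hz.1
    · rw [hq₂]; exact hc.position_lt S.flux ht hc₂ hz.2
  obtain ⟨h1, h2⟩ := S.supports_gapSlope hgap
  refine ⟨e, h, hgap, ht, ?_, ?_⟩
  · have h3 : e + t * deriv f (gapSlope φ e h) < q₂ := by
      rw [hq₂]; exact h1.position_lt S.flux ht hc₂ heh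
    by_contra! hlt
    exact disjoint_left.1 hdis ⟨hw.1.trans_le hlt, h3⟩ (h1.mem_dividePositions t)
  · have h3 : q₁ < h + t * deriv f (gapSlope φ e h) := by
      rw [hq₁]; exact hc₁.position_lt S.flux ht h2 heh
    by_contra! hlt
    exact disjoint_left.1 hdis ⟨h3, hlt.trans_lt hw.2⟩ (h2.mem_dividePositions t)

/-- At time `t` a point is the position of a divide, or lies between two consecutive ones, or beyond
all of them. -/
theorem FluxData.halfPlane_eq (S : FluxData f φ) (hne : (contactSet φ).Nonempty) :
    halfPlane = divideSet f φ ∪ ⋃₀ regions f φ := by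
  refine Subset.antisymm ?_ ?_
  · rintro ⟨w, t⟩ ht
    have ht : 0 < t := ht
    by_cases hw : w ∈ dividePositions f φ t
    · exact Or.inl (S.mem_divideSet.2 ⟨ht, hw⟩)
    refine Or.inr ?_
    by_cases hlo : ∃ q ∈ dividePositions f φ t, q ≤ w
    · by_cases hhi : ∃ q ∈ dividePositions f φ t, w ≤ q
      · obtain ⟨a, ha, haw⟩ := hlo
        obtain ⟨b, hb, hwb⟩ := hhi
        obtain ⟨q₁, q₂, hg, hwg⟩ :=
          exists_isGap (S.isClosed_dividePositions t) ha hb haw hwb hw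
        obtain ⟨e, h, hg', hmem⟩ := S.mem_strip_of_isGap ht hg hwg
        exact ⟨_, Or.inl ⟨e, h, hg', rfl⟩, hmem⟩
      · push Not at hhi
        have hb : BddAbove (contactSet φ) := by
          refine ⟨w - t * deriv f (-dataBound φ), fun x hx => ?_⟩
          obtain ⟨c, hc⟩ := S.mem_contactSet.1 hx
          have h1 := hhi _ (hc.mem_dividePositions (f := f) t)
          have h2 := mul_le_mul_of_nonneg_left
            (S.flux.monotone_deriv (abs_le.1 (S.abs_slope_le hc)).1) ht.le
          linarith
        exact ⟨_, Or.inr (Or.inl ⟨hb, rfl⟩), ht,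
          hhi _ ((S.supports_sSup hne hb).mem_dividePositions t)⟩
    · push Not at hlo
      have hb : BddBelow (contactSet φ) := by
        refine ⟨w - t * deriv f (dataBound φ), fun x hx => ?_⟩
        obtain ⟨c, hc⟩ := S.mem_contactSet.1 hx
        have h1 := hlo _ (hc.mem_dividePositions (f := f) t)
        have h2 := mul_le_mul_of_nonneg_left
          (S.flux.monotone_deriv (abs_le.1 (S.abs_slope_le hc)).2) ht.le
        linarith
      exact ⟨_, Or.inr (Or.inr ⟨hb, rfl⟩), ht,
        hlo _ ((S.supports_sInf hne hb).mem_dividePositions t)⟩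
  · rintro p (hp | ⟨H, hH, hp⟩)
    · exact hp.1
    · rcases hH with ⟨e, h, -, rfl⟩ | ⟨-, rfl⟩ | ⟨-, rfl⟩ <;> exact hp.1

/-- Divides start from contact points, their slopes increase with the starting point, and the
boundaries of the regions are divides themselves. -/
theorem FluxData.disjoint_divideSet (S : FluxData f φ) {H : Set (ℝ × ℝ)}
    (hH : H ∈ regions f φ) : Disjoint (divideSet f φ) H := by
  refine disjoint_left.2 ?_
  rintro ⟨q, t⟩ ⟨ht, x₀, c, hd, hq⟩ hp
  have ht : 0 < t := ht
  have hq : q = x₀ + t * deriv f c := hq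
  have hs := S.isDivide_iff.1 hd
  have hx := S.mem_contactSet.2 ⟨c, hs⟩
  rcases hH with ⟨e, h, hg, rfl⟩ | ⟨hb, rfl⟩ | ⟨hb, rfl⟩
  · obtain ⟨-, hp1, hp2⟩ := hp
    obtain ⟨h1, h2⟩ := S.supports_gapSlope hg
    by_cases hxe : x₀ ≤ e
    · have := S.flux.monotone_deriv (hs.slope_mono h2 (hxe.trans_lt hg.1))
      have := mul_le_mul_of_nonneg_left this ht.le
      simp only at hp1
      linarith
    · by_cases hxh : h ≤ x₀
      · have := S.flux.monotone_deriv (h1.slope_mono hs (hg.1.trans_le hxh))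
        have := mul_le_mul_of_nonneg_left this ht.le
        simp only at hp2
        linarith
      · exact disjoint_left.1 hg.2.2.2 ⟨not_le.1 hxe, not_le.1 hxh⟩ hx
  · have h1 := S.flux.monotone_deriv (S.slope_le_lowerMeanRight hs)
    have h2 := mul_le_mul_of_nonneg_left h1 ht.le
    have h3 := le_csSup hb hx
    have hp1 := hp.2
    simp only at hp1
    linarith
  · have h1 := S.flux.monotone_deriv (S.upperMeanLeft_le_slope hs)
    have h2 := mul_le_mul_of_nonneg_left h1 ht.le
    have h3 := csInf_le hb hx
    have hp1 := hp.2
    simp only at hp1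
    linarith

theorem isOpen_region {H : Set (ℝ × ℝ)} (hH : H ∈ regions f φ) :
    IsOpen H := by
  have h0 : IsOpen {p : ℝ × ℝ | 0 < p.2} := isOpen_lt continuous_const continuous_snd
  have h1 : ∀ a b : ℝ, IsOpen {p : ℝ × ℝ | a + p.2 * b < p.1} := fun a b =>
    isOpen_lt (by fun_prop) continuous_fst
  have h2 : ∀ a b : ℝ, IsOpen {p : ℝ × ℝ | p.1 < a + p.2 * b} := fun a b =>
    isOpen_lt continuous_fst (by fun_prop)
  rcases hH with ⟨e, h, -, rfl⟩ | ⟨-, rfl⟩ | ⟨-, rfl⟩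
  · exact h0.inter ((h1 _ _).inter (h2 _ _))
  · exact h0.inter (h1 _ _)
  · exact h0.inter (h2 _ _)

theorem nonempty_region {H : Set (ℝ × ℝ)} (hH : H ∈ regions f φ) : H.Nonempty := by
  rcases hH with ⟨e, h, hg, rfl⟩ | ⟨-, rfl⟩ | ⟨-, rfl⟩
  · refine ⟨((e + h) / 2 + 1 * deriv f (gapSlope φ e h), 1), one_pos, ?_, ?_⟩ <;>
      simp only <;> linarith [hg.1]
  · exact ⟨(sSup (contactSet φ) + 1 * deriv f (lowerMeanRight φ) + 1, 1), one_pos,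
      by simp only; linarith⟩
  · exact ⟨(sInf (contactSet φ) + 1 * deriv f (upperMeanLeft φ) - 1, 1), one_pos,
      by simp only; linarith⟩

theorem FluxData.pairwiseDisjoint_regions (S : FluxData f φ) (hne : (contactSet φ).Nonempty) :
    (regions f φ).PairwiseDisjoint id := by
  -- two regions that meet coincide
  have hss : ∀ {e h e' h' : ℝ} {p : ℝ × ℝ}, IsGap (contactSet φ) e h →
      IsGap (contactSet φ) e' h' → p ∈ strip f φ e h → p ∈ strip f φ e' h' → e' < h := by
    intro e h e' h' p hg hg' hp hp'
    by_contra! hlt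
    obtain ⟨h1, -⟩ := S.supports_gapSlope hg
    obtain ⟨-, h2⟩ := S.supports_gapSlope hg'
    have := mul_le_mul_of_nonneg_left (S.flux.monotone_deriv
      (h1.slope_mono h2 ((hg.1.trans_le hlt).trans hg'.1))) hp.1.le
    linarith [hp.2.2, hp'.2.1]
  have hsr : ∀ {e h : ℝ} {p : ℝ × ℝ}, IsGap (contactSet φ) e h → BddAbove (contactSet φ) →
      p ∈ strip f φ e h → p ∉ rightRegion f φ := by
    intro e h p hg hb hp hp'
    have := mul_le_mul_of_nonneg_left (S.flux.monotone_deriv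
      (S.slope_le_lowerMeanRight (S.supports_gapSlope hg).1)) hp.1.le
    linarith [hp.2.2, hp'.2, le_csSup hb hg.2.2.1]
  have hsl : ∀ {e h : ℝ} {p : ℝ × ℝ}, IsGap (contactSet φ) e h → BddBelow (contactSet φ) →
      p ∈ strip f φ e h → p ∉ leftRegion f φ := by
    intro e h p hg hb hp hp'
    have := mul_le_mul_of_nonneg_left (S.flux.monotone_deriv
      (S.upperMeanLeft_le_slope (S.supports_gapSlope hg).1)) hp.1.le
    linarith [hp.2.1, hp'.2, csInf_le hb hg.2.1]
  have hlr : ∀ {p : ℝ × ℝ}, BddBelow (contactSet φ) → BddAbove (contactSet φ) →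
      p ∈ leftRegion f φ → p ∉ rightRegion f φ := by
    intro p hb hb' hp hp'
    have := mul_le_mul_of_nonneg_left (S.flux.monotone_deriv
      (S.slope_le_lowerMeanRight (S.supports_sInf hne hb))) hp.1.le
    linarith [hp.2, hp'.2, csInf_le_csSup hne hb hb']
  intro H hH H' hH' hHH'
  refine disjoint_left.2 fun p hp hp' => hHH' ?_
  have hp : p ∈ H := hp
  have hp' : p ∈ H' := hp'
  rcases hH with ⟨e, h, hg, rfl⟩ | ⟨hb, rfl⟩ | ⟨hb, rfl⟩ <;>
    rcases hH' with ⟨e', h', hg', rfl⟩ | ⟨hb', rfl⟩ | ⟨hb', rfl⟩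
  · have h1 := hss hg hg' hp hp'
    have h2 := hss hg' hg hp' hp
    obtain ⟨w, hw1, hw2⟩ := exists_between
      (max_lt (lt_min hg.1 h2) (lt_min h1 hg'.1) : max e e' < min h h')
    obtain ⟨rfl, rfl⟩ := hg.eq_of_mem hg' (w := w)
      ⟨(le_max_left _ _).trans_lt hw1, hw2.trans_le (min_le_left _ _)⟩
      ⟨(le_max_right _ _).trans_lt hw1, hw2.trans_le (min_le_right _ _)⟩
    rfl
  · exact absurd hp' (hsr hg hb' hp)
  · exact absurd hp' (hsl hg hb' hp)
  · exact absurd hp (hsr hg' hb hp')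
  · rfl
  · exact absurd hp (hlr hb' hb hp')
  · exact absurd hp (hsl hg' hb hp')
  · exact absurd hp' (hlr hb hb' hp)
  · rfl

theorem FluxData.countable_regions (S : FluxData f φ) (hne : (contactSet φ).Nonempty) :
    (regions f φ).Countable :=
  (S.pairwiseDisjoint_regions hne).countable_of_isOpen (fun _ hH => isOpen_region hH)
    fun _ hH => nonempty_region hH

/-! ### Backward fans and forward characteristics -/

theorem mem_fan_Icc (hf : IsFlux f) {c d x t : ℝ} (hcd : c ≤ d) {p : ℝ × ℝ} :
    p ∈ fan f (Icc c d) x t ↔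
      0 < p.2 ∧ p.2 < t ∧ linePos f x t d p.2 ≤ p.1 ∧ p.1 ≤ linePos f x t c p.2 := by
  refine and_congr_right fun _ => and_congr_right fun hpt => ⟨?_, ?_⟩
  · rintro ⟨v, hv, hp⟩
    rw [hp]
    exact ⟨linePos_anti hf hpt.le hv.2, linePos_anti hf hpt.le hv.1⟩
  · rintro ⟨h1, h2⟩
    unfold linePos at h1 h2
    have hneg : p.2 - t < 0 := sub_neg.2 hpt
    obtain ⟨v, hv, hdv⟩ := hf.exists_deriv_eq (p := (p.1 - x) / (p.2 - t)) hcd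
      (by rw [le_div_iff_of_neg hneg]; linarith) (by rw [div_le_iff_of_neg hneg]; linarith)
    exact ⟨v, hv, by rw [hdv, mul_div_cancel₀ _ hneg.ne]; ring⟩

theorem mem_fan_Ioo (hf : IsFlux f) {c d x t : ℝ} (hcd : c ≤ d) {p : ℝ × ℝ} :
    p ∈ fan f (Ioo c d) x t ↔
      0 < p.2 ∧ p.2 < t ∧ linePos f x t d p.2 < p.1 ∧ p.1 < linePos f x t c p.2 := by
  constructor
  · rintro ⟨h0, hpt, v, hv, hp⟩
    rw [show p.1 = linePos f x t v p.2 from hp]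
    exact ⟨h0, hpt, (linePos_lt_linePos_iff hf hpt).2 hv.2, (linePos_lt_linePos_iff hf hpt).2 hv.1⟩
  · rintro ⟨h0, hpt, h1, h2⟩
    obtain ⟨-, -, v, -, hp⟩ := (mem_fan_Icc hf hcd).2 ⟨h0, hpt, h1.le, h2.le⟩
    rw [show p.1 = linePos f x t v p.2 from hp] at h1 h2
    exact ⟨h0, hpt, v, ⟨(linePos_lt_linePos_iff hf hpt).1 h2, (linePos_lt_linePos_iff hf hpt).1 h1⟩,
      hp⟩

theorem FluxData.linePos_lt_of_lt_flow (S : FluxData f φ) {x₀ t₀ x t v : ℝ} (h₀ : 0 < t₀)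
    (ht : t₀ ≤ t) (hx : x < flow f φ x₀ t₀ t) (hv : v ∈ maximizers f φ x t) :
    linePos f x t v t₀ < x₀ := by
  by_contra! hle
  have h1 := S.flow_mono hle h₀ ht
  rw [S.flow_eq h₀ ht (S.reaches_of_mem (h₀.trans_le ht) ht hv)] at h1
  exact hx.not_ge h1

theorem FluxData.lt_linePos_of_flow_lt (S : FluxData f φ) {x₀ t₀ x t v : ℝ} (h₀ : 0 < t₀)
    (ht : t₀ ≤ t) (hx : flow f φ x₀ t₀ t < x) (hv : v ∈ maximizers f φ x t) :
    x₀ < linePos f x t v t₀ := by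
  by_contra! hle
  have h1 := S.flow_mono hle h₀ ht
  rw [S.flow_eq h₀ ht (S.reaches_of_mem (h₀.trans_le ht) ht hv)] at h1
  exact hx.not_ge h1

/-- The speed of a shock: if the average of a solution with the one-sided values `A` and `B` over
the base of a backward triangle is balanced by the costs along its edges, then the slope converges
to the Rankine–Hugoniot speed. -/
theorem tendsto_shock_speed (hf : IsFlux f) {ι : Type*} {l : Filter ι} {a b σ : ι → ℝ} {A B : ℝ}
    (hBA : B < A) (ha : Tendsto a l (𝓝 A)) (hb : Tendsto b l (𝓝 B))
    (h : ∀ ε, 0 < ε → ∀ᶠ i in l, |legendre f (a i) - legendre f (b i) -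
      A * (deriv f (a i) - σ i) - B * (σ i - deriv f (b i))| ≤ ε) :
    Tendsto σ l (𝓝 ((f A - f B) / (A - B))) := by
  have hne : A - B ≠ 0 := (sub_pos.2 hBA).ne'
  have hR : Tendsto (fun i => legendre f (a i) - legendre f (b i) -
      A * (deriv f (a i) - σ i) - B * (σ i - deriv f (b i))) l (𝓝 0) := by
    refine Metric.tendsto_nhds.2 fun ε hε => ?_
    filter_upwards [h (ε / 2) (half_pos hε)] with i hi
    rw [Real.dist_eq, sub_zero]
    linarith
  have h1 := (hf.continuous_legendre.tendsto A).comp ha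
  have h2 := (hf.continuous_legendre.tendsto B).comp hb
  have h3 := ((hf.continuous_deriv.tendsto A).comp ha).const_mul A
  have h4 := ((hf.continuous_deriv.tendsto B).comp hb).const_mul B
  have h5 := ((((hR.sub h1).add h2).add h3).sub h4).div_const (A - B)
  refine (h5.congr fun i => ?_).trans_eq ?_
  · simp only [Function.comp_apply]
    field_simp
    ring
  · congr 1
    unfold legendre
    field_simp
    ring

namespace IsLaxSolution

theorem mem_triangle (S : IsLaxSolution f φ u) {x t : ℝ} (ht : 0 < t) {p : ℝ × ℝ} :
    p ∈ triangle f u x t ↔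
      0 < p.2 ∧ p.2 < t ∧ leftEdge f φ x t p.2 ≤ p.1 ∧ p.1 ≤ rightEdge f φ x t p.2 := by
  rw [triangle, S.leftTrace_eq x ht, S.rightTrace_eq x ht, mem_fan_Icc S.flux (S.vmin_le_vmax x ht)]
  rfl

/-- The forward generalized characteristics are the curves of the flow. -/
theorem isForwardChar_iff (S : IsLaxSolution f φ u) {x₀ t₀ : ℝ} (h₀ : 0 < t₀) {X : ℝ → ℝ} :
    IsForwardChar f u x₀ t₀ X ↔ ∀ t, t₀ ≤ t → X t = flow f φ x₀ t₀ t := by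
  constructor
  · rintro ⟨hX0, hX⟩ t ht
    rcases ht.eq_or_lt with rfl | ht'
    · rw [hX0, S.flow_self x₀ h₀]
    have ht0 := h₀.trans ht'
    have hedge : ∀ r ∈ Ioo 0 t₀, leftEdge f φ (X t) t r ≤ leftEdge f φ x₀ t₀ r ∧
        rightEdge f φ x₀ t₀ r ≤ rightEdge f φ (X t) t r := by
      intro r hr
      have hsub := hX t₀ t le_rfl ht'
      rw [hX0] at hsub
      have hlr := S.leftEdge_le_rightEdge x₀ h₀ hr.2.le
      have h1 := (S.mem_triangle ht0).1 (hsub ((S.mem_triangle h₀ (p := (_, r))).2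
        ⟨hr.1, hr.2, le_rfl, hlr⟩))
      have h2 := (S.mem_triangle ht0).1 (hsub ((S.mem_triangle h₀ (p := (_, r))).2
        ⟨hr.1, hr.2, hlr, le_rfl⟩))
      exact ⟨h1.2.2.1, h2.2.2.2⟩
    have hself : ∀ v, linePos f x₀ t₀ v t₀ = x₀ := fun v => linePos_self _ _ _
    refine (S.flow_eq h₀ ht ⟨?_, ?_⟩).symm
    · have h1 : leftEdge f φ (X t) t t₀ ≤ leftEdge f φ x₀ t₀ t₀ :=
        le_of_tendsto_of_tendsto
          (((continuous_leftEdge _ _).tendsto t₀).mono_left (nhdsWithin_le_nhds (s := Iio t₀)))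
          (((continuous_leftEdge _ _).tendsto t₀).mono_left nhdsWithin_le_nhds) (by
            filter_upwards [Ioo_mem_nhdsLT h₀] with r hr using (hedge r hr).1)
      rwa [leftEdge, leftEdge, hself] at h1
    · have h1 : rightEdge f φ x₀ t₀ t₀ ≤ rightEdge f φ (X t) t t₀ :=
        le_of_tendsto_of_tendsto
          (((continuous_rightEdge _ _).tendsto t₀).mono_left (nhdsWithin_le_nhds (s := Iio t₀)))
          (((continuous_rightEdge _ _).tendsto t₀).mono_left nhdsWithin_le_nhds) (by
            filter_upwards [Ioo_mem_nhdsLT h₀] with r hr using (hedge r hr).2)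
      rwa [rightEdge, rightEdge, hself] at h1
  · intro hX
    refine ⟨by rw [hX t₀ le_rfl, S.flow_self x₀ h₀], fun t₁ t₂ h₁ h₁₂ p hp => ?_⟩
    have ht₁ := h₀.trans_le h₁
    have ht₂ := ht₁.trans h₁₂
    have hr : Reaches f φ (X t₁) t₁ (X t₂) t₂ := by
      rw [hX t₁ h₁, hX t₂ (h₁.trans h₁₂.le), ← S.flow_flow x₀ h₀ h₁ h₁₂.le]
      exact S.reaches_flow _ ht₁ h₁₂.le
    rw [S.mem_triangle ht₁] at hp
    rw [S.mem_triangle ht₂]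
    exact ⟨hp.1, hp.2.1.trans h₁₂,
      (S.leftEdge_le_of_reaches ht₁ h₁₂.le hr hp.1.le hp.2.1.le).trans hp.2.2.1,
      hp.2.2.2.trans (S.rightEdge_le_of_reaches ht₁ h₁₂.le hr hp.1.le hp.2.1.le)⟩

theorem isForwardChar_flow (S : IsLaxSolution f φ u) (x₀ : ℝ) {t₀ : ℝ} (h₀ : 0 < t₀) :
    IsForwardChar f u x₀ t₀ (flow f φ x₀ t₀) := (S.isForwardChar_iff h₀).2 fun _ _ => rfl

theorem isShockCurve_flow (S : IsLaxSolution f φ u) {x₀ t₀ : ℝ} (h₀ : 0 < t₀)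
    (h : ∀ t, t₀ < t → vmin f φ (flow f φ x₀ t₀ t) t < vmax f φ (flow f φ x₀ t₀ t) t) :
    IsShockCurve u t₀ (flow f φ x₀ t₀) :=
  ⟨h₀.le, S.continuousOn_flow_time x₀ h₀, fun t ht => S.mem_shockSet.2 ⟨h₀.trans ht, h t ht⟩⟩

theorem isShockCurve_flow_of_mem (S : IsLaxSolution f φ u) {x₀ t₀ : ℝ}
    (h : (x₀, t₀) ∈ shockSet u) : IsShockCurve u t₀ (flow f φ x₀ t₀) := by
  obtain ⟨h₀, hs⟩ := S.mem_shockSet.1 h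
  exact S.isShockCurve_flow h₀ fun t ht =>
    S.vmin_lt_vmax_of_reaches h₀ ht.le (S.reaches_flow x₀ h₀ ht.le) hs

theorem tendsto_forward (S : IsLaxSolution f φ u) {x₀ t₀ : ℝ} (h₀ : 0 < t₀) {X : ℝ → ℝ}
    (hX : ∀ t, t₀ ≤ t → X t = flow f φ x₀ t₀ t) :
    Tendsto (fun t => (X t, t)) (𝓝[>] t₀) (𝓝 (x₀, t₀)) := by
  have h1 : Tendsto (flow f φ x₀ t₀) (𝓝[>] t₀) (𝓝 x₀) := by
    have := (S.continuousOn_flow_time x₀ h₀ t₀ self_mem_Ici).mono_left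
      (nhdsWithin_mono t₀ Ioi_subset_Ici_self)
    rwa [S.flow_self x₀ h₀] at this
  refine (h1.congr' ?_).prodMk_nhds nhdsWithin_le_nhds
  filter_upwards [self_mem_nhdsWithin] with t ht using (hX t (le_of_lt ht)).symm

theorem tendsto_leftTrace_forward (S : IsLaxSolution f φ u) {x₀ t₀ : ℝ} (h₀ : 0 < t₀) {X : ℝ → ℝ}
    (hX : ∀ t, t₀ ≤ t → X t = flow f φ x₀ t₀ t) :
    Tendsto (fun t => vmax f φ (X t) t) (𝓝[>] t₀) (𝓝 (vmax f φ x₀ t₀)) := by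
  refine S.tendsto_selection h₀ (S.tendsto_forward h₀ hX)
    (isClosed_linePos_le S.flux 0 (leftEdge f φ x₀ t₀ 0)) ?_ ?_
  · filter_upwards [self_mem_nhdsWithin] with t ht
    have ht : t₀ < t := ht
    refine ⟨(S.isGreatest_vmax _ (h₀.trans ht)).1, ?_⟩
    rw [hX t ht.le]
    exact S.leftEdge_le_of_reaches h₀ ht.le (S.reaches_flow x₀ h₀ ht.le) le_rfl h₀.le
  · intro v hv hle
    by_contra hne
    have hlt := lt_of_le_of_ne ((S.isGreatest_vmax x₀ h₀).2 hv) hne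
    exact absurd ((linePos_lt_linePos_iff S.flux h₀).2 hlt) (not_lt.2 hle)

theorem tendsto_rightTrace_forward (S : IsLaxSolution f φ u) {x₀ t₀ : ℝ} (h₀ : 0 < t₀)
    {X : ℝ → ℝ} (hX : ∀ t, t₀ ≤ t → X t = flow f φ x₀ t₀ t) :
    Tendsto (fun t => vmin f φ (X t) t) (𝓝[>] t₀) (𝓝 (vmin f φ x₀ t₀)) := by
  refine S.tendsto_selection h₀ (S.tendsto_forward h₀ hX)
    (isClosed_le_linePos S.flux 0 (rightEdge f φ x₀ t₀ 0)) ?_ ?_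
  · filter_upwards [self_mem_nhdsWithin] with t ht
    have ht : t₀ < t := ht
    refine ⟨(S.isLeast_vmin _ (h₀.trans ht)).1, ?_⟩
    rw [hX t ht.le]
    exact S.rightEdge_le_of_reaches h₀ ht.le (S.reaches_flow x₀ h₀ ht.le) le_rfl h₀.le
  · intro v hv hle
    by_contra hne
    have hlt := lt_of_le_of_ne ((S.isLeast_vmin x₀ h₀).2 hv) (Ne.symm hne)
    exact absurd ((linePos_lt_linePos_iff S.flux h₀).2 hlt) (not_lt.2 hle)

theorem maximizersTendsto_leftSide (S : IsLaxSolution f φ u) {x₀ t₀ : ℝ} (h₀ : 0 < t₀) {X : ℝ → ℝ}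
    (hX : ∀ t, t₀ ≤ t → X t = flow f φ x₀ t₀ t) :
    MaximizersTendsto f φ (𝓝[leftSide f u x₀ t₀ X] (x₀, t₀)) (vmax f φ x₀ t₀) := by
  refine S.maximizersTendsto_vmax h₀ nhdsWithin_le_nhds ?_
  filter_upwards [self_mem_nhdsWithin] with p hp v hv
  obtain ⟨hp0, hp1, hp2⟩ := hp
  rw [S.leftTrace_eq x₀ h₀] at hp2
  rcases lt_or_ge p.2 t₀ with h | h
  · exact S.linePos_le hv (S.isGreatest_vmax x₀ h₀).1 le_rfl hp0 hp0.le le_rfl h.le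
      (by rw [linePos_self]; exact hp2 h)
  · have h1 := hp1 h
    rw [hX _ h] at h1
    exact S.linePos_le hv (S.isGreatest_vmax x₀ h₀).1 le_rfl h₀ h₀.le h le_rfl
      (by rw [linePos_self x₀]; exact S.linePos_lt_of_lt_flow h₀ h h1 hv)

theorem maximizersTendsto_rightSide (S : IsLaxSolution f φ u) {x₀ t₀ : ℝ} (h₀ : 0 < t₀)
    {X : ℝ → ℝ} (hX : ∀ t, t₀ ≤ t → X t = flow f φ x₀ t₀ t) :
    MaximizersTendsto f φ (𝓝[rightSide f u x₀ t₀ X] (x₀, t₀)) (vmin f φ x₀ t₀) := by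
  refine S.maximizersTendsto_vmin h₀ nhdsWithin_le_nhds ?_
  filter_upwards [self_mem_nhdsWithin] with p hp v hv
  obtain ⟨hp0, hp1, hp2⟩ := hp
  rw [S.rightTrace_eq x₀ h₀] at hp2
  rcases lt_or_ge p.2 t₀ with h | h
  · exact S.linePos_le (S.isLeast_vmin x₀ h₀).1 hv le_rfl hp0 hp0.le h.le le_rfl
      (by rw [linePos_self p.1]; exact hp2 h)
  · have h1 := hp1 h
    rw [hX _ h] at h1
    exact S.linePos_le (S.isLeast_vmin x₀ h₀).1 hv le_rfl h₀ h₀.le le_rfl h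
      (by rw [linePos_self x₀]; exact S.lt_linePos_of_flow_lt h₀ h h1 hv)

/-- Increments of the value function over short intervals on which the maximizers are close
to `w`. -/
theorem eventually_abs_value_sub_le (S : IsLaxSolution f φ u) {T : Set (ℝ × ℝ)} {x t w : ℝ}
    (ht : 0 < t) (h : MaximizersTendsto f φ (𝓝[T] (x, t)) w) {ι : Type*} {l : Filter ι}
    {α β τ : ι → ℝ} (hα : Tendsto α l (𝓝 x)) (hβ : Tendsto β l (𝓝 x)) (hτ : Tendsto τ l (𝓝 t))
    (hle : ∀ᶠ i in l, α i ≤ β i) (hT : ∀ᶠ i in l, ∀ y ∈ Ioo (α i) (β i), (y, τ i) ∈ T)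
    {ε : ℝ} (hε : 0 < ε) : ∀ᶠ i in l,
      |value f φ (β i) (τ i) - value f φ (α i) (τ i) - w * (β i - α i)| ≤ ε * (β i - α i) := by
  have h1 := h ε hε
  rw [eventually_nhdsWithin_iff, Metric.eventually_nhds_iff] at h1
  obtain ⟨δ, hδ, hball⟩ := h1
  filter_upwards [hle, hT, Metric.tendsto_nhds.1 hα δ hδ, Metric.tendsto_nhds.1 hβ δ hδ,
    Metric.tendsto_nhds.1 hτ δ hδ, hτ.eventually (lt_mem_nhds ht)] with i h2 h3 h4 h5 h6 h7
  refine S.abs_value_sub_le h7 h2 fun y hy v hv => ?_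
  refine (hball (y := (y, τ i)) ?_ (h3 y hy) v hv).le
  rw [Real.dist_eq, abs_lt] at h4 h5
  rw [Prod.dist_eq, max_lt_iff]
  refine ⟨?_, h6⟩
  rw [Real.dist_eq, abs_lt]
  constructor <;> linarith [h4.1, h5.2, hy.1, hy.2]

/-- A shock leaves its starting point with the Rankine–Hugoniot speed. -/
theorem hasDerivWithinAt_forward (S : IsLaxSolution f φ u) {x₀ t₀ : ℝ} (h₀ : 0 < t₀)
    (hs : vmin f φ x₀ t₀ < vmax f φ x₀ t₀) {X : ℝ → ℝ}
    (hX : ∀ t, t₀ ≤ t → X t = flow f φ x₀ t₀ t) :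
    HasDerivWithinAt X ((f (vmax f φ x₀ t₀) - f (vmin f φ x₀ t₀)) /
      (vmax f φ x₀ t₀ - vmin f φ x₀ t₀)) (Ici t₀) t₀ := by
  rw [← hasDerivWithinAt_Ioi_iff_Ici, hasDerivWithinAt_iff_tendsto_slope' (by simp)]
  have hpos : ∀ᶠ t in 𝓝[>] t₀, t₀ < t := self_mem_nhdsWithin
  have hXlim : Tendsto X (𝓝[>] t₀) (𝓝 x₀) :=
    (continuous_fst.tendsto _).comp (S.tendsto_forward h₀ hX)
  have hX0 : X t₀ = x₀ := by rw [hX t₀ le_rfl, S.flow_self x₀ h₀]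
  have ha := S.tendsto_leftTrace_forward h₀ hX
  have hb := S.tendsto_rightTrace_forward h₀ hX
  have hid : Tendsto (fun t : ℝ => t) (𝓝[>] t₀) (𝓝 t₀) := nhdsWithin_le_nhds
  have hreach : ∀ t, t₀ < t → leftEdge f φ (X t) t t₀ ≤ x₀ ∧ x₀ ≤ rightEdge f φ (X t) t t₀ := by
    intro t ht
    rw [hX t ht.le]
    exact S.reaches_flow x₀ h₀ ht.le
  -- the end points of the bases of the backward triangles at time `t₀`
  have hzL : Tendsto (fun t => leftEdge f φ (X t) t t₀) (𝓝[>] t₀) (𝓝 x₀) := by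
    have := hXlim.add ((hid.const_sub t₀).mul ((S.flux.continuous_deriv.tendsto _).comp ha))
    simpa [leftEdge, linePos] using this
  have hzR : Tendsto (fun t => rightEdge f φ (X t) t t₀) (𝓝[>] t₀) (𝓝 x₀) := by
    have := hXlim.add ((hid.const_sub t₀).mul ((S.flux.continuous_deriv.tendsto _).comp hb))
    simpa [rightEdge, linePos] using this
  refine tendsto_shock_speed S.flux hs ha hb fun ε hε => ?_
  set K := 2 * speedBound f φ + 1 with hK
  have hK0 : 0 < K := by have := speedBound_nonneg f φ; linarith
  have e1 := S.eventually_abs_value_sub_le h₀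
    (T := {p | p.2 = t₀ ∧ p.1 < x₀}) (w := vmax f φ x₀ t₀) (S.maximizersTendsto_vmax h₀
      nhdsWithin_le_nhds (by
        filter_upwards [self_mem_nhdsWithin] with p hp v hv
        obtain ⟨hp1, hp2⟩ := hp
        exact S.linePos_le hv (S.isGreatest_vmax x₀ h₀).1 le_rfl h₀ h₀.le hp1.ge le_rfl
          (by rw [linePos_self x₀, ← hp1, linePos_self]; exact hp2)))
    hzL (tendsto_const_nhds (x := x₀)) (tendsto_const_nhds (x := t₀))
    (hpos.mono fun t ht => (hreach t ht).1) (Eventually.of_forall fun t y hy => ⟨rfl, hy.2⟩)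
    (div_pos hε hK0)
  have e2 := S.eventually_abs_value_sub_le h₀
    (T := {p | p.2 = t₀ ∧ x₀ < p.1}) (w := vmin f φ x₀ t₀) (S.maximizersTendsto_vmin h₀
      nhdsWithin_le_nhds (by
        filter_upwards [self_mem_nhdsWithin] with p hp v hv
        obtain ⟨hp1, hp2⟩ := hp
        exact S.linePos_le (S.isLeast_vmin x₀ h₀).1 hv le_rfl h₀ h₀.le le_rfl hp1.ge
          (by rw [linePos_self x₀, ← hp1, linePos_self]; exact hp2)))
    (tendsto_const_nhds (x := x₀)) hzR (tendsto_const_nhds (x := t₀))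
    (hpos.mono fun t ht => (hreach t ht).2) (Eventually.of_forall fun t y hy => ⟨rfl, hy.1⟩)
    (div_pos hε hK0)
  filter_upwards [hpos, e1, e2] with t ht h1 h2
  have ht0 := h₀.trans ht
  have hδ : 0 < t - t₀ := sub_pos.2 ht
  have hm1 := (S.isGreatest_vmax (X t) ht0).1
  have hm2 := (S.isLeast_vmin (X t) ht0).1
  have v1 := S.value_eq_linePos h₀ ht.le hm1
  have v2 := S.value_eq_linePos h₀ ht.le hm2
  have s1 := (abs_le.1 (S.abs_speed_le ht0 hm1))
  have s2 := (abs_le.1 (S.abs_speed_le ht0 hm2))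
  change value f φ (X t) t = value f φ (leftEdge f φ (X t) t t₀) t₀ + _ at v1
  change value f φ (X t) t = value f φ (rightEdge f φ (X t) t t₀) t₀ + _ at v2
  set a := vmax f φ (X t) t
  set b := vmin f φ (X t) t
  have hσ : (t - t₀) * slope X t₀ t = X t - x₀ := by
    rw [slope_def_field, hX0]; field_simp
  have hL : leftEdge f φ (X t) t t₀ = X t + (t₀ - t) * deriv f a := rfl
  have hR : rightEdge f φ (X t) t t₀ = X t + (t₀ - t) * deriv f b := rfl
  set σ := slope X t₀ t
  have d1 : x₀ - leftEdge f φ (X t) t t₀ = (t - t₀) * (deriv f a - σ) := by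
    rw [hL]; linarith
  have d2 : rightEdge f φ (X t) t t₀ - x₀ = (t - t₀) * (σ - deriv f b) := by
    rw [hR]; linarith
  rw [d1] at h1
  rw [d2] at h2
  have h3 := abs_add_le
    (value f φ x₀ t₀ - value f φ (leftEdge f φ (X t) t t₀) t₀ -
      vmax f φ x₀ t₀ * ((t - t₀) * (deriv f a - σ)))
    (value f φ (rightEdge f φ (X t) t t₀) t₀ - value f φ x₀ t₀ -
      vmin f φ x₀ t₀ * ((t - t₀) * (σ - deriv f b)))
  have h4 : (value f φ x₀ t₀ - value f φ (leftEdge f φ (X t) t t₀) t₀ -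
      vmax f φ x₀ t₀ * ((t - t₀) * (deriv f a - σ))) +
      (value f φ (rightEdge f φ (X t) t t₀) t₀ - value f φ x₀ t₀ -
      vmin f φ x₀ t₀ * ((t - t₀) * (σ - deriv f b))) =
      (t - t₀) * (legendre f a - legendre f b - vmax f φ x₀ t₀ * (deriv f a - σ) -
        vmin f φ x₀ t₀ * (σ - deriv f b)) := by
    linear_combination v1 - v2
  rw [h4, abs_mul, abs_of_pos hδ] at h3
  have h5 : (t - t₀) * |legendre f a - legendre f b - vmax f φ x₀ t₀ * (deriv f a - σ) -
      vmin f φ x₀ t₀ * (σ - deriv f b)| ≤ (t - t₀) * (ε / K * (deriv f a - deriv f b)) := by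
    linarith
  refine (le_of_mul_le_mul_left h5 hδ).trans ?_
  rw [div_mul_eq_mul_div, div_le_iff₀ hK0]
  exact mul_le_mul_of_nonneg_left (by linarith [s1.2, s2.1]) hε.le

end IsLaxSolution

/-! ### Centered compression waves -/

/-- If all the velocities between `a` and `b` are maximizers at `(x₀, t₀)`, then all the competitors
have the same cost, and differentiation of this identity determines the data. -/
theorem FluxData.ae_data_of_Icc_subset (S : FluxData f φ) {x₀ t₀ a b : ℝ} (h₀ : 0 < t₀)
    (hab : a < b) (hsub : Icc a b ⊆ maximizers f φ x₀ t₀) :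
    ∀ᵐ y, y ∈ Icc (x₀ - t₀ * deriv f b) (x₀ - t₀ * deriv f a) →
      deriv f (φ y) = (x₀ - y) / t₀ := by
  have hend : ∀ᵐ y, y ≠ x₀ - t₀ * deriv f b := by simp [ae_iff]
  filter_upwards [_root_.LocallyIntegrable.ae_hasDerivAt_integral S.locallyIntegrable,
    hend] with y hy hyb hmem
  have hd : HasDerivAt (primitive φ) (φ y) y := hy 0
  obtain ⟨v, hv, hdv⟩ := S.flux.exists_deriv_eq (p := (x₀ - y) / t₀) hab.le
    (by rw [le_div_iff₀ h₀]; linarith [hmem.2]) (by rw [div_le_iff₀ h₀]; linarith [hmem.1])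
  have hyv : x₀ - t₀ * deriv f v = y := by rw [hdv, mul_div_cancel₀ _ h₀.ne']; ring
  have hvb : v < b := lt_of_le_of_ne hv.2 fun h => hyb (by rw [← hyv, h])
  rw [← hdv]
  congr 1
  set g : ℝ → ℝ := fun m => x₀ - t₀ * deriv f m with hg
  have hgc : Continuous g := by
    have := S.flux.continuous_deriv
    fun_prop
  have hglim : Tendsto g (𝓝[>] v) (𝓝[≠] y) := by
    refine tendsto_nhdsWithin_iff.2 ⟨?_, ?_⟩
    · rw [← hyv]; exact (hgc.tendsto v).mono_left nhdsWithin_le_nhds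
    · filter_upwards [self_mem_nhdsWithin] with m hm
      have := mul_lt_mul_of_pos_left (S.flux.strictMono (mem_Ioi.1 hm)) h₀
      simp only [mem_compl_iff, mem_singleton_iff, hg]
      linarith
  have hs := (hasDerivAt_iff_tendsto_slope.1 hd).comp hglim
  have hbound : ∀ᶠ m in 𝓝[>] v, v ≤ slope (primitive φ) y (g m) ∧
      slope (primitive φ) y (g m) ≤ m := by
    filter_upwards [Ioo_mem_nhdsGT hvb] with m hm
    have hlt := S.flux.strictMono hm.1
    have hneg : g m - y < 0 := by
      have := mul_lt_mul_of_pos_left hlt h₀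
      simp only [hg]
      linarith
    have e1 := (S.mem_maximizers h₀).1 (hsub hv) m
    have e2 := (S.mem_maximizers h₀).1 (hsub ⟨hv.1.trans hm.1.le, hm.2.le⟩) v
    unfold cost at e1 e2
    rw [hyv] at e1 e2
    change _ ≤ primitive φ (g m) + _ at e1
    change primitive φ (g m) + _ ≤ _ at e2
    have l1 := mul_le_mul_of_nonneg_left (S.flux.legendre_le v m) h₀.le
    have l2 := mul_le_mul_of_nonneg_left (S.flux.legendre_le m v) h₀.le
    have d1 : g m - y = -(t₀ * (deriv f m - deriv f v)) := by rw [← hyv, hg]; ring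
    rw [slope_def_field, le_div_iff_of_neg hneg, div_le_iff_of_neg hneg, d1]
    constructor <;> nlinarith
  have hid : Tendsto (fun m : ℝ => m) (𝓝[>] v) (𝓝 v) := nhdsWithin_le_nhds
  exact tendsto_nhds_unique hs (tendsto_of_tendsto_of_tendsto_of_le_of_le' tendsto_const_nhds hid
    (hbound.mono fun m hm => hm.1) (hbound.mono fun m hm => hm.2))

/-! ### Shocks arriving at a point -/

/-- A continuous function without zeros which is negative at one point of an interval is negative
on the interval. -/
theorem neg_of_ne_zero {g : ℝ → ℝ} {a b t r : ℝ} (hg : ContinuousOn g (Ioo a b))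
    (h0 : ∀ x ∈ Ioo a b, g x ≠ 0) (ht : t ∈ Ioo a b) (hneg : g t < 0) (hr : r ∈ Ioo a b) :
    g r < 0 := by
  by_contra! hle
  obtain ⟨z, hz, hz0⟩ := isPreconnected_Ioo.intermediate_value ht hr hg ⟨hneg.le, hle⟩
  exact h0 z hz hz0

theorem le_of_mem_of_isGap {x₀ t₀ c d v : ℝ} (hg : IsGap (maximizers f φ x₀ t₀) c d)
    (hv : v ∈ maximizers f φ x₀ t₀) (hcv : c < v) : d ≤ v := by
  by_contra! hvd
  exact disjoint_left.1 hg.2.2.2 ⟨hcv, hvd⟩ hv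

namespace IsLaxSolution

variable {x₀ t₀ s : ℝ} {γ : ℝ → ℝ}

theorem vmin_lt_vmax_of_arriving (S : IsLaxSolution f φ u) (hγ : IsArrivingShock u x₀ t₀ s γ)
    {r : ℝ} (hr : r ∈ Ioo s t₀) : vmin f φ (γ r) r < vmax f φ (γ r) r :=
  (S.mem_shockSet.1 (hγ.2.2.2.2 r hr)).2

theorem reaches_of_arriving (S : IsLaxSolution f φ u) (hγ : IsArrivingShock u x₀ t₀ s γ)
    {r t : ℝ} (hr : r ∈ Ioo s t₀) (hrt : r ≤ t) (ht : t ≤ t₀) :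
    Reaches f φ (γ r) r (γ t) t := by
  have hr0 : 0 < r := hγ.1.trans_lt hr.1
  have h1 := S.flow_eq_of_curve hr0 hrt
    (hγ.2.2.1.mono (Icc_subset_Icc hr.1.le ht)) fun q hq =>
      S.vmin_lt_vmax_of_arriving hγ ⟨hr.1.trans_le hq.1, hq.2.trans_le ht⟩
  rw [← h1]
  exact S.reaches_flow _ hr0 hrt

theorem ne_linePos_of_arriving (S : IsLaxSolution f φ u) (hγ : IsArrivingShock u x₀ t₀ s γ)
    {r v : ℝ} (hr : r ∈ Ioo s t₀) (hv : v ∈ maximizers f φ x₀ t₀) :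
    γ r ≠ linePos f x₀ t₀ v r := by
  intro h
  have h1 := S.maximizers_linePos hv (hγ.1.trans_lt hr.1) hr.2
  have h2 := S.vmin_lt_vmax_of_arriving hγ hr
  rw [h, vmin_eq_of_singleton h1, vmax_eq_of_singleton h1] at h2
  exact h2.false

theorem continuousOn_sub_linePos (hγ : IsArrivingShock u x₀ t₀ s γ) (v : ℝ) :
    ContinuousOn (fun r => γ r - linePos f x₀ t₀ v r) (Ioo s t₀) :=
  (hγ.2.2.1.mono Ioo_subset_Icc_self).sub (continuous_linePos _ _ _).continuousOn

/-- A shock arriving at `(x₀, t₀)` cannot cross the characteristics to this point, so that it runs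
in the fan over one gap of `𝒰(x₀, t₀)`. -/
theorem exists_gap_of_arriving (S : IsLaxSolution f φ u) (h₀ : 0 < t₀)
    (hγ : IsArrivingShock u x₀ t₀ s γ) :
    ∃ c d, IsGap (maximizers f φ x₀ t₀) c d ∧ RunsInFan f c d x₀ t₀ s γ := by
  obtain ⟨t, ht⟩ := exists_between hγ.2.1
  have ht0 : 0 < t := hγ.1.trans_lt ht.1
  have hmax := S.isGreatest_vmax x₀ h₀
  have hmin := S.isLeast_vmin x₀ h₀
  have hreach := S.reaches_of_arriving hγ ht ht.2.le le_rfl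
  rw [hγ.2.2.2.1] at hreach
  obtain ⟨-, -, w, hw, hγw⟩ := (mem_fan_Icc S.flux (S.vmin_le_vmax x₀ h₀) (p := (γ t, t))).2
    ⟨ht0, ht.2, hreach.1, hreach.2⟩
  have hγw : γ t = linePos f x₀ t₀ w t := hγw
  have hwn : w ∉ maximizers f φ x₀ t₀ := fun h => S.ne_linePos_of_arriving hγ ht h hγw
  obtain ⟨c, d, hg, hwg⟩ := exists_isGap (S.isClosed_maximizers x₀ h₀) hmin.1 hmax.1 hw.1 hw.2 hwn
  refine ⟨c, d, hg, fun r hr => (mem_fan_Ioo S.flux hg.1.le).2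
    ⟨hγ.1.trans_lt hr.1, hr.2, ?_, ?_⟩⟩
  · have h1 := neg_of_ne_zero (continuousOn_sub_linePos (f := f) hγ d).neg
      (fun q hq => by
        have := S.ne_linePos_of_arriving hγ hq hg.2.2.1
        rw [Pi.neg_apply, neg_ne_zero, sub_ne_zero]; exact this) ht
      (by
        have := (linePos_lt_linePos_iff S.flux (x := x₀) ht.2).2 hwg.2
        rw [Pi.neg_apply, neg_lt_zero, sub_pos, hγw]; exact this) hr
    rw [Pi.neg_apply, neg_lt_zero, sub_pos] at h1
    exact h1
  · have h1 := neg_of_ne_zero (continuousOn_sub_linePos (f := f) hγ c)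
      (fun q hq => sub_ne_zero.2 (S.ne_linePos_of_arriving hγ hq hg.2.1)) ht
      (by
        have := (linePos_lt_linePos_iff S.flux (x := x₀) ht.2).2 hwg.1
        rw [sub_neg, hγw]; exact this) hr
    exact sub_neg.1 h1

/-- The gap is unique because the fans over different gaps are disjoint. -/
theorem gap_of_shock (S : IsLaxSolution f φ u) (h₀ : 0 < t₀)
    (hγ : IsArrivingShock u x₀ t₀ s γ) :
    ∃! J : ℝ × ℝ, IsGap (maximizers f φ x₀ t₀) J.1 J.2 ∧ RunsInFan f J.1 J.2 x₀ t₀ s γ := by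
  obtain ⟨c, d, hg, hrun⟩ := S.exists_gap_of_arriving h₀ hγ
  refine ⟨(c, d), ⟨hg, hrun⟩, ?_⟩
  rintro ⟨c', d'⟩ ⟨hg', hrun'⟩
  obtain ⟨t, ht⟩ := exists_between hγ.2.1
  obtain ⟨-, -, v, hv, h1⟩ := hrun t ht
  obtain ⟨-, -, v', hv', h2⟩ := hrun' t ht
  have hvv : v = v' := by
    refine le_antisymm ?_ ?_
    · by_contra! hlt
      exact ((linePos_lt_linePos_iff S.flux (x := x₀) ht.2).2 hlt).ne (h1.symm.trans h2)
    · by_contra! hlt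
      exact ((linePos_lt_linePos_iff S.flux (x := x₀) ht.2).2 hlt).ne (h2.symm.trans h1)
  rw [← hvv] at hv'
  obtain ⟨h3, h4⟩ := hg'.eq_of_mem hg hv' hv
  exact Prod.ext h3 h4

/-- Every gap `(c, d)` of `𝒰(x₀, t₀)` is the gap of a shock: the forward characteristic of a point
inside the fan stays in the fan up to `(x₀, t₀)`.  It must become a shock before, for otherwise the
limit of its velocities would be a maximizer in the gap. -/
theorem shock_of_gap (S : IsLaxSolution f φ u) (h₀ : 0 < t₀) {c d : ℝ}
    (hg : IsGap (maximizers f φ x₀ t₀) c d) :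
    ∃ s γ, IsArrivingShock u x₀ t₀ s γ ∧ RunsInFan f c d x₀ t₀ s γ := by
  set r := t₀ / 2 with hr
  have hr0 : 0 < r := half_pos h₀
  have hrt : r < t₀ := half_lt_self h₀
  obtain ⟨y, hy1, hy2⟩ := exists_between ((linePos_lt_linePos_iff S.flux (x := x₀) hrt).2 hg.1)
  have hline : ∀ v ∈ maximizers f φ x₀ t₀, ∀ t ∈ Icc r t₀,
      flow f φ (linePos f x₀ t₀ v r) r t = linePos f x₀ t₀ v t := by
    intro v hv t ht
    have ht0 := hr0.trans_le ht.1
    have h1 := S.reaches_of_mem ht0 ht.1 (S.mem_linePos hv ht0 ht.2)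
    rw [linePos_linePos] at h1
    exact S.flow_eq hr0 ht.1 h1
  have hfan : ∀ t ∈ Ico r t₀, linePos f x₀ t₀ d t < flow f φ y r t ∧
      flow f φ y r t < linePos f x₀ t₀ c t := by
    intro t ht
    have ht0 := hr0.trans_le ht.1
    have hne : ∀ v ∈ maximizers f φ x₀ t₀, y ≠ linePos f x₀ t₀ v r →
        flow f φ y r t ≠ linePos f x₀ t₀ v t := by
      intro v hv hne heq
      have h1 := S.reaches_flow y hr0 ht.1
      rw [heq, reaches_singleton_iff (S.maximizers_linePos hv ht0 ht.2), linePos_linePos] at h1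
      exact hne h1
    constructor
    · refine lt_of_le_of_ne ?_ (hne d hg.2.2.1 hy1.ne').symm
      rw [← hline d hg.2.2.1 t ⟨ht.1, ht.2.le⟩]
      exact S.flow_mono hy1.le hr0 ht.1
    · refine lt_of_le_of_ne ?_ (hne c hg.2.1 hy2.ne)
      rw [← hline c hg.2.1 t ⟨ht.1, ht.2.le⟩]
      exact S.flow_mono hy2.le hr0 ht.1
  have hend : flow f φ y r t₀ = x₀ := by
    refine le_antisymm ?_ ?_
    · have h1 := S.flow_mono hy2.le hr0 hrt.le
      rwa [hline c hg.2.1 t₀ ⟨hrt.le, le_rfl⟩, linePos_self] at h1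
    · have h1 := S.flow_mono hy1.le hr0 hrt.le
      rwa [hline d hg.2.2.1 t₀ ⟨hrt.le, le_rfl⟩, linePos_self] at h1
  have hcont := S.continuousOn_flow_time y hr0
  -- the characteristic becomes a shock
  have hshock : ∃ t₁ ∈ Ioo r t₀, vmin f φ (flow f φ y r t₁) t₁ < vmax f φ (flow f φ y r t₁) t₁ := by
    have hC : IsClosed {q : (ℝ × ℝ) × ℝ | linePos f q.1.1 q.1.2 q.2 r = y} := by
      have := S.flux.continuous_deriv
      unfold linePos
      exact isClosed_eq (by fun_prop) continuous_const
    have hev := S.eventually_notMem h₀ hC (x := x₀) fun v hv hvy => by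
      have hvy : linePos f x₀ t₀ v r = y := hvy
      rw [← hvy] at hy1 hy2
      exact disjoint_left.1 hg.2.2.2 ⟨(linePos_lt_linePos_iff S.flux hrt).1 hy2,
        (linePos_lt_linePos_iff S.flux hrt).1 hy1⟩ hv
    have hlim : Tendsto (fun t => (flow f φ y r t, t)) (𝓝[<] t₀) (𝓝 (x₀, t₀)) := by
      refine Tendsto.prodMk_nhds ?_ nhdsWithin_le_nhds
      have h1 := hcont t₀ hrt.le
      rw [ContinuousWithinAt, hend] at h1
      refine h1.mono_left ?_
      rw [nhdsWithin_le_iff]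
      filter_upwards [Ioo_mem_nhdsLT hrt] with t ht using ht.1.le
    obtain ⟨t, ht1, ht2⟩ := ((hlim.eventually hev).and (Ioo_mem_nhdsLT hrt)).exists
    have ht0 := hr0.trans ht2.1
    refine ⟨t, ht2, ?_⟩
    by_contra! hle
    have hsing := S.eq_singleton ht0 hle
    have h2 := S.reaches_flow y hr0 ht2.1.le
    rw [reaches_singleton_iff hsing] at h2
    exact ht1 (vmin f φ (flow f φ y r t) t) (hsing ▸ rfl) h2.symm
  obtain ⟨t₁, ht₁, hs₁⟩ := hshock
  have ht₁0 := hr0.trans ht₁.1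
  refine ⟨t₁, flow f φ y r, ⟨ht₁0.le, ht₁.2, hcont.mono fun t ht => ht₁.1.le.trans ht.1, hend,
    fun t ht => S.mem_shockSet.2 ⟨ht₁0.trans ht.1, ?_⟩⟩, fun t ht => ?_⟩
  · refine S.vmin_lt_vmax_of_reaches ht₁0 ht.1.le ?_ hs₁
    change Reaches f φ (flow f φ y r t₁) t₁ (flow f φ y r t) t
    rw [← S.flow_flow y hr0 ht₁.1.le ht.1.le]
    exact S.reaches_flow _ ht₁0 ht.1.le
  · exact (mem_fan_Ioo S.flux hg.1.le).2
      ⟨ht₁0.trans ht.1, ht.2, hfan t ⟨(ht₁.1.trans ht.1).le, ht.2⟩⟩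

/-- Two shocks running in the fan over the same gap meet before they reach the vertex: otherwise the
characteristics between them would converge to a maximizer in the gap. -/
theorem exists_eq_of_runsInFan (S : IsLaxSolution f φ u) (h₀ : 0 < t₀) {c d : ℝ}
    (hg : IsGap (maximizers f φ x₀ t₀) c d) {s₁ s₂ : ℝ} {γ₁ γ₂ : ℝ → ℝ}
    (h₁ : IsArrivingShock u x₀ t₀ s₁ γ₁) (hr₁ : RunsInFan f c d x₀ t₀ s₁ γ₁)
    (h₂ : IsArrivingShock u x₀ t₀ s₂ γ₂) (hr₂ : RunsInFan f c d x₀ t₀ s₂ γ₂) {r : ℝ}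
    (hrs₁ : r ∈ Ioo s₁ t₀) (hrs₂ : r ∈ Ioo s₂ t₀) (hlt : γ₁ r < γ₂ r) :
    ∃ t ∈ Ioo r t₀, γ₁ t = γ₂ t := by
  by_contra! hne
  have hr0 : 0 < r := h₁.1.trans_lt hrs₁.1
  have hsub : Ico r t₀ ⊆ Icc s₁ t₀ ∩ Icc s₂ t₀ := fun t ht =>
    ⟨⟨hrs₁.1.le.trans ht.1, ht.2.le⟩, ⟨hrs₂.1.le.trans ht.1, ht.2.le⟩⟩
  have hltt : ∀ t ∈ Ioo r t₀, γ₁ t < γ₂ t := by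
    intro t ht
    by_contra! hle
    have hcont : ContinuousOn (fun t => γ₂ t - γ₁ t) (Ico r t₀) :=
      (h₂.2.2.1.mono fun t ht => (hsub ht).2).sub (h₁.2.2.1.mono fun t ht => (hsub ht).1)
    obtain ⟨z, hz, hz0⟩ := isPreconnected_Ico.intermediate_value
      (⟨ht.1.le, ht.2⟩ : t ∈ Ico r t₀) (⟨le_rfl, hrs₁.2⟩ : r ∈ Ico r t₀) hcont
      (show (0 : ℝ) ∈ Icc (γ₂ t - γ₁ t) (γ₂ r - γ₁ r) from ⟨by linarith, by linarith⟩)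
    have hz0 : γ₁ z = γ₂ z := by linarith [hz0]
    rcases hz.1.eq_or_lt with rfl | hrz
    · exact hlt.ne hz0
    · exact hne z ⟨hrz, hz.2⟩ hz0
  have hfan₁ := (mem_fan_Ioo S.flux hg.1.le).1 (hr₁ r hrs₁)
  have hfan₂ := (mem_fan_Ioo S.flux hg.1.le).1 (hr₂ r hrs₂)
  have hev := S.eventually_notMem h₀ (x := x₀)
    ((isClosed_le_linePos S.flux r (γ₁ r)).inter (isClosed_linePos_le S.flux r (γ₂ r)))
    fun v hv hvC => by
      have hv1 : γ₁ r ≤ linePos f x₀ t₀ v r := hvC.1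
      have hv2 : linePos f x₀ t₀ v r ≤ γ₂ r := hvC.2
      exact disjoint_left.1 hg.2.2.2
        ⟨(linePos_lt_linePos_iff S.flux hrs₁.2).1 (hv2.trans_lt hfan₂.2.2.2),
          (linePos_lt_linePos_iff S.flux hrs₁.2).1 (hfan₁.2.2.1.trans_le hv1)⟩ hv
  have hlim : Tendsto (fun t => (γ₁ t, t)) (𝓝[<] t₀) (𝓝 (x₀, t₀)) := by
    refine Tendsto.prodMk_nhds ?_ nhdsWithin_le_nhds
    have := h₁.2.2.1 t₀ ⟨h₁.2.1.le, le_rfl⟩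
    rw [ContinuousWithinAt, h₁.2.2.2.1] at this
    refine this.mono_left ?_
    rw [nhdsWithin_le_iff]
    filter_upwards [Ioo_mem_nhdsLT h₁.2.1] with t ht using ⟨ht.1.le, ht.2.le⟩
  obtain ⟨t, ht1, ht2⟩ := ((hlim.eventually hev).and (Ioo_mem_nhdsLT hrs₁.2)).exists
  have ht0 := hr0.trans ht2.1
  have hm1 := (S.isLeast_vmin (γ₁ t) ht0).1
  have hm2 := (S.isGreatest_vmax (γ₂ t) ht0).1
  refine ht1 _ hm1 ⟨(S.reaches_of_arriving h₁ hrs₁ ht2.1.le ht2.2.le).2, ?_⟩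
  refine (S.linePos_lt hm1 hm2 hr0 ht2.1.le le_rfl le_rfl ?_).le.trans
    (S.reaches_of_arriving h₂ hrs₂ ht2.1.le ht2.2.le).1
  rw [linePos_self, linePos_self]
  exact hltt t ht2

/-- Once two shocks have met they follow the same forward characteristic. -/
theorem shock_of_gap_unique (S : IsLaxSolution f φ u) (h₀ : 0 < t₀) {c d : ℝ}
    (hg : IsGap (maximizers f φ x₀ t₀) c d) {s₁ s₂ : ℝ} {γ₁ γ₂ : ℝ → ℝ}
    (h₁ : IsArrivingShock u x₀ t₀ s₁ γ₁) (hr₁ : RunsInFan f c d x₀ t₀ s₁ γ₁)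
    (h₂ : IsArrivingShock u x₀ t₀ s₂ γ₂) (hr₂ : RunsInFan f c d x₀ t₀ s₂ γ₂) :
    ∃ s, s < t₀ ∧ ∀ t ∈ Icc s t₀, γ₁ t = γ₂ t := by
  obtain ⟨r, hr1, hr2⟩ := exists_between (max_lt h₁.2.1 h₂.2.1)
  have hrs₁ : r ∈ Ioo s₁ t₀ := ⟨(le_max_left _ _).trans_lt hr1, hr2⟩
  have hrs₂ : r ∈ Ioo s₂ t₀ := ⟨(le_max_right _ _).trans_lt hr1, hr2⟩
  have hmeet : ∃ t ∈ Ico r t₀, γ₁ t = γ₂ t := by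
    rcases lt_trichotomy (γ₁ r) (γ₂ r) with h | h | h
    · obtain ⟨t, ht, he⟩ := S.exists_eq_of_runsInFan h₀ hg h₁ hr₁ h₂ hr₂ hrs₁ hrs₂ h
      exact ⟨t, ⟨ht.1.le, ht.2⟩, he⟩
    · exact ⟨r, ⟨le_rfl, hr2⟩, h⟩
    · obtain ⟨t, ht, he⟩ := S.exists_eq_of_runsInFan h₀ hg h₂ hr₂ h₁ hr₁ hrs₂ hrs₁ h
      exact ⟨t, ⟨ht.1.le, ht.2⟩, he.symm⟩
  obtain ⟨q, hq, he⟩ := hmeet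
  refine ⟨q, hq.2, fun t ht => ?_⟩
  have hq0 : 0 < q := (h₁.1.trans_lt hrs₁.1).trans_le hq.1
  have e1 := S.reaches_of_arriving h₁ ⟨hrs₁.1.trans_le hq.1, hq.2⟩ ht.1 ht.2
  have e2 := S.reaches_of_arriving h₂ ⟨hrs₂.1.trans_le hq.1, hq.2⟩ ht.1 ht.2
  rw [he] at e1
  exact S.reaches_unique hq0 ht.1 e1 e2

end IsLaxSolution

/-! ### Limits and slopes along an arriving shock -/

/-- A maximizer at the vertex of the fan over the gap `(c, d)` is `d` if its characteristic passes on
the left of some point `(K, r)` inside the right edge of the fan, but not on the left of the fan. -/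
theorem FluxData.eq_right_of_gap (S : FluxData f φ) {x₀ t₀ c d r K v : ℝ}
    (hg : IsGap (maximizers f φ x₀ t₀) c d) (hr : r < t₀) (hK : K < linePos f x₀ t₀ c r)
    (hv : v ∈ maximizers f φ x₀ t₀) (h1 : linePos f x₀ t₀ v r ≤ K)
    (h2 : linePos f x₀ t₀ d r ≤ linePos f x₀ t₀ v r) : v = d := by
  refine le_antisymm ?_
    (le_of_mem_of_isGap hg hv ((linePos_lt_linePos_iff S.flux hr).1 (h1.trans_lt hK)))
  by_contra! hlt
  exact ((linePos_lt_linePos_iff S.flux hr).2 hlt).not_ge h2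

theorem FluxData.eq_left_of_gap (S : FluxData f φ) {x₀ t₀ c d r K v : ℝ}
    (hg : IsGap (maximizers f φ x₀ t₀) c d) (hr : r < t₀) (hK : linePos f x₀ t₀ d r < K)
    (hv : v ∈ maximizers f φ x₀ t₀) (h1 : K ≤ linePos f x₀ t₀ v r)
    (h2 : linePos f x₀ t₀ v r ≤ linePos f x₀ t₀ c r) : v = c := by
  have hvd : v < d := (linePos_lt_linePos_iff S.flux hr).1 (hK.trans_le h1)
  refine le_antisymm (not_lt.1 fun hlt => (le_of_mem_of_isGap hg hv hlt).not_gt hvd) ?_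
  by_contra! hlt
  exact ((linePos_lt_linePos_iff S.flux hr).2 hlt).not_ge h2

namespace IsLaxSolution

variable {x₀ t₀ s c d : ℝ} {γ : ℝ → ℝ}

theorem tendsto_arriving (hγ : IsArrivingShock u x₀ t₀ s γ) :
    Tendsto γ (𝓝[<] t₀) (𝓝 x₀) := by
  have h := hγ.2.2.1 t₀ ⟨hγ.2.1.le, le_rfl⟩
  rw [ContinuousWithinAt, hγ.2.2.2.1] at h
  refine h.mono_left ?_
  rw [nhdsWithin_le_iff]
  filter_upwards [Ioo_mem_nhdsLT hγ.2.1] with t ht using ⟨ht.1.le, ht.2.le⟩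

/-- On the left of an arriving shock inside the fan, the backward characteristics run between the
left edge of the fan and the shock, so that `FluxData.eq_right_of_gap` applies to their limits. -/
theorem maximizersTendsto_left_of_arriving (S : IsLaxSolution f φ u) (h₀ : 0 < t₀)
    (hg : IsGap (maximizers f φ x₀ t₀) c d) (hγ : IsArrivingShock u x₀ t₀ s γ)
    (hrun : RunsInFan f c d x₀ t₀ s γ) :
    MaximizersTendsto f φ
      (𝓝[{p | p ∈ fan f (Ioo c d) x₀ t₀ ∧ s < p.2 ∧ p.1 < γ p.2}] (x₀, t₀)) d := by
  obtain ⟨r, hr⟩ := exists_between hγ.2.1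
  have hfr := (mem_fan_Ioo S.flux hg.1.le).1 (hrun r hr)
  refine S.maximizersTendsto h₀ nhdsWithin_le_nhds
    ((isClosed_linePos_le S.flux r (γ r)).inter
      (isClosed_le_linePos S.flux r (linePos f x₀ t₀ d r))) ?_ fun v hv hvC =>
    S.eq_right_of_gap hg hr.2 hfr.2.2.2 hv hvC.1 hvC.2
  have hev : ∀ᶠ p : ℝ × ℝ in 𝓝 (x₀, t₀), r < p.2 :=
    (continuous_snd.continuousAt (x := (x₀, t₀))).eventually (lt_mem_nhds hr.2)
  filter_upwards [self_mem_nhdsWithin, nhdsWithin_le_nhds hev] with p hp hrp v hv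
  obtain ⟨hpf, -, hpγ⟩ := hp
  rw [mem_fan_Ioo S.flux hg.1.le] at hpf
  have hr0 : 0 < r := hfr.1
  constructor
  · refine (S.linePos_lt hv (S.isGreatest_vmax (γ p.2) hpf.1).1 hr0 hrp.le le_rfl le_rfl ?_).le.trans
      (S.reaches_of_arriving hγ hr hrp.le hpf.2.1.le).1
    rw [linePos_self, linePos_self]
    exact hpγ
  · refine (S.linePos_lt hg.2.2.1 hv hr0 hrp.le hpf.2.1.le le_rfl ?_).le
    rw [linePos_self p.1]
    exact hpf.2.2.1

theorem maximizersTendsto_right_of_arriving (S : IsLaxSolution f φ u) (h₀ : 0 < t₀)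
    (hg : IsGap (maximizers f φ x₀ t₀) c d) (hγ : IsArrivingShock u x₀ t₀ s γ)
    (hrun : RunsInFan f c d x₀ t₀ s γ) :
    MaximizersTendsto f φ
      (𝓝[{p | p ∈ fan f (Ioo c d) x₀ t₀ ∧ s < p.2 ∧ γ p.2 < p.1}] (x₀, t₀)) c := by
  obtain ⟨r, hr⟩ := exists_between hγ.2.1
  have hfr := (mem_fan_Ioo S.flux hg.1.le).1 (hrun r hr)
  refine S.maximizersTendsto h₀ nhdsWithin_le_nhds
    ((isClosed_le_linePos S.flux r (γ r)).inter
      (isClosed_linePos_le S.flux r (linePos f x₀ t₀ c r))) ?_ fun v hv hvC =>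
    S.eq_left_of_gap hg hr.2 hfr.2.2.1 hv hvC.1 hvC.2
  have hev : ∀ᶠ p : ℝ × ℝ in 𝓝 (x₀, t₀), r < p.2 :=
    (continuous_snd.continuousAt (x := (x₀, t₀))).eventually (lt_mem_nhds hr.2)
  filter_upwards [self_mem_nhdsWithin, nhdsWithin_le_nhds hev] with p hp hrp v hv
  obtain ⟨hpf, -, hpγ⟩ := hp
  rw [mem_fan_Ioo S.flux hg.1.le] at hpf
  have hr0 : 0 < r := hfr.1
  constructor
  · refine (S.reaches_of_arriving hγ hr hrp.le hpf.2.1.le).2.trans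
      (S.linePos_lt (S.isLeast_vmin (γ p.2) hpf.1).1 hv hr0 hrp.le le_rfl le_rfl ?_).le
    rw [linePos_self, linePos_self]
    exact hpγ
  · refine (S.linePos_lt hv hg.2.1 hr0 hrp.le le_rfl hpf.2.1.le ?_).le
    rw [linePos_self p.1]
    exact hpf.2.2.2

theorem tendsto_traces_arriving (S : IsLaxSolution f φ u) (h₀ : 0 < t₀)
    (hg : IsGap (maximizers f φ x₀ t₀) c d) (hγ : IsArrivingShock u x₀ t₀ s γ)
    (hrun : RunsInFan f c d x₀ t₀ s γ) :
    Tendsto (fun t => vmax f φ (γ t) t) (𝓝[<] t₀) (𝓝 d) ∧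
      Tendsto (fun t => vmin f φ (γ t) t) (𝓝[<] t₀) (𝓝 c) := by
  obtain ⟨r, hr⟩ := exists_between hγ.2.1
  have hfr := (mem_fan_Ioo S.flux hg.1.le).1 (hrun r hr)
  have hlim : Tendsto (fun t => (γ t, t)) (𝓝[<] t₀) (𝓝 (x₀, t₀)) :=
    (tendsto_arriving hγ).prodMk_nhds nhdsWithin_le_nhds
  constructor
  · refine S.tendsto_selection h₀ hlim ((isClosed_linePos_le S.flux r (γ r)).inter
      (isClosed_le_linePos S.flux r (linePos f x₀ t₀ d r))) ?_ fun v hv hvC =>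
      S.eq_right_of_gap hg hr.2 hfr.2.2.2 hv hvC.1 hvC.2
    filter_upwards [Ioo_mem_nhdsLT hr.2] with t ht
    have ht0 := hfr.1.trans ht.1
    have hm := (S.isGreatest_vmax (γ t) ht0).1
    refine ⟨hm, (S.reaches_of_arriving hγ hr ht.1.le ht.2.le).1, ?_⟩
    refine (S.linePos_lt hg.2.2.1 hm hfr.1 ht.1.le ht.2.le le_rfl ?_).le
    rw [linePos_self (γ t)]
    exact ((mem_fan_Ioo S.flux hg.1.le).1 (hrun t ⟨hr.1.trans ht.1, ht.2⟩)).2.2.1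
  · refine S.tendsto_selection h₀ hlim ((isClosed_le_linePos S.flux r (γ r)).inter
      (isClosed_linePos_le S.flux r (linePos f x₀ t₀ c r))) ?_ fun v hv hvC =>
      S.eq_left_of_gap hg hr.2 hfr.2.2.1 hv hvC.1 hvC.2
    filter_upwards [Ioo_mem_nhdsLT hr.2] with t ht
    have ht0 := hfr.1.trans ht.1
    have hm := (S.isLeast_vmin (γ t) ht0).1
    refine ⟨hm, (S.reaches_of_arriving hγ hr ht.1.le ht.2.le).2, ?_⟩
    refine (S.linePos_lt hm hg.2.1 hfr.1 ht.1.le le_rfl ht.2.le ?_).le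
    rw [linePos_self (γ t)]
    exact ((mem_fan_Ioo S.flux hg.1.le).1 (hrun t ⟨hr.1.trans ht.1, ht.2⟩)).2.2.2

/-- A shock arrives at the vertex of the fan over the gap `(c, d)` with the Rankine–Hugoniot speed
of the states `d` and `c`. -/
theorem hasDerivWithinAt_arriving (S : IsLaxSolution f φ u) (h₀ : 0 < t₀)
    (hg : IsGap (maximizers f φ x₀ t₀) c d) (hγ : IsArrivingShock u x₀ t₀ s γ)
    (hrun : RunsInFan f c d x₀ t₀ s γ) :
    HasDerivWithinAt γ ((f d - f c) / (d - c)) (Iic t₀) t₀ := by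
  rw [← hasDerivWithinAt_Iio_iff_Iic, hasDerivWithinAt_iff_tendsto_slope' (by simp)]
  have hid : Tendsto (fun t : ℝ => t) (𝓝[<] t₀) (𝓝 t₀) := nhdsWithin_le_nhds
  have hline : ∀ v, Tendsto (fun t => linePos f x₀ t₀ v t) (𝓝[<] t₀) (𝓝 x₀) := fun v => by
    have := ((continuous_linePos (f := f) x₀ t₀ v).tendsto t₀).mono_left
      (nhdsWithin_le_nhds (s := Iio t₀))
    rwa [linePos_self] at this
  have hmem : ∀ᶠ t in 𝓝[<] t₀, t ∈ Ioo s t₀ := Ioo_mem_nhdsLT hγ.2.1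
  have hfan : ∀ t ∈ Ioo s t₀, 0 < t ∧ linePos f x₀ t₀ d t < γ t ∧ γ t < linePos f x₀ t₀ c t :=
    fun t ht => by
      obtain ⟨h1, -, h2, h3⟩ := (mem_fan_Ioo S.flux hg.1.le).1 (hrun t ht)
      exact ⟨h1, h2, h3⟩
  refine tendsto_shock_speed S.flux hg.1 tendsto_const_nhds tendsto_const_nhds fun ε hε => ?_
  set K := deriv f d - deriv f c with hK
  have hK0 : 0 < K := sub_pos.2 (S.flux.strictMono hg.1)
  have e1 := S.eventually_abs_value_sub_le h₀ (S.maximizersTendsto_left_of_arriving h₀ hg hγ hrun)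
    (hline d) (tendsto_arriving hγ) hid (hmem.mono fun t ht => (hfan t ht).2.1.le)
    (hmem.mono fun t ht y hy => ⟨(mem_fan_Ioo S.flux hg.1.le).2
      ⟨(hfan t ht).1, ht.2, hy.1, hy.2.trans (hfan t ht).2.2⟩, ht.1, hy.2⟩) (div_pos hε hK0)
  have e2 := S.eventually_abs_value_sub_le h₀ (S.maximizersTendsto_right_of_arriving h₀ hg hγ hrun)
    (tendsto_arriving hγ) (hline c) hid (hmem.mono fun t ht => (hfan t ht).2.2.le)
    (hmem.mono fun t ht y hy => ⟨(mem_fan_Ioo S.flux hg.1.le).2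
      ⟨(hfan t ht).1, ht.2, (hfan t ht).2.1.trans hy.1, hy.2⟩, ht.1, hy.1⟩) (div_pos hε hK0)
  filter_upwards [hmem, e1, e2] with t ht h1 h2
  have ht0 := (hfan t ht).1
  have hδ : 0 < t₀ - t := sub_pos.2 ht.2
  have hne : t - t₀ ≠ 0 := (sub_neg.2 ht.2).ne
  have v1 := S.value_eq_linePos ht0 ht.2.le hg.2.2.1
  have v2 := S.value_eq_linePos ht0 ht.2.le hg.2.1
  have hσ : (t - t₀) * slope γ t₀ t = γ t - x₀ := by
    rw [slope_def_field, hγ.2.2.2.1]; field_simp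
  set σ := slope γ t₀ t
  have d1 : γ t - linePos f x₀ t₀ d t = (t₀ - t) * (deriv f d - σ) := by
    unfold linePos; linarith
  have d2 : linePos f x₀ t₀ c t - γ t = (t₀ - t) * (σ - deriv f c) := by
    unfold linePos; linarith
  rw [d1] at h1
  rw [d2] at h2
  have h3 := abs_add_le
    (value f φ (γ t) t - value f φ (linePos f x₀ t₀ d t) t - d * ((t₀ - t) * (deriv f d - σ)))
    (value f φ (linePos f x₀ t₀ c t) t - value f φ (γ t) t - c * ((t₀ - t) * (σ - deriv f c)))
  have h4 : (value f φ (γ t) t - value f φ (linePos f x₀ t₀ d t) t -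
      d * ((t₀ - t) * (deriv f d - σ))) +
      (value f φ (linePos f x₀ t₀ c t) t - value f φ (γ t) t -
      c * ((t₀ - t) * (σ - deriv f c))) =
      (t₀ - t) * (legendre f d - legendre f c - d * (deriv f d - σ) - c * (σ - deriv f c)) := by
    linear_combination v1 - v2
  rw [h4, abs_mul, abs_of_pos hδ] at h3
  have h5 : (t₀ - t) * |legendre f d - legendre f c - d * (deriv f d - σ) -
      c * (σ - deriv f c)| ≤ (t₀ - t) * ε := by
    have h6 : (t₀ - t) * ε = ε / K * ((t₀ - t) * (deriv f d - σ)) +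
        ε / K * ((t₀ - t) * (σ - deriv f c)) := by
      rw [← mul_add, ← mul_add, sub_add_sub_cancel, ← hK]; field_simp
    linarith
  exact le_of_mul_le_mul_left h5 hδ

/-! ### The structure at single points -/

theorem fineStructure (S : IsLaxSolution f φ u) {x₀ t₀ : ℝ} (h : (x₀, t₀) ∈ shockSet u) :
    FineStructure f φ u x₀ t₀ := by
  obtain ⟨h₀, hs⟩ := S.mem_shockSet.1 h
  have h₀ : 0 < t₀ := h₀
  have hl := S.leftTrace_eq x₀ h₀
  have hr := S.rightTrace_eq x₀ h₀
  exact {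
    greatest := hl ▸ S.isGreatest_vmax x₀ h₀
    least := hr ▸ S.isLeast_vmin x₀ h₀
    forward_exists := ⟨_, S.isForwardChar_flow x₀ h₀, S.isShockCurve_flow_of_mem h⟩
    forward_unique := fun X Y hX hY t ht => by
      rw [(S.isForwardChar_iff h₀).1 hX t ht, (S.isForwardChar_iff h₀).1 hY t ht]
    right_deriv := fun X hX => by
      rw [hl, hr]
      exact S.hasDerivWithinAt_forward h₀ hs ((S.isForwardChar_iff h₀).1 hX)
    forward_limits := fun X hX => by
      have hX := (S.isForwardChar_iff h₀).1 hX
      rw [hl, hr]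
      refine ⟨(S.tendsto_leftTrace_forward h₀ hX).congr' ?_,
        (S.tendsto_rightTrace_forward h₀ hX).congr' ?_,
        S.tracesTendsto (fun p hp => hp.1) (S.maximizersTendsto_leftSide h₀ hX),
        S.tracesTendsto (fun p hp => hp.1) (S.maximizersTendsto_rightSide h₀ hX)⟩
      · filter_upwards [self_mem_nhdsWithin] with t ht using
          (S.leftTrace_eq _ (h₀.trans (mem_Ioi.1 ht))).symm
      · filter_upwards [self_mem_nhdsWithin] with t ht using
          (S.rightTrace_eq _ (h₀.trans (mem_Ioi.1 ht))).symm
    backward_char := fun v hv t ht => by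
      have h1 := S.eq_of_singleton ht.1 (S.maximizers_linePos hv ht.1 ht.2)
      exact ⟨h1.1, h1.2.1⟩
    compression := fun a b hab hsub => by
      refine ⟨?_, S.ae_data_of_Icc_subset h₀ hab hsub⟩
      rintro ⟨x, t⟩ ⟨ht0, ht, v, hv, hp⟩
      have ht0 : 0 < t := ht0
      have ht : t < t₀ := ht
      have hp : x = linePos f x₀ t₀ v t := hp
      have h1 := (S.eq_of_singleton ht0
        (S.maximizers_linePos (hsub (Ioo_subset_Icc_self hv)) ht0 ht)).2.2
      rw [← hp] at h1
      simp only
      rw [h1]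
      refine ⟨?_, hv⟩
      rw [eq_div_iff (sub_neg.2 ht).ne, hp, linePos]
      ring
    gap_of_shock := fun s γ hγ => S.gap_of_shock h₀ hγ
    shock_of_gap := fun c d hg => S.shock_of_gap h₀ hg
    shock_of_gap_unique := fun c d hg s₁ s₂ γ₁ γ₂ h₁ hr₁ h₂ hr₂ =>
      S.shock_of_gap_unique h₀ hg h₁ hr₁ h₂ hr₂
    left_deriv := fun c d hg s γ hγ hrun => S.hasDerivWithinAt_arriving h₀ hg hγ hrun
    backward_limits := fun c d hg s γ hγ hrun => by
      obtain ⟨h1, h2⟩ := S.tendsto_traces_arriving h₀ hg hγ hrun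
      refine ⟨h1.congr' ?_, h2.congr' ?_,
        S.tracesTendsto (fun p hp => hp.1.1)
          (S.maximizersTendsto_left_of_arriving h₀ hg hγ hrun),
        S.tracesTendsto (fun p hp => hp.1.1)
          (S.maximizersTendsto_right_of_arriving h₀ hg hγ hrun)⟩
      · filter_upwards [Ioo_mem_nhdsLT h₀] with t ht using (S.leftTrace_eq _ ht.1).symm
      · filter_upwards [Ioo_mem_nhdsLT h₀] with t ht using (S.rightTrace_eq _ ht.1).symm }

/-- If the forward characteristic is not a shock at some later time `t₁`, the triangle of its point
at time `t₁` is a single segment, and it passes through `(x₀, t₀)`. -/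
theorem continuityPointStructure (S : IsLaxSolution f φ u) {x₀ t₀ : ℝ} (h₀ : 0 < t₀)
    (h : (x₀, t₀) ∉ shockSet u) : ContinuityPointStructure f φ u x₀ t₀ := by
  have hle : vmax f φ x₀ t₀ ≤ vmin f φ x₀ t₀ := not_lt.1 fun hlt =>
    h (S.mem_shockSet.2 ⟨h₀, hlt⟩)
  have hsing := S.eq_singleton h₀ hle
  obtain ⟨hl, hr, -⟩ := S.eq_of_singleton h₀ hsing
  refine ⟨hl.trans hr.symm, ?_⟩
  rw [hr]
  by_cases hall : ∀ t, t₀ < t → vmin f φ (flow f φ x₀ t₀ t) t < vmax f φ (flow f φ x₀ t₀ t) t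
  · exact Or.inr ⟨_, S.isForwardChar_flow x₀ h₀, S.isShockCurve_flow h₀ hall⟩
  · push Not at hall
    obtain ⟨t₁, ht₁, hle₁⟩ := hall
    have ht₁0 := h₀.trans ht₁
    have hsing₁ := S.eq_singleton ht₁0 hle₁
    have hmem : vmin f φ (flow f φ x₀ t₀ t₁) t₁ ∈ maximizers f φ (flow f φ x₀ t₀ t₁) t₁ :=
      hsing₁ ▸ rfl
    have hreach := S.reaches_flow x₀ h₀ ht₁.le
    rw [reaches_singleton_iff hsing₁] at hreach
    have hmem₀ := S.mem_linePos hmem h₀ ht₁.le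
    rw [← hreach, hsing] at hmem₀
    refine Or.inl ⟨t₁, ht₁, fun t ht => ?_⟩
    rw [← hmem₀]
    have h1 := S.maximizers_linePos hmem ht.1 ht.2
    rw [← linePos_linePos (f := f) _ t₁ _ t₀ t, ← hreach] at h1
    exact h1

end IsLaxSolution

/-! ### The pattern in a region without divides -/

/-- The properties of a region which imply the single-shock pattern: it is open, its sections at
fixed times are intervals, the forward characteristics of its points do not leave it, and it does
not meet any divide. -/
structure IsFlowRegion (f φ : ℝ → ℝ) (H : Set (ℝ × ℝ)) : Prop where
  subset : H ⊆ halfPlane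
  isOpen : IsOpen H
  nonempty : H.Nonempty
  between : ∀ ⦃x y z t : ℝ⦄, (x, t) ∈ H → (y, t) ∈ H → x ≤ z → z ≤ y → (z, t) ∈ H
  flow_mem : ∀ ⦃x s t : ℝ⦄, (x, s) ∈ H → s ≤ t → (flow f φ x s t, t) ∈ H
  disjoint : Disjoint (divideSet f φ) H

theorem FluxData.flow_divide (S : FluxData f φ) {x₀ c s t : ℝ} (h : IsDivide f φ x₀ c)
    (hs : 0 < s) (hst : s ≤ t) :
    flow f φ (x₀ + s * deriv f c) s t = x₀ + t * deriv f c := by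
  refine S.flow_eq hs hst ?_
  rw [reaches_singleton_iff (h t (hs.trans_le hst)), linePos]
  ring

theorem FluxData.eq_of_flow_eq_divide (S : FluxData f φ) {x x₀ c s t : ℝ}
    (h : IsDivide f φ x₀ c) (hs : 0 < s) (hst : s ≤ t)
    (hx : flow f φ x s t = x₀ + t * deriv f c) : x = x₀ + s * deriv f c := by
  have h1 := S.reaches_flow x hs hst
  rw [hx, reaches_singleton_iff (h t (hs.trans_le hst)), linePos] at h1
  rw [h1]
  ring

theorem FluxData.flow_lt_divide (S : FluxData f φ) {x x₀ c s t : ℝ} (h : IsDivide f φ x₀ c)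
    (hs : 0 < s) (hst : s ≤ t) (hx : x < x₀ + s * deriv f c) :
    flow f φ x s t < x₀ + t * deriv f c := by
  refine lt_of_le_of_ne ?_ fun he => hx.ne (S.eq_of_flow_eq_divide h hs hst he)
  rw [← S.flow_divide h hs hst]
  exact S.flow_mono hx.le hs hst

theorem FluxData.divide_lt_flow (S : FluxData f φ) {x x₀ c s t : ℝ} (h : IsDivide f φ x₀ c)
    (hs : 0 < s) (hst : s ≤ t) (hx : x₀ + s * deriv f c < x) :
    x₀ + t * deriv f c < flow f φ x s t := by
  refine lt_of_le_of_ne ?_ fun he => hx.ne (S.eq_of_flow_eq_divide h hs hst he.symm).symm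
  rw [← S.flow_divide h hs hst]
  exact S.flow_mono hx.le hs hst

theorem FluxData.isFlowRegion_of_mem (S : FluxData f φ) (hne : (contactSet φ).Nonempty)
    {H : Set (ℝ × ℝ)} (hH : H ∈ regions f φ) : IsFlowRegion f φ H where
  subset := by
    rcases hH with ⟨e, h, -, rfl⟩ | ⟨-, rfl⟩ | ⟨-, rfl⟩ <;> exact fun p hp => hp.1
  isOpen := isOpen_region hH
  nonempty := nonempty_region hH
  between := by
    intro x y z t hx hy hxz hzy
    rcases hH with ⟨e, h, -, rfl⟩ | ⟨-, rfl⟩ | ⟨-, rfl⟩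
    · exact ⟨hx.1, hx.2.1.trans_le hxz, hzy.trans_lt hy.2.2⟩
    · exact ⟨hx.1, hx.2.trans_le hxz⟩
    · exact ⟨hx.1, hzy.trans_lt hy.2⟩
  flow_mem := by
    intro x s t hx hst
    rcases hH with ⟨e, h, hg, rfl⟩ | ⟨hb, rfl⟩ | ⟨hb, rfl⟩
    · obtain ⟨h1, h2⟩ := S.supports_gapSlope hg
      exact ⟨lt_of_lt_of_le hx.1 hst, S.divide_lt_flow (S.isDivide_iff.2 h1) hx.1 hst hx.2.1,
        S.flow_lt_divide (S.isDivide_iff.2 h2) hx.1 hst hx.2.2⟩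
    · exact ⟨lt_of_lt_of_le hx.1 hst,
        S.divide_lt_flow (S.isDivide_iff.2 (S.supports_sSup hne hb)) hx.1 hst hx.2⟩
    · exact ⟨lt_of_lt_of_le hx.1 hst,
        S.flow_lt_divide (S.isDivide_iff.2 (S.supports_sInf hne hb)) hx.1 hst hx.2⟩
  disjoint := S.disjoint_divideSet hH

theorem isFlowRegion_halfPlane (h : ∀ x₀ c, ¬ IsDivide f φ x₀ c) :
    IsFlowRegion f φ halfPlane where
  subset := Subset.rfl
  isOpen := isOpen_lt continuous_const continuous_snd
  nonempty := ⟨(0, 1), (one_pos : (0 : ℝ) < 1)⟩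
  between _ _ _ _ hx _ _ _ := hx
  flow_mem _ _ _ hx hst := lt_of_lt_of_le (show (0 : ℝ) < _ from hx) hst
  disjoint := disjoint_left.2 fun _ ⟨_, x₀, c, hd, _⟩ => absurd hd (h x₀ c)

namespace IsFlowRegion

variable {H : Set (ℝ × ℝ)}

/-- Forward characteristics which do not meet enclose a divide, so that those in a region without
divides merge. -/
theorem exists_merge (R : IsFlowRegion f φ H) (S : FluxData f φ) {x y T : ℝ} (hx : (x, T) ∈ H)
    (hy : (y, T) ∈ H) (hxy : x ≤ y) :
    ∃ T', T < T' ∧ ∀ t, T' ≤ t → flow f φ x T t = flow f φ y T t := by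
  have hT : 0 < T := R.subset hx
  have hex : ∃ t, T ≤ t ∧ flow f φ y T t ≤ flow f φ x T t := by
    by_contra! hcon
    obtain ⟨x₀, c, hd, h1, h2⟩ := S.exists_divide_between hT hcon
    exact disjoint_left.1 R.disjoint ⟨hT, x₀, c, hd, rfl⟩ (R.between hx hy h1 h2)
  obtain ⟨t₁, ht₁, hle⟩ := hex
  have heq := le_antisymm (S.flow_mono hxy hT ht₁) hle
  refine ⟨t₁ + 1, by linarith, fun t ht => ?_⟩
  have ht' : t₁ ≤ t := by linarith
  rw [← S.flow_flow x hT ht₁ ht', heq, S.flow_flow y hT ht₁ ht']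

theorem flow_eq_of_isShockCurve (S : IsLaxSolution f φ u) {γ : ℝ → ℝ} {t₀ T t : ℝ}
    (hγ : IsShockCurve u t₀ γ) (hT : t₀ < T) (ht : T ≤ t) : flow f φ (γ T) T t = γ t :=
  S.flow_eq_of_curve (hγ.1.trans_lt hT) ht
    (hγ.2.1.mono fun _ hr => hT.le.trans hr.1) fun r hr =>
      (S.mem_shockSet.1 (hγ.2.2 r (hT.trans_le hr.1))).2

theorem merge (R : IsFlowRegion f φ H) (S : IsLaxSolution f φ u) {t₁ t₂ : ℝ} {γ₁ γ₂ : ℝ → ℝ}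
    (h₁ : IsShockCurve u t₁ γ₁) (h₂ : IsShockCurve u t₂ γ₂) (hH₁ : ∀ t, t₁ < t → (γ₁ t, t) ∈ H)
    (hH₂ : ∀ t, t₂ < t → (γ₂ t, t) ∈ H) :
    ∃ T, t₁ ≤ T ∧ t₂ ≤ T ∧ ∀ t, T ≤ t → γ₁ t = γ₂ t := by
  set T := max t₁ t₂ + 1 with hT
  have hT₁ : t₁ < T := (le_max_left _ _).trans_lt (lt_add_one _)
  have hT₂ : t₂ < T := (le_max_right _ _).trans_lt (lt_add_one _)
  have key : ∃ T', T < T' ∧ ∀ t, T' ≤ t → flow f φ (γ₁ T) T t = flow f φ (γ₂ T) T t := by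
    rcases le_total (γ₁ T) (γ₂ T) with h | h
    · exact R.exists_merge S.toFluxData (hH₁ T hT₁) (hH₂ T hT₂) h
    · obtain ⟨T', h1, h2⟩ := R.exists_merge S.toFluxData (hH₂ T hT₂) (hH₁ T hT₁) h
      exact ⟨T', h1, fun t ht => (h2 t ht).symm⟩
  obtain ⟨T', hT', heq⟩ := key
  refine ⟨T', (hT₁.trans hT').le, (hT₂.trans hT').le, fun t ht => ?_⟩
  rw [← flow_eq_of_isShockCurve S h₁ hT₁ (hT'.le.trans ht),
    ← flow_eq_of_isShockCurve S h₂ hT₂ (hT'.le.trans ht), heq t ht]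

/-- The region contains a shock: two forward characteristics merge, and the points of a single
backward characteristic do not. -/
theorem exists_shock (R : IsFlowRegion f φ H) (S : IsLaxSolution f φ u) :
    (shockSet u ∩ H).Nonempty := by
  obtain ⟨⟨x, T⟩, hx⟩ := R.nonempty
  have hT : 0 < T := R.subset hx
  have hnear : ∀ᶠ y in 𝓝[>] x, (y, T) ∈ H :=
    nhdsWithin_le_nhds (((Continuous.prodMk_left T).tendsto x).eventually (R.isOpen.mem_nhds hx))
  obtain ⟨y, hy, hxy⟩ := (hnear.and self_mem_nhdsWithin).exists
  have hxy : x < y := hxy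
  obtain ⟨T', hT', heq⟩ := R.exists_merge S.toFluxData hx hy hxy.le
  have hT'0 := hT.trans hT'
  have he := heq T' le_rfl
  refine ⟨(flow f φ x T T', T'), S.mem_shockSet.2 ⟨hT'0, ?_⟩, R.flow_mem hx hT'.le⟩
  by_contra! hle
  have hsing := S.eq_singleton hT'0 hle
  have h1 := S.reaches_flow x hT hT'.le
  have h2 := S.reaches_flow y hT hT'.le
  rw [← he] at h2
  rw [reaches_singleton_iff hsing] at h1 h2
  exact hxy.ne (h1.trans h2.symm)

/-- The flow carries a compact set and the shock to a compact set of positions at a common later time;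
when the extreme ones have merged, so have all those between them. -/
theorem turnsIntoSingleShock (R : IsFlowRegion f φ H) (S : IsLaxSolution f φ u) :
    TurnsIntoSingleShock f u H := by
  obtain ⟨⟨x₀, t₀⟩, hs, hH⟩ := R.exists_shock S
  have h₀ : 0 < t₀ := R.subset hH
  refine ⟨t₀, flow f φ x₀ t₀, S.isShockCurve_flow_of_mem hs,
    fun t ht => R.flow_mem hH ht.le, fun K hKH hK => ?_⟩
  obtain ⟨M, hM⟩ := (hK.image continuous_snd).bddAbove
  set T₀ := max M t₀ with hT₀
  have hKT : ∀ p ∈ K, p.2 ≤ T₀ := fun p hp =>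
    (hM (mem_image_of_mem _ hp)).trans (le_max_left _ _)
  have ht₀T : t₀ ≤ T₀ := le_max_right _ _
  have hT₀0 : 0 < T₀ := h₀.trans_le ht₀T
  -- the positions at time `T₀` of the characteristics from `K` and of the shock
  set A : Set ℝ := insert (flow f φ x₀ t₀ T₀) ((fun p : ℝ × ℝ => flow f φ p.1 p.2 T₀) '' K) with hA
  have hAc : IsCompact A := (hK.image_of_continuousOn
    (S.continuousOn_flow.mono fun p hp => ⟨R.subset (hKH hp), hKT p hp⟩)).insert _
  have hAH : ∀ a ∈ A, (a, T₀) ∈ H := by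
    rintro a (rfl | ⟨p, hp, rfl⟩)
    · exact R.flow_mem hH ht₀T
    · exact R.flow_mem (hKH hp) (hKT p hp)
  have hAne : A.Nonempty := ⟨_, mem_insert _ _⟩
  have hlo := hAc.isLeast_sInf hAne
  have hhi := hAc.isGreatest_sSup hAne
  obtain ⟨T, hT, heq⟩ := R.exists_merge S.toFluxData (hAH _ hlo.1) (hAH _ hhi.1) (hlo.2 hhi.1)
  have hall : ∀ a ∈ A, ∀ t, T ≤ t → flow f φ a T₀ t = flow f φ (sInf A) T₀ t := by
    intro a ha t ht
    refine le_antisymm ?_ (S.flow_mono (hlo.2 ha) hT₀0 (hT.le.trans ht))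
    rw [heq t ht]
    exact S.flow_mono (hhi.2 ha) hT₀0 (hT.le.trans ht)
  refine ⟨T, ht₀T.trans_lt hT, fun p hp => ?_⟩
  have hp0 : 0 < p.2 := R.subset (hKH hp)
  refine ⟨(hKT p hp).trans hT.le, ⟨_, S.isForwardChar_flow p.1 hp0⟩, fun X hX t ht => ?_⟩
  have htT := hT.le.trans ht
  rw [(S.isForwardChar_iff hp0).1 hX t ((hKT p hp).trans htT),
    ← S.flow_flow p.1 hp0 (hKT p hp) htT, ← S.flow_flow x₀ h₀ ht₀T htT,
    hall _ (mem_insert_of_mem _ ⟨p, hp, rfl⟩) t ht, hall _ (mem_insert _ _) t ht]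

theorem joinedIn_flow (R : IsFlowRegion f φ H) (S : IsLaxSolution f φ u) {p : ℝ × ℝ}
    (hp : p ∈ shockSet u ∩ H) {T : ℝ} (hT : p.2 ≤ T) :
    JoinedIn (shockSet u ∩ H) p (flow f φ p.1 p.2 T, T) := by
  have hp0 : 0 < p.2 := R.subset hp.2
  have hmem : ∀ r ∈ unitInterval, p.2 ≤ p.2 + r * (T - p.2) := fun r hr =>
    le_add_of_nonneg_right (mul_nonneg hr.1 (sub_nonneg.2 hT))
  refine JoinedIn.ofLine
    (f := fun r : ℝ => (flow f φ p.1 p.2 (p.2 + r * (T - p.2)), p.2 + r * (T - p.2))) ?_ ?_ ?_ ?_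
  · refine ContinuousOn.prodMk ?_ (by fun_prop)
    exact (S.continuousOn_flow_time p.1 hp0).comp (by fun_prop) hmem
  · simp [S.flow_self p.1 hp0]
  · simp
  · rintro _ ⟨r, hr, rfl⟩
    have h1 := hmem r hr
    have hpt : (p.1, p.2) ∈ H := hp.2
    refine ⟨S.mem_shockSet.2 ⟨hp0.trans_le h1, ?_⟩, R.flow_mem hpt h1⟩
    exact S.vmin_lt_vmax_of_reaches hp0 h1 (S.reaches_flow p.1 hp0 h1) (S.mem_shockSet.1 hp.1).2

/-- Points of the shock set are joined by following their forward characteristics until these merge. -/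
theorem isPathConnected (R : IsFlowRegion f φ H) (S : IsLaxSolution f φ u) :
    IsPathConnected (shockSet u ∩ H) := by
  rw [isPathConnected_iff]
  refine ⟨R.exists_shock S, fun p hp q hq => ?_⟩
  have hγ := fun (p : ℝ × ℝ) (hp : p ∈ shockSet u ∩ H) =>
    S.isShockCurve_flow_of_mem (x₀ := p.1) (t₀ := p.2) hp.1
  have hH := fun (p : ℝ × ℝ) (hp : p ∈ shockSet u ∩ H) t (ht : p.2 < t) =>
    R.flow_mem (x := p.1) (s := p.2) hp.2 ht.le
  obtain ⟨T, h1, h2, heq⟩ := R.merge S (hγ p hp) (hγ q hq) (hH p hp) (hH q hq)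
  have h3 := R.joinedIn_flow S hp h1
  have h4 := R.joinedIn_flow S hq h2
  rw [← heq T le_rfl] at h4
  exact h3.trans h4.symm

theorem singleShockPattern (R : IsFlowRegion f φ H) (S : IsLaxSolution f φ u) :
    SingleShockPattern f φ u H where
  merge _ _ _ _ h₁ h₂ hH₁ hH₂ := R.merge S h₁ h₂ hH₁ hH₂
  pathConnected := R.isPathConnected S
  single := R.turnsIntoSingleShock S
  fine _ hp := S.fineStructure hp.1
  continuity _ hp := S.continuityPointStructure (R.subset hp.1) hp.2

end IsFlowRegion

/-! ### Rarefaction waves and divides -/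

theorem IsLaxSolution.deriv_eq_of_between (S : IsLaxSolution f φ u) {x₀ x t : ℝ}
    (hx₀ : x₀ ∈ contactSet φ) (ht : 0 < t) (h1 : x₀ + t * deriv f (hullLeftDeriv φ x₀) < x)
    (h2 : x < x₀ + t * deriv f (hullRightDeriv φ x₀)) : deriv f (u x t) = (x - x₀) / t := by
  obtain ⟨c₀, hc₀⟩ := S.mem_contactSet.1 hx₀
  have hc := (S.supports_iff hx₀).1 hc₀
  obtain ⟨c, hc, hdc⟩ := S.flux.exists_deriv_eq (p := (x - x₀) / t) (hc.1.trans hc.2)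
    (by rw [le_div_iff₀ ht]; linarith) (by rw [div_le_iff₀ ht]; linarith)
  have hd := S.isDivide_iff.2 ((S.supports_iff hx₀).2 hc) t ht
  rw [hdc, mul_div_cancel₀ _ ht.ne', add_sub_cancel] at hd
  rw [(S.eq_of_singleton ht hd).2.2, hdc]

theorem FluxData.gap_slopes (S : FluxData f φ) {e h : ℝ} (hg : IsGap (contactSet φ) e h) :
    hullRightDeriv φ e = gapSlope φ e h ∧ hullLeftDeriv φ h = gapSlope φ e h := by
  obtain ⟨h1, h2⟩ := S.supports_gapSlope hg
  have b1 := (S.supports_iff hg.2.1).1 h1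
  have b2 := (S.supports_iff hg.2.2.1).1 h2
  -- the one-sided derivatives are themselves slopes of supporting lines
  have s1 := (S.supports_iff hg.2.1).2 ⟨b1.1.trans b1.2, le_rfl⟩
  have s2 := (S.supports_iff hg.2.2.1).2 ⟨le_rfl, b2.1.trans b2.2⟩
  exact ⟨le_antisymm (s1.slope_mono h2 hg.1) b1.2, le_antisymm b2.1 (h1.slope_mono s2 hg.1)⟩

end

end ScalarLaw

open ScalarLaw in
theorem theorem6p3 (f : ℝ → ℝ) (hf : IsFlux f) (φ : ℝ → ℝ) (hφ : MemLp φ ⊤ volume)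
    (u : ℝ → ℝ → ℝ) (hu : IsEntropySolution f φ u) :
    -- (i) the case with divides
    ((upperMeanLeft φ < lowerMeanRight φ ∨
        (upperMeanLeft φ = lowerMeanRight φ ∧ (contactSet φ).Nonempty)) →
      -- existence, locations and speeds of the divides
      (∃ x₀ c, IsDivide f φ x₀ c) ∧
      (∀ x, hull φ x ≠ ⊥) ∧
      (∀ x₀ c, IsDivide f φ x₀ c ↔
        x₀ ∈ contactSet φ ∧ hullLeftDeriv φ x₀ ≤ c ∧ c ≤ hullRightDeriv φ x₀) ∧
      (∀ x₀ ∈ contactSet φ, hullLeftDeriv φ x₀ ≤ hullRightDeriv φ x₀) ∧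
      (∀ x₀ ∈ contactSet φ, ∀ x t, 0 < t →
        x₀ + t * deriv f (hullLeftDeriv φ x₀) < x → x < x₀ + t * deriv f (hullRightDeriv φ x₀) →
        deriv f (u x t) = (x - x₀) / t) ∧
      (upperMeanLeft φ = lowerMeanRight φ →
        ∀ x₀ c, IsDivide f φ x₀ c ↔ x₀ ∈ contactSet φ ∧ c = lowerMeanRight φ) ∧
      -- the boundaries of the regions are divides
      (∀ e h, IsGap (contactSet φ) e h →
        hullRightDeriv φ e = gapSlope φ e h ∧ hullLeftDeriv φ h = gapSlope φ e h ∧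
        IsDivide f φ e (gapSlope φ e h) ∧ IsDivide f φ h (gapSlope φ e h)) ∧
      (BddAbove (contactSet φ) → IsDivide f φ (sSup (contactSet φ)) (lowerMeanRight φ)) ∧
      (BddBelow (contactSet φ) → IsDivide f φ (sInf (contactSet φ)) (upperMeanLeft φ)) ∧
      -- the partition of the half-plane
      (halfPlane = divideSet f φ ∪ ⋃₀ regions f φ) ∧
      (regions f φ).Countable ∧
      (regions f φ).PairwiseDisjoint id ∧
      (∀ H ∈ regions f φ, Disjoint (divideSet f φ) H) ∧
      -- no shocks on the divides
      (∀ p ∈ divideSet f φ, leftTrace u p.1 p.2 = rightTrace u p.1 p.2) ∧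
      -- the pattern in each region
      ∀ H ∈ regions f φ, SingleShockPattern f φ u H) ∧
    -- (ii) the case without divides
    ((lowerMeanRight φ < upperMeanLeft φ ∨
        (upperMeanLeft φ = lowerMeanRight φ ∧ contactSet φ = ∅)) →
      (∀ x₀ c, ¬ IsDivide f φ x₀ c) ∧ SingleShockPattern f φ u halfPlane) := by
  have S : IsLaxSolution f φ u := IsSolution.isLaxSolution ⟨⟨hf, hφ⟩, hu⟩
  constructor
  · intro hcase
    have hne : (contactSet φ).Nonempty := by
      rcases hcase with h | ⟨-, h⟩
      · obtain ⟨x₀, c, hc⟩ := S.exists_supports h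
        exact ⟨x₀, S.mem_contactSet.2 ⟨c, hc⟩⟩
      · exact h
    obtain ⟨x₁, hx₁⟩ := hne
    obtain ⟨c₁, hc₁⟩ := S.mem_contactSet.1 hx₁
    have hne : (contactSet φ).Nonempty := ⟨x₁, hx₁⟩
    refine ⟨⟨x₁, c₁, S.isDivide_iff.2 hc₁⟩, S.hull_ne_bot hc₁, fun x₀ c => ?_, fun x₀ hx₀ => ?_,
      fun x₀ hx₀ x t ht h1 h2 => S.deriv_eq_of_between hx₀ ht h1 h2, fun heq x₀ c => ?_,
      fun e h hg => ?_, fun hb => S.isDivide_iff.2 (S.supports_sSup hne hb),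
      fun hb => S.isDivide_iff.2 (S.supports_sInf hne hb), S.halfPlane_eq hne,
      S.countable_regions hne, S.pairwiseDisjoint_regions hne,
      fun H hH => S.disjoint_divideSet hH, ?_,
      fun H hH => (S.isFlowRegion_of_mem hne hH).singleShockPattern S⟩
    · rw [S.isDivide_iff]
      exact ⟨fun h => ⟨S.mem_contactSet.2 ⟨c, h⟩,
        (S.supports_iff (S.mem_contactSet.2 ⟨c, h⟩)).1 h⟩, fun h => (S.supports_iff h.1).2 h.2⟩
    · obtain ⟨c, hc⟩ := S.mem_contactSet.1 hx₀
      exact ((S.supports_iff hx₀).1 hc).1.trans ((S.supports_iff hx₀).1 hc).2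
    · have hslope : ∀ {x₀ c : ℝ}, Supports φ x₀ c → c = lowerMeanRight φ := fun h =>
        le_antisymm (S.slope_le_lowerMeanRight h) (heq ▸ S.upperMeanLeft_le_slope h)
      rw [S.isDivide_iff]
      constructor
      · exact fun h => ⟨S.mem_contactSet.2 ⟨c, h⟩, hslope h⟩
      · rintro ⟨hx₀, rfl⟩
        obtain ⟨c, hc⟩ := S.mem_contactSet.1 hx₀
        rwa [hslope hc] at hc
    · obtain ⟨h1, h2⟩ := S.supports_gapSlope hg
      exact ⟨(S.gap_slopes hg).1, (S.gap_slopes hg).2, S.isDivide_iff.2 h1, S.isDivide_iff.2 h2⟩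
    · rintro ⟨x, t⟩ ⟨ht, x₀, c, hd, hp⟩
      have hsing := hd t ht
      rw [← show x = x₀ + t * deriv f c from hp] at hsing
      obtain ⟨h1, h2, -⟩ := S.eq_of_singleton ht hsing
      exact h1.trans h2.symm
  · intro hcase
    have hno : ∀ x₀ c, ¬ IsDivide f φ x₀ c := by
      intro x₀ c hd
      have hs := S.isDivide_iff.1 hd
      rcases hcase with h | ⟨-, h⟩
      · exact h.not_ge ((S.upperMeanLeft_le_slope hs).trans (S.slope_le_lowerMeanRight hs))
      · have : x₀ ∈ contactSet φ := S.mem_contactSet.2 ⟨c, hs⟩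
        rw [h] at this
        exact this
    exact ⟨hno, (isFlowRegion_halfPlane hno).singleShockPattern S⟩
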